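/- Let $\Sigma=\{0,1\}$ and let $\Gamma=\langle\tau,\mu\rangle$ be the Brunner–Sidki–Vieira group, acting on the right on the set of words $\Sigma^*$ by $\emptyset^\tau=\emptyset^\mu=\emptyset$ and $$(0w)^\tau=1w,\quad (1w)^\tau=0\,w^{\tau},\qquad (0w)^\mu=1w,\quad (1w)^\mu=0\,w^{\mu^{-1}}.$$ Let $\Gamma_1=\Gamma$ and $\Gamma_n=[\Gamma,\Gamma_{n-1}]\,\Gamma_{\lceil n/2\rceil}^2$ for $n\ge2$ (where $H^2$ is the subgroup generated by the squares of elements of $H$) be the $2$-dimension series of $\Gamma$, and let $$\mathrm{Lie}(\Gamma)=\bigoplus_{n\ge1}\Gamma_n/\Gamma_{n+1}$$ be the associated restricted graded Lie algebra over $\mathbb F_2$, with bracket induced by commutation and Frobenius map $v\mapsto v^2$ induced by squaring. The degree of $g\in\Gamma$ is the largest $n\in\mathbb N\cup\{\infty\}$ with $g\in\Gamma_n$; an element $g$ of finite degree $n$ represents the homogeneous element $g\Gamma_{n+1}$ of $\mathrm{Lie}(\Gamma)$. Write $(g,h)$ for the permutation of $\Sigma^*$ that acts as $g$ on $0\Sigma^*$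 and as $h$ on $1\Sigma^*$. The derived subgroup $\Gamma'$ contains $\Gamma'\times\Gamma'$, so $\mathbf 8(g)=(g,1)$ and $\mathbf 9(g)=(g,g)$ define endomorphisms of $\Gamma'$. Let $c=[\tau,\mu]=\tau^{-1}\mu^{-1}\tau\mu\in\Gamma'$, and for a word $W=W_1\cdots W_m\in\{\mathbf 8,\mathbf 9\}^m$ put $W(c)=W_1(W_2(\cdots W_m(c)))$. In sums, $\mathbf 8$ stands for the digit $0$ and $\mathbf 9$ for the digit $1$. **Theorem.** The following elements form a basis of $\mathrm{Lie}(\Gamma)$ over $\mathbb F_2$: - $\tau^{2^n}$ for all $n\in\mathbb N$, of degree $2^n$; - $\mu^{2^n}$ for all $n\in\mathbb N$, of degree $2^n$; - $W(c)^{2^n}$ for all $m,n\in\mathbb N$ and $W\in\{\mathbf 8,\mathbf 9\}^m$, of degree $2^n\bigl(\sum_{i=1}^m W_i2^{i-1}+2^m+1\bigr)$. (Here $\mathbb N$ contains $0$, and distinct labels give distinct basis vectors.) In $\mathrm{Lie}(\Gamma)$ one has, for all $n\in\mathbb N$ and all words $W\in\{\mathbf 8,\mathbf 9\}^*$: - $[\tau^{2^n},\mu]=\mathbf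 8^n(c)$ and $[\mu^{2^n},\tau]=\mathbf 8^n(c)$; - $[\mathbf 9^n(c),\tau]=[\mathbf 9^n(c),\mu]=\mathbf 8^{n+1}(c)$; - $[\mathbf 9^n\mathbf 8W(c),\tau]=[\mathbf 9^n\mathbf 8W(c),\mu]=\mathbf 8^n\mathbf 9W(c)$; - the Frobenius map sends the basis vector $v^{2^n}$ to the basis vector $v^{2^{n+1}}$, for $v=\tau$, $v=\mu$ and $v=W(c)$. These are all the arrows of the Lie graph: every other bracket of a basis vector with $\tau$ or $\mu$ vanishes, that is, $[\tau^{2^n},\tau]=0$, $[\mu^{2^n},\mu]=0$ and $[W(c)^{2^{n+1}},\tau]=[W(c)^{2^{n+1}},\mu]=0$. -/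

import Mathlib

open scoped DirectSum commutatorElement

/-! ### The 2-dimension series of a group -/

/-- The 2-dimension series `Γ₁ = Γ`, `Γₙ = [Γ, Γₙ₋₁] · (Γ_⌈n/2⌉)²`, where `H²` is the subgroup
generated by the squares of the elements of `H`. The value at the index `0` is the convention
`Γ₀ = Γ`. -/
def dimSeries (G : Type*) [Group G] : ℕ → Subgroup G
  | 0 => ⊤
  | 1 => ⊤
  | (n + 2) => ⁅(⊤ : Subgroup G), dimSeries G (n + 1)⁆ ⊔
      Subgroup.closure {g | ∃ h ∈ dimSeries G ((n + 3) / 2), g = h ^ 2}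
  termination_by n => n
  decreasing_by all_goals omega

section DimensionSeries

theorem dimSeries_zero (G : Type*) [Group G] : dimSeries G 0 = ⊤ := by
  rw [dimSeries]

theorem dimSeries_one (G : Type*) [Group G] : dimSeries G 1 = ⊤ := by
  rw [dimSeries]

theorem dimSeries_add_two (G : Type*) [Group G] (n : ℕ) :
    dimSeries G (n + 2) = ⁅(⊤ : Subgroup G), dimSeries G (n + 1)⁆ ⊔
      Subgroup.closure {g | ∃ h ∈ dimSeries G ((n + 3) / 2), g = h ^ 2} := by
  rw [dimSeries]

theorem sq_mem_dimSeries {G : Type*} [Group G] (n : ℕ) {x : G} (hx : x ∈ dimSeries G n) :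
    x ^ 2 ∈ dimSeries G (2 * n) := by
  rcases n with _ | n
  · simp [dimSeries_zero]
  · have e : 2 * (n + 1) = 2 * n + 2 := by ring
    rw [e, dimSeries_add_two]
    refine Subgroup.mem_sup_right (Subgroup.subset_closure ⟨x, ?_, rfl⟩)
    have : (2 * n + 3) / 2 = n + 1 := by omega
    rwa [this]

instance dimSeries_normal (G : Type*) [Group G] (n : ℕ) : (dimSeries G n).Normal := by
  induction n using Nat.strong_induction_on with
  | _ n ih =>
    match n, ih with
    | 0, _ => rw [dimSeries_zero]; infer_instance
    | 1, _ => rw [dimSeries_one]; infer_instance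
    | n + 2, ih =>
      rw [dimSeries_add_two]
      have h1 := ih (n + 1) (by omega)
      have h2 := ih ((n + 3) / 2) (by omega)
      have h3 : (Subgroup.closure {g : G | ∃ h ∈ dimSeries G ((n + 3) / 2), g = h ^ 2}).Normal := by
        refine ⟨fun x hx g => ?_⟩
        induction hx using Subgroup.closure_induction with
        | mem x hx =>
          obtain ⟨h, hh, rfl⟩ := hx
          exact Subgroup.subset_closure ⟨g * h * g⁻¹, h2.conj_mem h hh g, by rw [conj_pow]⟩
        | one => simp
        | mul x y _ _ hx hy => rw [← conj_mul]; exact mul_mem hx hy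
        | inv x _ hx => rw [← conj_inv]; exact inv_mem hx
      infer_instance

theorem dimSeries_succ_le (G : Type*) [Group G] (n : ℕ) :
    dimSeries G (n + 1) ≤ dimSeries G n := by
  induction n using Nat.strong_induction_on with
  | _ n ih =>
    match n, ih with
    | 0, _ => rw [dimSeries_zero]; exact le_top
    | 1, _ => rw [dimSeries_one]; exact le_top
    | n + 2, ih =>
      have ih1 := ih (n + 1) (by omega)
      rw [dimSeries_add_two G (n + 1), dimSeries_add_two G n]
      refine sup_le_sup (Subgroup.commutator_mono le_rfl ?_) (Subgroup.closure_mono ?_)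
      · rw [← dimSeries_add_two]
        exact ih1
      rintro _ ⟨h, hh, rfl⟩
      refine ⟨h, ?_, rfl⟩
      by_cases he : (n + 1 + 3) / 2 = (n + 3) / 2
      · rwa [← he]
      · have : (n + 1 + 3) / 2 = (n + 3) / 2 + 1 := by omega
        rw [this] at hh
        exact ih _ (by omega) hh

theorem dimSeries_antitone (G : Type*) [Group G] : Antitone (dimSeries G) :=
  antitone_nat_of_succ_le (dimSeries_succ_le G)

theorem commutator_top_dimSeries_le (G : Type*) [Group G] (n : ℕ) :
    ⁅(⊤ : Subgroup G), dimSeries G n⁆ ≤ dimSeries G (n + 1) := by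
  rcases n with _ | n
  · rw [zero_add, dimSeries_one]; exact le_top
  · rw [dimSeries_add_two]; exact le_sup_left

theorem commutator_le_iff_le_comap {G : Type*} [Group G] (H D N : Subgroup G) [N.Normal] :
    ⁅H, D⁆ ≤ N ↔ H ≤ (Subgroup.centralizer
      (D.map (QuotientGroup.mk' N) : Set (G ⧸ N))).comap (QuotientGroup.mk' N) := by
  rw [← Subgroup.map_le_iff_le_comap, ← Subgroup.commutator_eq_bot_iff_le_centralizer,
    ← Subgroup.map_commutator, Subgroup.map_eq_bot_iff, QuotientGroup.ker_mk']

theorem commutator_dimSeries_le (G : Type*) [Group G] (m n : ℕ) :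
    ⁅dimSeries G m, dimSeries G n⁆ ≤ dimSeries G (m + n) := by
  induction m using Nat.strong_induction_on generalizing n with
  | _ m ih =>
    match m, ih with
    | 0, _ =>
      rw [zero_add]
      exact Subgroup.commutator_le_right _ _
    | 1, _ =>
      rw [dimSeries_one, add_comm]
      exact commutator_top_dimSeries_le G n
    | m + 2, ih =>
      rw [commutator_le_iff_le_comap]
      conv_lhs => rw [dimSeries_add_two]
      rw [sup_le_iff, Subgroup.closure_le]
      constructor
      · rw [← commutator_le_iff_le_comap]
        have key : ∀ q : G →* G ⧸ dimSeries G (m + 2 + n), q = QuotientGroup.mk' _ →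
            ⁅⁅(⊤ : Subgroup G).map q, (dimSeries G (m + 1)).map q⁆, (dimSeries G n).map q⁆ = ⊥ := by
          rintro q rfl
          apply Subgroup.commutator_commutator_eq_bot_of_rotate
          · rw [← Subgroup.map_commutator, ← Subgroup.map_commutator, Subgroup.map_eq_bot_iff,
              QuotientGroup.ker_mk']
            rw [Subgroup.commutator_comm]
            refine (Subgroup.commutator_mono le_rfl (ih (m + 1) (by omega) n)).trans ?_
            refine (commutator_top_dimSeries_le G _).trans (dimSeries_antitone G (by omega))
          · rw [← Subgroup.map_commutator, ← Subgroup.map_commutator, Subgroup.map_eq_bot_iff,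
              QuotientGroup.ker_mk']
            rw [Subgroup.commutator_comm, Subgroup.commutator_comm (dimSeries G n)]
            refine (Subgroup.commutator_mono le_rfl (commutator_top_dimSeries_le G n)).trans ?_
            refine (ih (m + 1) (by omega) (n + 1)).trans (dimSeries_antitone G (by omega))
        have := key _ rfl
        rwa [← Subgroup.map_commutator, ← Subgroup.map_commutator, Subgroup.map_eq_bot_iff,
              QuotientGroup.ker_mk'] at this
      · rintro _ ⟨h, hh, rfl⟩
        have hcomm : ∀ y ∈ dimSeries G n, ⁅h ^ 2, y⁆ ∈ dimSeries G (m + 2 + n) := by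
          intro y hy
          have h1 : ⁅h, y⁆ ∈ dimSeries G ((m + 3) / 2 + n) :=
            ih _ (by omega) n (Subgroup.commutator_mem_commutator hh hy)
          have h2 : ⁅h, ⁅h, y⁆⁆ ∈ dimSeries G ((m + 3) / 2 + ((m + 3) / 2 + n)) :=
            ih _ (by omega) _ (Subgroup.commutator_mem_commutator hh h1)
          have h3 := sq_mem_dimSeries _ h1
          have e : ⁅h ^ 2, y⁆ = ⁅h, ⁅h, y⁆⁆ * ⁅h, y⁆ ^ 2 := by
            simp only [commutatorElement_def, pow_two]; group
          rw [e]
          exact mul_mem (dimSeries_antitone G (by omega) h2) (dimSeries_antitone G (by omega) h3)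
        have : ⁅Subgroup.closure {h ^ 2}, dimSeries G n⁆ ≤ dimSeries G (m + 2 + n) := by
          rw [commutator_le_iff_le_comap, Subgroup.closure_le, Set.singleton_subset_iff]
          rintro _ ⟨y, hy, rfl⟩
          have := hcomm y hy
          rw [← QuotientGroup.eq_one_iff, ← QuotientGroup.mk'_apply, map_commutatorElement,
            commutatorElement_eq_one_iff_mul_comm] at this
          exact this.symm
        rw [commutator_le_iff_le_comap, Subgroup.closure_le, Set.singleton_subset_iff] at this
        exact this

theorem quotient_comm_of_mem {G : Type*} [Group G] {k : ℕ} {a : G} (ha : a ∈ dimSeries G k)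
    (g : G) : (QuotientGroup.mk a : G ⧸ dimSeries G (k + 1)) * QuotientGroup.mk g =
      QuotientGroup.mk g * QuotientGroup.mk a := by
  have h : ⁅g, a⁆ ∈ dimSeries G (k + 1) :=
    commutator_top_dimSeries_le G k (Subgroup.commutator_mem_commutator (Subgroup.mem_top g) ha)
  rw [← QuotientGroup.eq_one_iff, ← QuotientGroup.mk'_apply, map_commutatorElement,
    commutatorElement_eq_one_iff_mul_comm] at h
  exact h.symm

theorem comm_mem_dimSeries {G : Type*} [Group G] {m n : ℕ} {x y : G} (hx : x ∈ dimSeries G m)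
    (hy : y ∈ dimSeries G n) : x⁻¹ * y⁻¹ * x * y ∈ dimSeries G (m + n) := by
  have := commutator_dimSeries_le G m n
    (Subgroup.commutator_mem_commutator (inv_mem hx) (inv_mem hy))
  simpa [commutatorElement_def] using this

end DimensionSeries

/-! ### The homogeneous components `Γₙ / Γₙ₊₁` -/

/-- The elementary abelian 2-group `Γₙ / Γₙ₊₁`, written additively. For `n = 0` it is trivial. -/
def Gr (G : Type*) [Group G] (n : ℕ) : Type _ :=
  Additive (dimSeries G n ⧸ (dimSeries G (n + 1)).subgroupOf (dimSeries G n))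

section Components

instance (G : Type*) [Group G] (n : ℕ) : AddGroup (Gr G n) :=
  inferInstanceAs (AddGroup (Additive
    (dimSeries G n ⧸ (dimSeries G (n + 1)).subgroupOf (dimSeries G n))))

/-- The class in `Γₙ / Γₙ₊₁` of an element of `Γₙ`. -/
def Gr.mk {G : Type*} [Group G] {n : ℕ} (x : dimSeries G n) : Gr G n :=
  Additive.ofMul (QuotientGroup.mk x)

theorem Gr.mk_mul {G : Type*} [Group G] {n : ℕ} (x y : dimSeries G n) :
    Gr.mk (x * y) = Gr.mk x + Gr.mk y := rfl

theorem Gr.mk_inv {G : Type*} [Group G] {n : ℕ} (x : dimSeries G n) :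
    Gr.mk x⁻¹ = - Gr.mk x := rfl

theorem Gr.exists_mk {G : Type*} [Group G] {n : ℕ} (a : Gr G n) :
    ∃ x : dimSeries G n, Gr.mk x = a :=
  QuotientGroup.mk_surjective (s := (dimSeries G (n + 1)).subgroupOf (dimSeries G n)) a

theorem Gr.mk_eq_mk {G : Type*} [Group G] {n : ℕ} {x y : dimSeries G n} :
    Gr.mk x = Gr.mk y ↔ (QuotientGroup.mk (x : G) : G ⧸ dimSeries G (n + 1)) =
      QuotientGroup.mk (y : G) := by
  refine Iff.trans (QuotientGroup.eq (s := (dimSeries G (n + 1)).subgroupOf (dimSeries G n)))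
    (Iff.trans ?_ QuotientGroup.eq.symm)
  rw [Subgroup.mem_subgroupOf]
  rfl

theorem Gr.mk_eq_zero {G : Type*} [Group G] {n : ℕ} {x : dimSeries G n} :
    Gr.mk x = 0 ↔ (x : G) ∈ dimSeries G (n + 1) := by
  have : (0 : Gr G n) = Gr.mk 1 := rfl
  rw [this, Gr.mk_eq_mk, OneMemClass.coe_one, QuotientGroup.mk_one, QuotientGroup.eq_one_iff]

instance (G : Type*) [Group G] (n : ℕ) : AddCommGroup (Gr G n) where
  add_comm a b := by
    obtain ⟨x, rfl⟩ := a.exists_mk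
    obtain ⟨y, rfl⟩ := b.exists_mk
    rw [← Gr.mk_mul, ← Gr.mk_mul, Gr.mk_eq_mk]
    exact quotient_comm_of_mem x.2 y

theorem Gr.two_nsmul {G : Type*} [Group G] {n : ℕ} (a : Gr G n) : 2 • a = 0 := by
  obtain ⟨x, rfl⟩ := a.exists_mk
  rw [_root_.two_nsmul, ← Gr.mk_mul, Gr.mk_eq_zero]
  have h := sq_mem_dimSeries n x.2
  rw [pow_two] at h
  rcases n with _ | n
  · rw [zero_add, dimSeries_one]; trivial
  · exact dimSeries_antitone G (by omega) h

instance (G : Type*) [Group G] (n : ℕ) : Module (ZMod 2) (Gr G n) :=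
  AddCommGroup.zmodModule (fun a => a.two_nsmul)

/-- A homomorphism out of `Γₙ / Γₙ₊₁` is a homomorphism out of `Γₙ` that kills `Γₙ₊₁`. -/
def Gr.lift {G : Type*} [Group G] {n : ℕ} {A : Type*} [AddCommGroup A] (f : dimSeries G n → A)
    (hmul : ∀ x y, f (x * y) = f x + f y)
    (hker : ∀ x : dimSeries G n, (x : G) ∈ dimSeries G (n + 1) → f x = 0) : Gr G n →+ A :=
  AddMonoidHom.mk' (fun a => Quotient.liftOn' (Additive.toMul a) f (by
    intro x y hxy
    rw [QuotientGroup.leftRel_apply, Subgroup.mem_subgroupOf] at hxy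
    have h := hmul x (x⁻¹ * y)
    rw [mul_inv_cancel_left, hker _ hxy, add_zero] at h
    exact h.symm)) (by
    intro a b
    obtain ⟨x, rfl⟩ := a.exists_mk
    obtain ⟨y, rfl⟩ := b.exists_mk
    exact hmul x y)

theorem Gr.lift_mk {G : Type*} [Group G] {n : ℕ} {A : Type*} [AddCommGroup A]
    (f : dimSeries G n → A) (hmul : ∀ x y, f (x * y) = f x + f y)
    (hker : ∀ x : dimSeries G n, (x : G) ∈ dimSeries G (n + 1) → f x = 0) (x : dimSeries G n) :
    Gr.lift f hmul hker (Gr.mk x) = f x := rfl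

/-- The commutator `[x, y] = x⁻¹y⁻¹xy` as a map `Γₘ × Γₙ → Γₘ₊ₙ`. -/
def dimComm {G : Type*} [Group G] {m n : ℕ} (x : dimSeries G m) (y : dimSeries G n) :
    dimSeries G (m + n) :=
  ⟨(x : G)⁻¹ * (y : G)⁻¹ * x * y, comm_mem_dimSeries x.2 y.2⟩

theorem mk_dimComm_mul_left {G : Type*} [Group G] {m n : ℕ} (x x' : dimSeries G m)
    (y : dimSeries G n) :
    Gr.mk (dimComm (x * x') y) = Gr.mk (dimComm x y) + Gr.mk (dimComm x' y) := by
  rw [← Gr.mk_mul, Gr.mk_eq_mk]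
  have e : ((dimComm (x * x') y : dimSeries G (m + n)) : G) =
      (x' : G)⁻¹ * (dimComm x y : dimSeries G (m + n)) * x' *
        (dimComm x' y : dimSeries G (m + n)) := by
    simp only [dimComm, Subgroup.coe_mul]; group
  rw [e, Subgroup.coe_mul, QuotientGroup.mk_mul, QuotientGroup.mk_mul, QuotientGroup.mk_mul,
    QuotientGroup.mk_mul, ← quotient_comm_of_mem (dimComm x y).2, mul_assoc (QuotientGroup.mk _),
    ← QuotientGroup.mk_mul (dimSeries G (m + n + 1)) (x' : G)⁻¹, inv_mul_cancel,
    QuotientGroup.mk_one, mul_one]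

theorem mk_dimComm_mul_right {G : Type*} [Group G] {m n : ℕ} (x : dimSeries G m)
    (y y' : dimSeries G n) :
    Gr.mk (dimComm x (y * y')) = Gr.mk (dimComm x y) + Gr.mk (dimComm x y') := by
  rw [add_comm (Gr.mk (dimComm x y)), ← Gr.mk_mul, Gr.mk_eq_mk]
  have e : ((dimComm x (y * y') : dimSeries G (m + n)) : G) =
      (dimComm x y' : dimSeries G (m + n)) * ((y' : G)⁻¹ *
        (dimComm x y : dimSeries G (m + n)) * y') := by
    simp only [dimComm, Subgroup.coe_mul]; group
  rw [e, Subgroup.coe_mul, QuotientGroup.mk_mul, QuotientGroup.mk_mul, QuotientGroup.mk_mul,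
    QuotientGroup.mk_mul, ← quotient_comm_of_mem (dimComm x y).2, mul_assoc (QuotientGroup.mk _),
    ← QuotientGroup.mk_mul (dimSeries G (m + n + 1)) (y' : G)⁻¹, inv_mul_cancel,
    QuotientGroup.mk_one, mul_one]

/-- The bracket `Γₘ/Γₘ₊₁ × Γₙ/Γₙ₊₁ → Γₘ₊ₙ/Γₘ₊ₙ₊₁` induced by commutation. -/
def grBracket (G : Type*) [Group G] (m n : ℕ) : Gr G m →+ Gr G n →+ Gr G (m + n) :=
  Gr.lift
    (fun x => Gr.lift (fun y => Gr.mk (dimComm x y)) (mk_dimComm_mul_right x)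
      (fun _ hy => Gr.mk_eq_zero.2 (comm_mem_dimSeries (m := m) (n := n + 1) x.2 hy)))
    (fun x x' => by
      ext b
      obtain ⟨y, rfl⟩ := b.exists_mk
      exact mk_dimComm_mul_left x x' y)
    (fun x hx => by
      ext b
      obtain ⟨y, rfl⟩ := b.exists_mk
      refine Gr.mk_eq_zero.2 ?_
      have := comm_mem_dimSeries hx y.2
      rwa [add_right_comm] at this)

theorem grBracket_mk {G : Type*} [Group G] {m n : ℕ} (x : dimSeries G m) (y : dimSeries G n) :
    grBracket G m n (Gr.mk x) (Gr.mk y) = Gr.mk (dimComm x y) := rfl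

/-- The map `Γₙ/Γₙ₊₁ → Γ₂ₙ/Γ₂ₙ₊₁` induced by squaring. -/
def grFrobenius (G : Type*) [Group G] (n : ℕ) (a : Gr G n) : Gr G (2 * n) :=
  Quotient.liftOn' (Additive.toMul a)
    (fun x : dimSeries G n => Gr.mk ⟨(x : G) ^ 2, sq_mem_dimSeries n x.2⟩) (by
    intro x y hxy
    rw [QuotientGroup.leftRel_apply, Subgroup.mem_subgroupOf] at hxy
    rw [Gr.mk_eq_mk, QuotientGroup.eq]
    have h1 := comm_mem_dimSeries x.2 (inv_mem hxy)
    have h2 := sq_mem_dimSeries _ hxy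
    have e : ((x : G) ^ 2)⁻¹ * (y : G) ^ 2 =
        ((x : G)⁻¹ * ((x⁻¹ * y : dimSeries G n) : G)⁻¹⁻¹ * x * ((x⁻¹ * y : dimSeries G n) : G)⁻¹) *
          ((x⁻¹ * y : dimSeries G n) : G) ^ 2 := by
      simp only [Subgroup.coe_mul, Subgroup.coe_inv, pow_two]; group
    rw [e]
    exact mul_mem (dimSeries_antitone G (by omega) h1) (dimSeries_antitone G (by omega) h2))

theorem grFrobenius_mk {G : Type*} [Group G] {n : ℕ} (x : dimSeries G n) :
    grFrobenius G n (Gr.mk x) = Gr.mk ⟨(x : G) ^ 2, sq_mem_dimSeries n x.2⟩ := rfl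

end Components

/-! ### The restricted graded Lie algebra `Lie(Γ)` -/

/-- The 2-Lie algebra `⨁ₙ Γₙ / Γₙ₊₁` of a group. The component of index `0` is trivial because
`Γ₀ = Γ₁`, so this is the sum over `n ≥ 1`. -/
abbrev DimLie (G : Type*) [Group G] : Type _ := ⨁ n : ℕ, Gr G n

section LieAlgebra

/-- The inclusion of the component of degree `n`. -/
def DimLie.of {G : Type*} [Group G] (n : ℕ) : Gr G n →+ DimLie G :=
  DirectSum.of (fun n => Gr G n) n

/-- The element of degree `n` of `Lie(Γ)` given by an element of `Γₙ`. -/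
def DimLie.cls {G : Type*} [Group G] (n : ℕ) (x : dimSeries G n) : DimLie G :=
  DimLie.of n (Gr.mk x)

/-- The bilinear extension of the brackets of the components. -/
def DimLie.bracketHom (G : Type*) [Group G] : DimLie G →+ DimLie G →+ DimLie G :=
  DirectSum.toAddMonoid fun m => AddMonoidHom.flip
    (DirectSum.toAddMonoid fun n => AddMonoidHom.flip
      ((AddMonoidHom.compHom (DimLie.of (m + n))).comp (grBracket G m n)))

instance (G : Type*) [Group G] : Bracket (DimLie G) (DimLie G) where
  bracket x y := DimLie.bracketHom G x y

theorem DimLie.bracket_def {G : Type*} [Group G] (x y : DimLie G) :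
    ⁅x, y⁆ = DimLie.bracketHom G x y := rfl

theorem DimLie.of_bracket_of {G : Type*} [Group G] {m n : ℕ} (a : Gr G m) (b : Gr G n) :
    ⁅DimLie.of m a, DimLie.of n b⁆ = DimLie.of (m + n) (grBracket G m n a b) := by
  rw [DimLie.bracket_def, DimLie.bracketHom, DimLie.of, DimLie.of, DirectSum.toAddMonoid_of,
    AddMonoidHom.flip_apply, DirectSum.toAddMonoid_of]
  rfl

theorem DimLie.cls_bracket_cls {G : Type*} [Group G] {m n : ℕ} (x : dimSeries G m)
    (y : dimSeries G n) : ⁅DimLie.cls m x, DimLie.cls n y⁆ = DimLie.cls (m + n) (dimComm x y) := by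
  rw [DimLie.cls, DimLie.cls, DimLie.of_bracket_of, grBracket_mk]; rfl

theorem DimLie.induction {G : Type*} [Group G] {p : DimLie G → Prop} (x : DimLie G)
    (h0 : p 0) (hc : ∀ n (g : dimSeries G n), p (DimLie.cls n g))
    (ha : ∀ x y, p x → p y → p (x + y)) : p x := by
  refine DirectSum.induction_on (motive := p) x h0 ?_ ha
  intro n a
  obtain ⟨g, rfl⟩ := a.exists_mk
  exact hc n g

theorem DimLie.add_self {G : Type*} [Group G] (x : DimLie G) : x + x = 0 := by
  have h : (2 : ZMod 2) • x = 0 := by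
    have : (2 : ZMod 2) = 0 := rfl
    rw [this, zero_smul]
  rwa [two_smul] at h

theorem DimLie.cls_congr {G : Type*} [Group G] {m n : ℕ} (h : m = n) (g : G)
    (hm : g ∈ dimSeries G m) (hn : g ∈ dimSeries G n) :
    DimLie.cls m ⟨g, hm⟩ = DimLie.cls n ⟨g, hn⟩ := by
  subst h; rfl

theorem DimLie.cls_mul {G : Type*} [Group G] {n : ℕ} (x y : dimSeries G n) :
    DimLie.cls n (x * y) = DimLie.cls n x + DimLie.cls n y := by
  rw [DimLie.cls, Gr.mk_mul, map_add]; rfl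

theorem DimLie.cls_inv {G : Type*} [Group G] {n : ℕ} (x : dimSeries G n) :
    DimLie.cls n x⁻¹ = DimLie.cls n x := by
  rw [DimLie.cls, Gr.mk_inv, map_neg, neg_eq_iff_add_eq_zero]
  exact DimLie.add_self _

theorem DimLie.cls_conj {G : Type*} [Group G] {n : ℕ} (x : G) (hx : x ∈ dimSeries G n) (g : G)
    (hg : g⁻¹ * x * g ∈ dimSeries G n) :
    DimLie.cls n ⟨g⁻¹ * x * g, hg⟩ = DimLie.cls n ⟨x, hx⟩ := by
  rw [DimLie.cls, DimLie.cls]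
  congr 1
  rw [Gr.mk_eq_mk, QuotientGroup.mk_mul, QuotientGroup.mk_mul, ← quotient_comm_of_mem hx,
    mul_assoc, ← QuotientGroup.mk_mul, inv_mul_cancel, QuotientGroup.mk_one, mul_one]

theorem DimLie.bracket_comm {G : Type*} [Group G] (x y : DimLie G) : ⁅x, y⁆ = ⁅y, x⁆ := by
  simp only [DimLie.bracket_def]
  induction x using DimLie.induction with
  | h0 => simp
  | ha a b ha hb => simp [ha, hb]
  | hc m g =>
    induction y using DimLie.induction with
    | h0 => simp
    | ha a b ha hb => simp [ha, hb]
    | hc n h =>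
      simp only [← DimLie.bracket_def, DimLie.cls_bracket_cls]
      rw [← DimLie.cls_inv (dimComm h g)]
      have e : (((dimComm h g)⁻¹ : dimSeries G (n + m)) : G) = dimComm g h := by
        simp only [dimComm, Subgroup.coe_inv]; group
      rw [show (dimComm h g)⁻¹ = ⟨(dimComm g h : G), e ▸ ((dimComm h g)⁻¹).2⟩ from Subtype.ext e]
      exact DimLie.cls_congr (add_comm m n) _ _ _

theorem DimLie.bracket_self {G : Type*} [Group G] (x : DimLie G) : ⁅x, x⁆ = 0 := by
  induction x using DimLie.induction with
  | h0 => simp [DimLie.bracket_def]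
  | ha a b ha hb =>
    have h := DimLie.bracket_comm a b
    simp only [DimLie.bracket_def] at *
    simp only [map_add, AddMonoidHom.add_apply, ha, hb, h, zero_add, add_zero]
    exact DimLie.add_self _
  | hc n g =>
    rw [DimLie.cls_bracket_cls, DimLie.cls, Gr.mk_eq_zero.2, map_zero]
    have : (dimComm g g : G) = 1 := by simp [dimComm]
    rw [this]
    exact one_mem _

theorem DimLie.jacobi {G : Type*} [Group G] (x y z : DimLie G) :
    ⁅⁅x, y⁆, z⁆ + ⁅⁅y, z⁆, x⁆ + ⁅⁅z, x⁆, y⁆ = 0 := by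
  simp only [DimLie.bracket_def]
  induction x using DimLie.induction with
  | h0 => simp
  | ha a b ha hb =>
    simp only [map_add, AddMonoidHom.add_apply]
    rw [← add_zero (0 : DimLie G)]
    nth_rewrite 1 [← ha]
    rw [← hb]
    abel
  | hc i g =>
    induction y using DimLie.induction with
    | h0 => simp
    | ha a b ha hb =>
      simp only [map_add, AddMonoidHom.add_apply]
      rw [← add_zero (0 : DimLie G)]
      nth_rewrite 1 [← ha]
      rw [← hb]
      abel
    | hc j h =>
      induction z using DimLie.induction with
      | h0 => simp
      | ha a b ha hb =>
        simp only [map_add, AddMonoidHom.add_apply]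
        rw [← add_zero (0 : DimLie G)]
        nth_rewrite 1 [← ha]
        rw [← hb]
        abel
      | hc k l =>
        simp only [← DimLie.bracket_def]
        rw [← DimLie.cls_inv h, DimLie.cls_bracket_cls g, DimLie.cls_bracket_cls _ l,
          DimLie.cls_inv h, ← DimLie.cls_inv l, DimLie.cls_bracket_cls h,
          DimLie.cls_bracket_cls _ g, DimLie.cls_inv l, ← DimLie.cls_inv g,
          DimLie.cls_bracket_cls l, DimLie.cls_bracket_cls _ h]
        have m1 := (dimComm (dimComm g h⁻¹) l).2
        have m2 := (dimComm (dimComm h l⁻¹) g).2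
        have m3 := (dimComm (dimComm l g⁻¹) h).2
        replace m2 : ((dimComm (dimComm h l⁻¹) g : dimSeries G (j + k + i)) : G) ∈
            dimSeries G (i + j + k) := dimSeries_antitone G (by omega) m2
        replace m3 : ((dimComm (dimComm l g⁻¹) h : dimSeries G (k + i + j)) : G) ∈
            dimSeries G (i + j + k) := dimSeries_antitone G (by omega) m3
        have n1 := (dimSeries_normal G (i + j + k)).conj_mem' _ m1 (h : G)
        have n2 := (dimSeries_normal G (i + j + k)).conj_mem' _ m2 (l : G)
        have n3 := (dimSeries_normal G (i + j + k)).conj_mem' _ m3 (g : G)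
        have e1 := DimLie.cls_conj _ m1 _ n1
        have e2 := (DimLie.cls_conj _ m2 _ n2).trans
          (DimLie.cls_congr (show i + j + k = j + k + i by ring) _ _ (Subtype.property _))
        have e3 := (DimLie.cls_conj _ m3 _ n3).trans
          (DimLie.cls_congr (show i + j + k = k + i + j by ring) _ _ (Subtype.property _))
        refine (congrArg₂ _ (congrArg₂ _ e1.symm e2.symm) e3.symm).trans ?_
        rw [← DimLie.cls_mul, ← DimLie.cls_mul, DimLie.cls, Gr.mk_eq_zero.2, map_zero]
        have e : ∀ a b c : G, b⁻¹ * ((a⁻¹ * b⁻¹⁻¹ * a * b⁻¹)⁻¹ * c⁻¹ * (a⁻¹ * b⁻¹⁻¹ * a * b⁻¹) * c) * b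
            * (c⁻¹ * ((b⁻¹ * c⁻¹⁻¹ * b * c⁻¹)⁻¹ * a⁻¹ * (b⁻¹ * c⁻¹⁻¹ * b * c⁻¹) * a) * c)
            * (a⁻¹ * ((c⁻¹ * a⁻¹⁻¹ * c * a⁻¹)⁻¹ * b⁻¹ * (c⁻¹ * a⁻¹⁻¹ * c * a⁻¹) * b) * a) = 1 := by
          intro a b c; group
        have e' := e (g : G) h l
        simp only [dimComm, Subgroup.coe_mul, Subgroup.coe_inv] at e' ⊢
        rw [e']
        exact one_mem _

instance (G : Type*) [Group G] : LieRing (DimLie G) where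
  add_lie x y z := by simp [DimLie.bracket_def]
  lie_add x y z := by simp [DimLie.bracket_def]
  lie_self := DimLie.bracket_self
  leibniz_lie x y z := by
    have h := DimLie.jacobi x y z
    rw [DimLie.bracket_comm x ⁅y, z⁆, DimLie.bracket_comm y ⁅x, z⁆, DimLie.bracket_comm x z,
      ← sub_eq_zero, sub_eq_add_neg]
    have hn : ∀ a : DimLie G, -a = a := fun a => by
      rw [neg_eq_iff_add_eq_zero]; exact DimLie.add_self a
    rw [hn, ← h]
    abel

instance (G : Type*) [Group G] : LieAlgebra (ZMod 2) (DimLie G) where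
  lie_smul t x y := by
    simp only [DimLie.bracket_def]
    exact ZMod.map_smul (DimLie.bracketHom G x) t y

open Classical in
/-- The Frobenius map of the restricted Lie algebra `Lie(Γ)`: it is induced by squaring on the
homogeneous elements, and extended to sums by `(x + y)^[2] = x^[2] + y^[2] + [x, y]`. -/
noncomputable def DimLie.frobenius {G : Type*} [Group G] (x : DimLie G) : DimLie G :=
  ∑ n ∈ x.support, DimLie.of (2 * n) (grFrobenius G n (x n)) +
    ∑ p ∈ x.support ×ˢ x.support with p.1 < p.2, ⁅DimLie.of p.1 (x p.1), DimLie.of p.2 (x p.2)⁆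

theorem DimLie.frobenius_of {G : Type*} [Group G] {n : ℕ} (a : Gr G n) :
    DimLie.frobenius (DimLie.of n a) = DimLie.of (2 * n) (grFrobenius G n a) := by
  classical
  have e2 : ∀ (t : Finset ℕ) (F : ℕ × ℕ → DimLie G), t ⊆ {n} →
      ∑ p ∈ t ×ˢ t with p.1 < p.2, F p = 0 := by
    intro t F ht
    refine Finset.sum_eq_zero fun p hp => ?_
    simp only [Finset.mem_filter, Finset.mem_product] at hp
    have h1 := Finset.mem_singleton.1 (ht hp.1.1)
    have h2 := Finset.mem_singleton.1 (ht hp.1.2)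
    omega
  have e1 : ∀ (t : Finset ℕ) (F : ℕ → DimLie G), t ⊆ {n} → (n ∉ t → F n = 0) →
      ∑ i ∈ t, F i = F n := by
    intro t F ht h0
    by_cases hn : n ∈ t
    · rw [Finset.Subset.antisymm ht (Finset.singleton_subset_iff.2 hn), Finset.sum_singleton]
    · rw [h0 hn]
      exact Finset.sum_eq_zero fun i hi =>
        absurd (Finset.mem_singleton.1 (ht hi) ▸ hi) hn
  have ha : (DimLie.of n a) n = a := DirectSum.of_eq_same n a
  have hs : ∀ i ∈ DFinsupp.support (DimLie.of n a), i = n := by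
    intro i hi
    by_contra hne
    exact DFinsupp.mem_support_iff.1 hi (DirectSum.of_eq_of_ne n i a hne)
  rw [DimLie.frobenius, e2 _ _ (fun i hi => Finset.mem_singleton.2 (hs i (by convert hi))),
    add_zero, e1 _ _ (fun i hi => Finset.mem_singleton.2 (hs i (by convert hi))), ha]
  intro hn
  have h0 : (DimLie.of n a) n = 0 := by
    by_contra h0
    exact hn (DFinsupp.mem_support_iff.2 h0)
  have h1 : (0 : Gr G n) = Gr.mk 1 := rfl
  rw [h0, h1, grFrobenius_mk, Gr.mk_eq_zero.2, map_zero]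
  simp

end LieAlgebra

/-- The degree of `g` in `ℕ ∪ {∞}`: the largest `n` such that `g` belongs to `Γₙ`. -/
noncomputable def dimDegree {G : Type*} [Group G] (g : G) : ℕ∞ :=
  ⨆ n ∈ {n : ℕ | g ∈ dimSeries G n}, (n : ℕ∞)

open Classical in
/-- The homogeneous element of `Lie(Γ)` represented by `g`: the class of `g` in `Γₙ / Γₙ₊₁` where
`n` is the degree of `g` (and `0` if the degree is infinite). -/
noncomputable def DimLie.symbol {G : Type*} [Group G] (g : G) : DimLie G :=
  if h : ∃ n, g ∈ dimSeries G n ∧ g ∉ dimSeries G (n + 1) then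
    DimLie.cls h.choose ⟨g, h.choose_spec.1⟩
  else 0

theorem DimLie.symbol_eq_cls {G : Type*} [Group G] {n : ℕ} {g : G} (h : g ∈ dimSeries G n)
    (h' : g ∉ dimSeries G (n + 1)) : DimLie.symbol g = DimLie.cls n ⟨g, h⟩ := by
  have hex : ∃ n, g ∈ dimSeries G n ∧ g ∉ dimSeries G (n + 1) := ⟨n, h, h'⟩
  rw [DimLie.symbol, dif_pos hex]
  refine DimLie.cls_congr ?_ _ _ _
  have h1 := hex.choose_spec
  rcases lt_trichotomy hex.choose n with hlt | heq | hgt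
  · exact absurd (dimSeries_antitone G hlt h) h1.2
  · exact heq
  · exact absurd (dimSeries_antitone G hgt h1.1) h'

/-! ### The Brunner-Sidki-Vieira group -/

/-- The permutations of the set of words over `{0, 1}` (with `0 = false` and `1 = true`). They act
on the right: in the product `g * h` the permutation `g` is applied first. -/
abbrev WordPerm : Type := (Equiv.Perm (List Bool))ᵐᵒᵖ

/-- The right action `w^g`. -/
def WordPerm.act (g : WordPerm) (w : List Bool) : List Bool := MulOpposite.unop g w

namespace BSV

/-- `(0w)^τ = 1w` and `(1w)^τ = 0(w^τ)`. -/
def tauFun : List Bool → List Bool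
  | [] => []
  | false :: w => true :: w
  | true :: w => false :: tauFun w

/-- The inverse of `τ`. -/
def tauInvFun : List Bool → List Bool
  | [] => []
  | true :: w => false :: w
  | false :: w => true :: tauInvFun w

mutual
/-- `(0w)^μ = 1w` and `(1w)^μ = 0(w^(μ⁻¹))`. -/
def muFun : List Bool → List Bool
  | [] => []
  | false :: w => true :: w
  | true :: w => false :: muInvFun w

/-- The inverse of `μ`. -/
def muInvFun : List Bool → List Bool
  | [] => []
  | true :: w => false :: w
  | false :: w => true :: muFun w
end

theorem tauInv_tau (w : List Bool) : tauInvFun (tauFun w) = w := by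
  induction w with
  | nil => rfl
  | cons b w ih => cases b <;> simp [tauFun, tauInvFun, ih]

theorem tau_tauInv (w : List Bool) : tauFun (tauInvFun w) = w := by
  induction w with
  | nil => rfl
  | cons b w ih => cases b <;> simp [tauFun, tauInvFun, ih]

theorem muInv_mu_and (w : List Bool) : muInvFun (muFun w) = w ∧ muFun (muInvFun w) = w := by
  induction w with
  | nil => simp [muFun, muInvFun]
  | cons b w ih => cases b <;> simp [muFun, muInvFun, ih.1, ih.2]

/-- The permutation `τ` of the set of words. -/
def tauPerm : WordPerm :=
  MulOpposite.op ⟨tauFun, tauInvFun, tauInv_tau, tau_tauInv⟩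

/-- The permutation `μ` of the set of words. -/
def muPerm : WordPerm :=
  MulOpposite.op ⟨muFun, muInvFun, fun w => (muInv_mu_and w).1, fun w => (muInv_mu_and w).2⟩

/-- The element `(g, h)`: it acts as `g` on `0Σ*` and as `h` on `1Σ*`. -/
def pairFun (g h : List Bool → List Bool) : List Bool → List Bool
  | [] => []
  | false :: w => false :: g w
  | true :: w => true :: h w

/-- The homomorphism `(g, h) ↦ (g, h)`, where `(g, h)` acts as `g` on `0Σ*` and as `h` on
`1Σ*`. -/
def pair : WordPerm × WordPerm →* WordPerm where
  toFun p := MulOpposite.op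
    ⟨pairFun p.1.act p.2.act, pairFun p.1⁻¹.act p.2⁻¹.act,
      fun w => by rcases w with _ | ⟨_ | _, w⟩ <;> simp [pairFun, WordPerm.act],
      fun w => by rcases w with _ | ⟨_ | _, w⟩ <;> simp [pairFun, WordPerm.act]⟩
  map_one' := by
    apply MulOpposite.unop_injective
    ext1 w
    rcases w with _ | ⟨_ | _, w⟩ <;> simp [pairFun, WordPerm.act]
  map_mul' p q := by
    apply MulOpposite.unop_injective
    ext1 w
    rcases w with _ | ⟨_ | _, w⟩ <;> simp [pairFun, WordPerm.act]

/-- The transposition of the two letters at the root. -/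
def epsFun : List Bool → List Bool
  | [] => []
  | b :: w => (!b) :: w

/-- The permutation `ε` that changes the first letter. -/
def eps : WordPerm :=
  MulOpposite.op ⟨epsFun, epsFun, fun w => by cases w <;> simp [epsFun],
    fun w => by cases w <;> simp [epsFun]⟩

theorem eps_mul_eps : eps * eps = 1 := by
  apply MulOpposite.unop_injective
  ext1 w
  cases w <;> simp [eps, epsFun]

theorem eps_mul_pair (g h : WordPerm) : eps * pair (g, h) = pair (h, g) * eps := by
  apply MulOpposite.unop_injective
  ext1 w
  rcases w with _ | ⟨_ | _, w⟩ <;> simp [eps, epsFun, pair, pairFun]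

theorem tauPerm_eq : tauPerm = pair (1, tauPerm) * eps := by
  apply MulOpposite.unop_injective
  ext1 w
  rcases w with _ | ⟨_ | _, w⟩ <;>
    simp [eps, epsFun, pair, pairFun, tauPerm, tauFun, WordPerm.act]

theorem muPerm_eq : muPerm = pair (1, muPerm⁻¹) * eps := by
  apply MulOpposite.unop_injective
  ext1 w
  rcases w with _ | ⟨_ | _, w⟩ <;>
    simp [eps, epsFun, pair, pairFun, muPerm, muFun, WordPerm.act]

/-- The Brunner-Sidki-Vieira group `Γ = ⟨τ, μ⟩`. -/
def Gam : Subgroup WordPerm := Subgroup.closure {tauPerm, muPerm}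

/-- The derived subgroup `Γ'` of `Γ`. -/
def Gam' : Subgroup WordPerm := ⁅Gam, Gam⁆

theorem tauPerm_mem : tauPerm ∈ Gam := Subgroup.subset_closure (by simp)

theorem muPerm_mem : muPerm ∈ Gam := Subgroup.subset_closure (by simp)

theorem Gam'_le : Gam' ≤ Gam := Subgroup.commutator_le_self Gam

theorem conj_mem_Gam' {x g : WordPerm} (hx : x ∈ Gam) (hg : g ∈ Gam') : x * g * x⁻¹ ∈ Gam' := by
  have h : ⁅x, g⁆ ∈ Gam' := Subgroup.commutator_mem_commutator hx (Gam'_le hg)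
  have e : x * g * x⁻¹ = ⁅x, g⁆ * g := by rw [commutatorElement_def]; group
  rw [e]
  exact mul_mem h hg

theorem tauPerm_sq : tauPerm ^ 2 = pair (tauPerm, tauPerm) := by
  rw [pow_two]
  nth_rewrite 1 [tauPerm_eq]
  nth_rewrite 2 [tauPerm_eq]
  rw [mul_assoc, ← mul_assoc eps, eps_mul_pair, mul_assoc, eps_mul_eps, mul_one, ← map_mul]
  simp

theorem muPerm_sq : muPerm ^ 2 = pair (muPerm⁻¹, muPerm⁻¹) := by
  rw [pow_two]
  nth_rewrite 1 [muPerm_eq]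
  nth_rewrite 2 [muPerm_eq]
  rw [mul_assoc, ← mul_assoc eps, eps_mul_pair, mul_assoc, eps_mul_eps, mul_one, ← map_mul]
  simp

theorem muPerm_mul_tauPerm : muPerm * tauPerm = pair (tauPerm, muPerm⁻¹) := by
  nth_rewrite 1 [muPerm_eq]
  nth_rewrite 1 [tauPerm_eq]
  rw [mul_assoc, ← mul_assoc eps, eps_mul_pair, mul_assoc, eps_mul_eps, mul_one, ← map_mul]
  simp

theorem tauPerm_mul_muPerm : tauPerm * muPerm = pair (muPerm⁻¹, tauPerm) := by
  nth_rewrite 1 [tauPerm_eq]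
  nth_rewrite 1 [muPerm_eq]
  rw [mul_assoc, ← mul_assoc eps, eps_mul_pair, mul_assoc, eps_mul_eps, mul_one, ← map_mul]
  simp

/-- The commutator `c = [τ, μ] = τ⁻¹μ⁻¹τμ`. -/
def cPerm : WordPerm := tauPerm⁻¹ * muPerm⁻¹ * tauPerm * muPerm

theorem cPerm_mem : cPerm ∈ Gam' := by
  have := Subgroup.commutator_mem_commutator (inv_mem tauPerm_mem) (inv_mem muPerm_mem)
  simpa [commutatorElement_def, cPerm, Gam'] using this

theorem cPerm_eq : cPerm = pair ((muPerm * tauPerm)⁻¹, muPerm * tauPerm) := by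
  have e : cPerm = (muPerm * tauPerm)⁻¹ * (tauPerm * muPerm) := by rw [cPerm]; group
  have h : ∀ a b : WordPerm, (pair (a, b))⁻¹ * pair (b⁻¹⁻¹, a) = pair (a⁻¹ * b, b⁻¹ * a) := by
    intro a b
    rw [← map_inv, ← map_mul]
    simp
  have e' : tauPerm * muPerm = pair ((muPerm⁻¹)⁻¹⁻¹, tauPerm) := by
    rw [inv_inv, tauPerm_mul_muPerm]
  rw [e, e', muPerm_mul_tauPerm, h, ← muPerm_mul_tauPerm]
  simp

theorem conj_tauPerm_pair (g h : WordPerm) :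
    tauPerm⁻¹ * pair (g, h) * tauPerm = pair (tauPerm⁻¹ * h * tauPerm, g) := by
  have e : ∀ t : WordPerm, (pair (1, t) * eps)⁻¹ * pair (g, h) * (pair (1, t) * eps) =
      pair (t⁻¹ * h * t, g) := by
    intro t
    have e1 : (pair (1, t) * eps)⁻¹ * pair (g, h) * (pair (1, t) * eps) =
        eps⁻¹ * ((pair (1, t))⁻¹ * pair (g, h) * pair (1, t)) * eps := by group
    have e2 : ((pair (1, t))⁻¹ * pair (g, h) * pair (1, t)) = pair (g, t⁻¹ * h * t) := by
      rw [← map_inv, ← map_mul, ← map_mul]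
      simp
    rw [e1, e2, mul_assoc, ← eps_mul_pair, inv_mul_cancel_left]
  have := e tauPerm
  rwa [← tauPerm_eq] at this

theorem exists_pair_mem {x : WordPerm} (hx : x ∈ Gam) : ∃ h, pair (x, h) ∈ Gam := by
  induction hx using Subgroup.closure_induction with
  | mem x hx =>
    rcases hx with rfl | rfl
    · exact ⟨tauPerm, tauPerm_sq ▸ pow_mem tauPerm_mem 2⟩
    · refine ⟨muPerm, ?_⟩
      have := inv_mem (pow_mem muPerm_mem 2)
      rw [muPerm_sq, ← map_inv] at this
      simpa using this
  | one => exact ⟨1, by rw [show ((1 : WordPerm), (1 : WordPerm)) = 1 from rfl, map_one]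
                        exact one_mem _⟩
  | mul x y _ _ hx hy =>
    obtain ⟨h, hh⟩ := hx
    obtain ⟨k, hk⟩ := hy
    refine ⟨h * k, ?_⟩
    have := mul_mem hh hk
    rwa [← map_mul] at this
  | inv x _ hx =>
    obtain ⟨h, hh⟩ := hx
    refine ⟨h⁻¹, ?_⟩
    have := inv_mem hh
    rwa [← map_inv] at this

theorem conj_pair_mem {x g : WordPerm} (hx : x ∈ Gam) (hg : pair (g, 1) ∈ Gam') :
    pair (x * g * x⁻¹, 1) ∈ Gam' := by
  obtain ⟨h, hh⟩ := exists_pair_mem hx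
  have := conj_mem_Gam' hh hg
  rw [← map_inv, ← map_mul, ← map_mul] at this
  simpa using this

theorem pair_mul_mem {g h : WordPerm} (hg : pair (g, 1) ∈ Gam') (hh : pair (h, 1) ∈ Gam') :
    pair (g * h, 1) ∈ Gam' := by
  have := mul_mem hg hh
  rw [← map_mul] at this
  simpa using this

theorem pair_inv_mem {g : WordPerm} (hg : pair (g, 1) ∈ Gam') : pair (g⁻¹, 1) ∈ Gam' := by
  have := inv_mem hg
  rw [← map_inv] at this
  simpa using this

theorem pair_comm_generators_mem : pair (⁅muPerm, tauPerm⁆, 1) ∈ Gam' := by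
  have h : tauPerm⁻¹ * cPerm * tauPerm ∈ Gam' := by
    have := conj_mem_Gam' (inv_mem tauPerm_mem) cPerm_mem
    rwa [inv_inv] at this
  have h2 : cPerm⁻¹ * (tauPerm⁻¹ * cPerm * tauPerm) * (cPerm * cPerm) ∈ Gam' :=
    mul_mem (mul_mem (inv_mem cPerm_mem) h) (mul_mem cPerm_mem cPerm_mem)
  rw [cPerm_eq, conj_tauPerm_pair, ← map_inv, ← map_mul, ← map_mul, ← map_mul] at h2
  have h3 := conj_pair_mem (x := muPerm⁻¹) (inv_mem muPerm_mem)
    (g := muPerm * ⁅muPerm, tauPerm⁆ * muPerm⁻¹) (by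
      convert h2 using 2
      ext1
      · simp only [commutatorElement_def, Prod.mk_mul_mk, Prod.inv_mk]; group
      · simp only [Prod.mk_mul_mk, Prod.inv_mk]; group)
  convert h3 using 3
  group

theorem pair_one_mem {g : WordPerm} (hg : g ∈ Gam') : pair (g, 1) ∈ Gam' := by
  have key : ∀ x ∈ Gam, ∀ y ∈ Gam, pair (⁅x, y⁆, 1) ∈ Gam' := by
    -- commutators of a fixed `y` form a set stable under the group operations in `x`
    have step : ∀ y ∈ Gam, (∀ x ∈ ({tauPerm, muPerm} : Set WordPerm), pair (⁅x, y⁆, 1) ∈ Gam') →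
        ∀ x ∈ Gam, pair (⁅x, y⁆, 1) ∈ Gam' := by
      intro y hy hgen x hx
      induction hx using Subgroup.closure_induction with
      | mem x hx => exact hgen x hx
      | one =>
        rw [commutatorElement_one_left, show ((1 : WordPerm), (1 : WordPerm)) = 1 from rfl, map_one]
        exact one_mem _
      | mul a b ha hb iha ihb =>
        have e : ⁅a * b, y⁆ = a * ⁅b, y⁆ * a⁻¹ * ⁅a, y⁆ := by
          simp only [commutatorElement_def]; group
        rw [e]
        exact pair_mul_mem (conj_pair_mem ha ihb) iha
      | inv a ha iha =>
        have e : ⁅a⁻¹, y⁆ = a⁻¹ * ⁅a, y⁆⁻¹ * a⁻¹⁻¹ := by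
          simp only [commutatorElement_def]; group
        rw [e]
        exact conj_pair_mem (inv_mem ha) (pair_inv_mem iha)
    have swap : ∀ x y : WordPerm, pair (⁅x, y⁆, 1) ∈ Gam' → pair (⁅y, x⁆, 1) ∈ Gam' := by
      intro x y h
      rw [← commutatorElement_inv]
      exact pair_inv_mem h
    have self : ∀ x : WordPerm, pair (⁅x, x⁆, 1) ∈ Gam' := by
      intro x
      rw [commutatorElement_self, show ((1 : WordPerm), (1 : WordPerm)) = 1 from rfl, map_one]
      exact one_mem _
    have hgen : ∀ y ∈ ({tauPerm, muPerm} : Set WordPerm), ∀ x ∈ Gam,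
        pair (⁅x, y⁆, 1) ∈ Gam' := by
      rintro y (rfl | rfl)
      · refine step _ tauPerm_mem ?_
        rintro x (rfl | rfl)
        · exact self _
        · exact pair_comm_generators_mem
      · refine step _ muPerm_mem ?_
        rintro x (rfl | rfl)
        · exact swap _ _ pair_comm_generators_mem
        · exact self _
    intro x hx y hy
    exact step y hy (fun x' hx' => swap _ _ (hgen x' hx' y hy)) x hx
  have hle : Gam' ≤ Gam'.comap (pair.comp (MonoidHom.inl WordPerm WordPerm)) :=
    Subgroup.commutator_le.2 key
  exact hle hg

theorem one_pair_mem {g : WordPerm} (hg : g ∈ Gam') : pair (1, g) ∈ Gam' := by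
  have h := conj_mem_Gam' (inv_mem tauPerm_mem) (pair_one_mem hg)
  rw [inv_inv, conj_tauPerm_pair] at h
  simpa using h

/-- The endomorphism `𝟖(g) = (g, 1)` of `Γ'`. -/
def eight : Gam' →* Gam' where
  toFun g := ⟨pair (g, 1), pair_one_mem g.2⟩
  map_one' := Subtype.ext pair.map_one
  map_mul' g h := by
    apply Subtype.ext
    simp only [Subgroup.coe_mul, ← map_mul, Prod.mk_mul_mk, mul_one]

/-- The endomorphism `𝟗(g) = (g, g)` of `Γ'`. -/
def nine : Gam' →* Gam' where
  toFun g := ⟨pair (g, g), by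
    have h := mul_mem (pair_one_mem g.2) (one_pair_mem g.2)
    rw [← map_mul] at h
    simpa using h⟩
  map_one' := Subtype.ext pair.map_one
  map_mul' g h := by
    apply Subtype.ext
    simp only [Subgroup.coe_mul, ← map_mul, Prod.mk_mul_mk]

/-- The element `τ` of `Γ`. -/
def tau : Gam := ⟨tauPerm, tauPerm_mem⟩

/-- The element `μ` of `Γ`. -/
def mu : Gam := ⟨muPerm, muPerm_mem⟩

/-- The element `c = [τ, μ]` of `Γ'`. -/
def c : Gam' := ⟨cPerm, cPerm_mem⟩

/-- The alphabet `{𝟖, 𝟗}`. -/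
inductive Letter
  | eight
  | nine

/-- The endomorphism of `Γ'` named by a letter. -/
def Letter.toEnd : Letter → (Gam' →* Gam')
  | .eight => BSV.eight
  | .nine => BSV.nine

/-- The value of a letter as a binary digit: `𝟖` is `0` and `𝟗` is `1`. -/
def Letter.digit : Letter → ℕ
  | .eight => 0
  | .nine => 1

/-- `W(g) = W₁(W₂(⋯ Wₘ(g)))` for a word `W = W₁W₂⋯Wₘ` in `{𝟖, 𝟗}`. -/
def applyWord (W : List Letter) (g : Gam') : Gam' :=
  W.foldr (fun l h => l.toEnd h) g

/-- The element `W(c)`, as an element of `Γ`. -/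
def wordC (W : List Letter) : Gam := Subgroup.inclusion Gam'_le (applyWord W c)

/-- The labels of the basis vectors `τ^(2ⁿ)`, `μ^(2ⁿ)` and `W(c)^(2ⁿ)`. -/
inductive BasisLabel
  | tau (n : ℕ)
  | mu (n : ℕ)
  | word (W : List Letter) (n : ℕ)

/-- The element of `Γ` with a given label. -/
def BasisLabel.elt : BasisLabel → Gam
  | .tau n => BSV.tau ^ 2 ^ n
  | .mu n => BSV.mu ^ 2 ^ n
  | .word W n => wordC W ^ 2 ^ n

/-- The asserted degrees: `2ⁿ`, `2ⁿ` and `2ⁿ(∑ᵢ Wᵢ 2^(i-1) + 2ᵐ + 1)`, where `m` is the length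
of `W = W₁⋯Wₘ`. -/
def BasisLabel.deg : BasisLabel → ℕ
  | .tau n => 2 ^ n
  | .mu n => 2 ^ n
  | .word W n => 2 ^ n * (∑ i : Fin W.length, (W.get i).digit * 2 ^ (i : ℕ) + 2 ^ W.length + 1)

/-- The label of the square of an element: the exponent `2ⁿ` becomes `2ⁿ⁺¹`. -/
def BasisLabel.double : BasisLabel → BasisLabel
  | .tau n => .tau (n + 1)
  | .mu n => .mu (n + 1)
  | .word W n => .word W (n + 1)

end BSV

-- Put x = μτ = (τ, μ⁻¹). Then c = (x⁻¹, x), and Γ' = ⟨c⟩(Γ' × Γ'). Every element of Γ' is therefore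
-- c^k(ub, b) = c^k · 𝟖(u) · 𝟗(b) with u, b in Γ', and k, u, b are unique because Γ/Γ' is free
-- abelian on τ and μ. Iterating, an element of Γ' has an integer coordinate at each word W, the
-- exponent of W(c).
--
-- Let e = `wordIndex W` be the binary number 1Wₘ⋯W₁, so that the asserted degree of W(c)^(2^j) is
-- 2^j(e + 1). The subgroups `filt N s n` collect the elements of weight at least n when W(c)^(2^j)
-- is given the weight 2^j(e + s). The parameter s is forced by self-similarity: prefixing 𝟖 or 𝟗
-- replaces e by 2e or 2e + 1, and 2e + s = 2(e + s/2), 2e + 1 + s = 2(e + (1 + s)/2). A claim at s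
-- = 1 thus becomes claims at other s in [0, 1] for the components. The depth N cuts the recursion
-- off.
--
-- The core is `FiltEstimates`: commutation with Γ raises the weight, squaring doubles it, and
-- commutators of two filtered elements add weights, all with a controlled decrease of s. The three
-- estimates are proved together by induction on N, by computing in components modulo the filtration
-- subgroups of depth N.
--
-- Upper bound for the degrees. At s = 1, adjoining powers of τ and μ gives subgroups (`InDelta`)
-- that satisfy the inclusions defining the 2-dimension series, so they contain it
-- (`inDelta_of_mem_dimSeries`). On weight 2^j(e + 1) the coordinate at W is divisible by 2^j and
-- additive modulo 2^(j+1) (`coord_mul`). This yields functionals on Γₙ/Γₙ₊₁ dual to the labels of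
-- degree n, hence linear independence.
--
-- Lower bound. [W(c), τ] and [W(c), μ] agree with W'(c) up to higher weight, where W' is the binary
-- successor of W (`succWord_inv_mul_cm_mem`): 𝟖(g) goes to 𝟗(g) up to a square, and 𝟗(g) goes to 𝟖
-- of a commutator, which is the carry. Together with a crude bound for long words, this puts W(c)
-- in Γ of index e + 1 (`wordHom_cPerm_mem_dimGam`). So weight at least n implies membership in Γₙ
-- (`filt_le_dimGam`), which gives spanning and turns every congruence up to higher weight into an
-- identity in Lie(Γ).

/-- The commutator `[a, b] = a⁻¹b⁻¹ab`. -/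
def cm {G : Type*} [Group G] (a b : G) : G := a⁻¹ * b⁻¹ * a * b

-- Commutator identities, and component computations modulo a normal subgroup

section CommutatorCalculus

variable {G : Type*} [Group G]

theorem cm_inv (a b : G) : (cm a b)⁻¹ = cm b a := by simp only [cm]; group

theorem cm_eq_one_iff {a b : G} : cm a b = 1 ↔ Commute a b := by
  rw [cm, show a⁻¹ * b⁻¹ * a * b = (b * a)⁻¹ * (a * b) by group, inv_mul_eq_one]
  exact ⟨fun h => h.symm, fun h => Eq.symm h⟩

theorem map_cm {H : Type*} [Group H] (f : G →* H) (a b : G) : f (cm a b) = cm (f a) (f b) := by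
  simp [cm]

theorem cm_mul_right (a b c : G) : cm a (b * c) = cm a c * (c⁻¹ * cm a b * c) := by
  simp only [cm]; group

theorem cm_mul_self_right (a b : G) : cm a (b * b) = cm a b ^ 2 * cm (cm a b) b := by
  simp only [cm, pow_two]; group

theorem cm_mul_self_left (a b : G) :
    cm (a * a) b = cm a b * cm (cm a b) a * cm a b := by
  simp only [cm]; group

theorem conj_eq_mul_cm (a y : G) : y⁻¹ * a * y = a * cm a y := by
  simp only [cm]; group

variable (T : Subgroup G) [T.Normal]

theorem mem_iff_mk'_eq_one {g : G} : g ∈ T ↔ QuotientGroup.mk' T g = 1 :=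
  (QuotientGroup.eq_one_iff g).symm

theorem cm_mem_iff {a b : G} :
    cm a b ∈ T ↔ Commute (QuotientGroup.mk' T a) (QuotientGroup.mk' T b) := by
  rw [mem_iff_mk'_eq_one, map_cm, cm_eq_one_iff]

theorem Commute.eq_conj {a b : G} (h : Commute a b) : b * a * b⁻¹ = a := by
  rw [← h.eq, mul_inv_cancel_right]

theorem Commute.eq_conj' {a b : G} (h : Commute a b) : b⁻¹ * a * b = a := by
  rw [mul_assoc, h.eq, inv_mul_cancel_left]

/-- The word is the 𝟖-component of c^k(ub, b) · c^l(u'b', b') with L = x^l. Modulo T the factors u,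
u' disappear, and L b L⁻² b⁻¹ L is trivial because b commutes with L². -/
theorem product_part_mem {u u' b L : G} (hu : u ∈ T) (hu' : u' ∈ T) (hb : cm b (L * L) ∈ T) :
    L * u * b * L⁻¹ * u' * L⁻¹ * b⁻¹ * L ∈ T := by
  rw [cm_mem_iff, map_mul] at hb
  rw [mem_iff_mk'_eq_one] at *
  simp only [map_mul, map_inv, hu, hu', mul_one]
  generalize QuotientGroup.mk' T b = b at *
  generalize QuotientGroup.mk' T L = L at *
  have := hb.eq
  calc L * b * L⁻¹ * L⁻¹ * b⁻¹ * L = L * (b * (L * L)⁻¹ * b⁻¹) * L := by group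
    _ = L * (L * L)⁻¹ * L := by rw [hb.inv_right.eq]; group
    _ = 1 := by group

theorem inverse_part_mem {u b L : G} (hu : u ∈ T) (hb : cm b (L * L) ∈ T) :
    L⁻¹ * b⁻¹ * u⁻¹ * L * L⁻¹ * L * L * b * L⁻¹ ∈ T := by
  rw [cm_mem_iff, map_mul] at hb
  rw [mem_iff_mk'_eq_one] at *
  simp only [map_mul, map_inv, hu, inv_one, mul_one]
  generalize QuotientGroup.mk' T b = b at *
  generalize QuotientGroup.mk' T L = L at *
  calc L⁻¹ * b⁻¹ * L * L⁻¹ * L * L * b * L⁻¹ = L⁻¹ * (b⁻¹ * ((L * L) * b)) * L⁻¹ := by group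
    _ = 1 := by rw [← hb.eq]; group

/-- The word is the 𝟖-component of the commutator of c^k(ub, b) with (p, q)ε, where X = x^k. Modulo
T the elements u, b, X are central, and all that survives is u⁻². -/
theorem bracket_first_part_mem {u b X p q : G} (hu : ∀ y, cm u y ∈ T) (hb : ∀ y, cm b y ∈ T)
    (hX : ∀ y, cm X y ∈ T) (hu2 : u ^ 2 ∈ T) :
    X⁻¹ * X⁻¹ * (u * b)⁻¹ * X * q⁻¹ * X * b * q *
      (X * X * b⁻¹ * X⁻¹ * p⁻¹ * X⁻¹ * (u * b) * p)⁻¹ ∈ T := by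
  simp only [cm_mem_iff] at hu hb hX
  rw [mem_iff_mk'_eq_one] at *
  simp only [map_mul, map_inv, map_pow] at *
  have hXq := hX q
  have hXp := hX p
  have hbq := hb q
  have hbp := hb p
  have hup := hu p
  have hub := hu b
  have hXb := hX b
  have hXu := hX u
  generalize QuotientGroup.mk' T b = b at *
  generalize QuotientGroup.mk' T X = X at *
  generalize QuotientGroup.mk' T u = u at *
  generalize QuotientGroup.mk' T p = p at *
  generalize QuotientGroup.mk' T q = q at *
  have e1 : X⁻¹ * X⁻¹ * (u * b)⁻¹ * X * q⁻¹ * X * b * q = u⁻¹ := by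
    calc _ = X⁻¹ * X⁻¹ * ((u * b)⁻¹ * X * (q⁻¹ * (X * b) * q)) := by group
      _ = X⁻¹ * X⁻¹ * ((u * b)⁻¹ * (X * X)) * b := by
          rw [(hXq.mul_left hbq).eq_conj']; group
      _ = X⁻¹ * X⁻¹ * ((X * X) * (u * b)⁻¹) * b := by
          have h : Commute X (u * b) := hXu.mul_right hXb
          rw [((h.mul_left h).inv_right).eq]
      _ = b⁻¹ * u⁻¹ * b := by group
      _ = u⁻¹ := hub.inv_left.eq_conj'
  have e2 : X * X * b⁻¹ * X⁻¹ * p⁻¹ * X⁻¹ * (u * b) * p = u := by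
    calc _ = X * X * (b⁻¹ * X⁻¹) * (p⁻¹ * (X⁻¹ * (u * b)) * p) := by group
      _ = X * X * (b⁻¹ * (X * X)⁻¹) * (u * b) := by
          rw [(hXp.inv_left.mul_left (hup.mul_left hbp)).eq_conj']; group
      _ = b⁻¹ * u * b := by
          rw [← ((hXb.mul_left hXb).inv_inv).eq]; group
      _ = u := hub.eq_conj'
  rw [e1, e2, ← mul_inv_rev, ← pow_two, hu2, inv_one]

theorem bracket_second_part_mem {u b X p : G} (hu : u ∈ T) (hb : ∀ y, cm b y ∈ T)
    (hX : ∀ y, cm X y ∈ T) :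
    X * X * b⁻¹ * X⁻¹ * p⁻¹ * X⁻¹ * (u * b) * p ∈ T := by
  simp only [cm_mem_iff] at hb hX
  rw [mem_iff_mk'_eq_one] at *
  simp only [map_mul, map_inv, hu, one_mul]
  have hXp := hX p
  have hbp := hb p
  have hXb := hX b
  generalize QuotientGroup.mk' T b = b at *
  generalize QuotientGroup.mk' T X = X at *
  generalize QuotientGroup.mk' T p = p at *
  calc _ = X * X * (b⁻¹ * X⁻¹) * (p⁻¹ * (X⁻¹ * b) * p) := by group
    _ = X * X * (b⁻¹ * (X * X)⁻¹) * b := by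
        rw [(hXp.inv_left.mul_left hbp).eq_conj']; group
    _ = 1 := by
        rw [← ((hXb.mul_left hXb).inv_inv).eq]; group

/-- The 𝟖-component of the square of c^k(ub, b), with X = x^k. Once u is moved to the left, the two
conjugates X b X⁻¹ and X⁻¹ b X cancel, since b commutes with X² modulo T. -/
theorem square_first_part_mem {u b X : G} (hu2 : u ^ 2 ∈ T) (huX : cm u X ∈ T)
    (hub : cm u (X * b * X⁻¹) ∈ T) (hb : cm b (X * X) ∈ T) :
    X * (u * b) * X⁻¹ * (u * b) * (X⁻¹ * b * X * b)⁻¹ ∈ T := by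
  simp only [cm_mem_iff] at huX hub hb
  rw [mem_iff_mk'_eq_one] at *
  simp only [map_mul, map_inv, map_pow] at *
  generalize QuotientGroup.mk' T b = b at *
  generalize QuotientGroup.mk' T X = X at *
  generalize QuotientGroup.mk' T u = u at *
  calc _ = (X * u * X⁻¹) * (X * b * X⁻¹) * u * (X⁻¹ * b * X)⁻¹ := by group
    _ = u * ((X * b * X⁻¹) * u) * (X⁻¹ * b * X)⁻¹ := by
        rw [huX.eq_conj]; group
    _ = u ^ 2 * (X * b * X⁻¹) * (X⁻¹ * b * X)⁻¹ := by rw [← hub.eq, pow_two]; group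
    _ = u ^ 2 * (X⁻¹ * ((X * X) * b * (X * X)⁻¹) * b⁻¹ * X) := by
        generalize u ^ 2 = v; group
    _ = 1 := by rw [hu2, hb.eq_conj]; group

/-- The two sides are the two sections of [c^k(ub, b), c^l(u'b', b')] with X = x^k, L = x^l. The
factors u, u' commute past everything they meet, and conjugation of b by L equals conjugation by
L⁻¹, likewise for b' and X; so the sign of the exponents of X and L does not matter. Read modulo T,
this says that the 𝟖-component of the commutator lies in T. -/
theorem commutator_first_part_eq {u u' b b' X L : G} (hXL : Commute X L) (huu : Commute u u')
    (huL : Commute u L) (huX : Commute u' X) (hub : Commute u (X * b' * X⁻¹))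
    (hub' : Commute u' (L * b * L⁻¹)) (hb : Commute b (L * L)) (hb' : Commute b' (X * X)) :
    cm (X⁻¹ * (u * b)) (L⁻¹ * (u' * b')) = cm (X * b) (L * b') := by
  have e1 : ∀ {Y d : G}, Commute d (Y * Y) → Y * d * Y⁻¹ = Y⁻¹ * d * Y := by
    intro Y d h
    calc Y * d * Y⁻¹ = Y⁻¹ * ((Y * Y) * d * (Y * Y)⁻¹) * Y := by group
      _ = _ := by rw [h.eq_conj]
  have h1 : X⁻¹ * (u * b) * (L⁻¹ * (u' * b')) =
      X⁻¹ * L⁻¹ * (u * u') * ((L⁻¹ * b * L) * b') := by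
    rw [← e1 hb]
    calc _ = X⁻¹ * L⁻¹ * (L * u * L⁻¹) * ((L * b * L⁻¹) * u') * b' := by group
      _ = _ := by rw [huL.eq_conj, ← hub'.eq]; group
  have h2 : L⁻¹ * (u' * b') * (X⁻¹ * (u * b)) =
      X⁻¹ * L⁻¹ * (u * u') * ((X⁻¹ * b' * X) * b) := by
    rw [← e1 hb', (hXL.inv_inv).eq, huu.eq]
    calc _ = L⁻¹ * X⁻¹ * (X * u' * X⁻¹) * ((X * b' * X⁻¹) * u) * b := by group
      _ = _ := by rw [huX.eq_conj, ← hub.eq]; group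
  have e : ∀ g h : G, cm g h = (h * g)⁻¹ * (g * h) := by intro g h; simp only [cm]; group
  rw [e, h1, h2, e]
  calc _ = b⁻¹ * X⁻¹ * b'⁻¹ * (X * L⁻¹) * b * L * b' := by group
    _ = b⁻¹ * X⁻¹ * b'⁻¹ * (L⁻¹ * X) * b * L * b' := by rw [hXL.inv_right.eq]
    _ = _ := by group

theorem commutator_first_part_mem {u u' b b' X L : G} (hXL : Commute X L) (huu : cm u u' ∈ T)
    (huL : cm u L ∈ T) (huX : cm u' X ∈ T) (hub : cm u (X * b' * X⁻¹) ∈ T)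
    (hub' : cm u' (L * b * L⁻¹) ∈ T) (hb : cm b (L * L) ∈ T) (hb' : cm b' (X * X) ∈ T) :
    cm (X⁻¹ * (u * b)) (L⁻¹ * (u' * b')) * (cm (X * b) (L * b'))⁻¹ ∈ T := by
  simp only [cm_mem_iff] at *
  rw [mem_iff_mk'_eq_one]
  simp only [map_mul, map_inv, map_cm] at *
  rw [commutator_first_part_eq _ huu huL huX hub hub' hb hb', mul_inv_cancel]
  exact hXL.map _

theorem commutator_second_part_mem {b b' X L : G} (hXL : Commute X L) (hbb : cm b b' ∈ T)
    (hb : cm b L ∈ T) (hb' : cm b' X ∈ T) : cm (X * b) (L * b') ∈ T := by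
  simp only [cm_mem_iff] at *
  simp only [map_mul]
  exact ((hXL.map (QuotientGroup.mk' T)).mul_right hb'.symm).mul_left (hb.mul_right hbb)

end CommutatorCalculus

-- Sections of elements of Γ, and the decomposition Γ' = ⟨c⟩(Γ' × Γ')

namespace BSV

/-- The element `x = μτ = (τ, μ⁻¹)`. -/
def xPerm : WordPerm := muPerm * tauPerm

theorem xPerm_mem : xPerm ∈ Gam := mul_mem muPerm_mem tauPerm_mem

theorem pair_mul (a b a' b' : WordPerm) : pair (a, b) * pair (a', b') = pair (a * a', b * b') := by
  rw [← map_mul]; rfl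

theorem pair_inv (a b : WordPerm) : (pair (a, b))⁻¹ = pair (a⁻¹, b⁻¹) := by
  rw [← map_inv]; rfl

theorem pair_zpow (a b : WordPerm) (k : ℤ) : pair (a, b) ^ k = pair (a ^ k, b ^ k) := by
  rw [← map_zpow]; rfl

theorem pair_pow (a b : WordPerm) (k : ℕ) : pair (a, b) ^ k = pair (a ^ k, b ^ k) := by
  rw [← map_pow]; rfl

theorem pair_injective : Function.Injective pair := by
  rw [injective_iff_map_eq_one]
  rintro ⟨a, b⟩ h
  have h' : ∀ w, pairFun a.act b.act w = w := fun w => congrArg (fun g => WordPerm.act g w) h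
  refine Prod.ext (MulOpposite.unop_injective (Equiv.ext fun w => ?_))
    (MulOpposite.unop_injective (Equiv.ext fun w => ?_))
  · simpa [pairFun, WordPerm.act] using h' (false :: w)
  · simpa [pairFun, WordPerm.act] using h' (true :: w)

theorem cPerm_zpow (k : ℤ) : cPerm ^ k = pair ((xPerm ^ k)⁻¹, xPerm ^ k) := by
  rw [cPerm_eq, pair_zpow, inv_zpow]; rfl

theorem cm_tauPerm_muPerm : cm tauPerm muPerm = cPerm := rfl

theorem conj_pair_odd (p q a b : WordPerm) :
    (pair (p, q) * eps)⁻¹ * pair (a, b) * (pair (p, q) * eps) =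
      pair (q⁻¹ * b * q, p⁻¹ * a * p) := by
  have e1 : (pair (p, q) * eps)⁻¹ * pair (a, b) * (pair (p, q) * eps) =
      eps⁻¹ * ((pair (p, q))⁻¹ * pair (a, b) * pair (p, q)) * eps := by group
  rw [e1, pair_inv, pair_mul, pair_mul, mul_assoc, ← eps_mul_pair, inv_mul_cancel_left]

theorem conj_pair_even (p q a b : WordPerm) :
    (pair (p, q))⁻¹ * pair (a, b) * pair (p, q) = pair (p⁻¹ * a * p, q⁻¹ * b * q) := by
  rw [pair_inv, pair_mul, pair_mul]

theorem cm_pair_odd (p q a b : WordPerm) :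
    cm (pair (a, b)) (pair (p, q) * eps) = pair (a⁻¹ * q⁻¹ * b * q, b⁻¹ * p⁻¹ * a * p) := by
  have : cm (pair (a, b)) (pair (p, q) * eps) =
      (pair (a, b))⁻¹ * ((pair (p, q) * eps)⁻¹ * pair (a, b) * (pair (p, q) * eps)) := by
    simp only [cm]; group
  rw [this, conj_pair_odd, pair_inv, pair_mul]
  simp only [mul_assoc]

theorem cm_pair_pair (p q a b : WordPerm) :
    cm (pair (a, b)) (pair (p, q)) = pair (cm a p, cm b q) := by
  simp only [cm, pair_mul, pair_inv]

theorem odd_mul_odd (p q p' q' : WordPerm) :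
    pair (p, q) * eps * (pair (p', q') * eps) = pair (p * q', q * p') := by
  rw [mul_assoc, ← mul_assoc eps, eps_mul_pair, mul_assoc, eps_mul_eps, mul_one, pair_mul]

theorem odd_inv (p q : WordPerm) : (pair (p, q) * eps)⁻¹ = pair (q⁻¹, p⁻¹) * eps := by
  rw [inv_eq_iff_mul_eq_one, odd_mul_odd]
  simp only [mul_inv_cancel]
  exact map_one pair

/-- The odd elements of `Γ` are the elements `(p, q)ε`. -/
def IsOdd (y : WordPerm) : Prop := ∃ p ∈ Gam, ∃ q ∈ Gam, y = pair (p, q) * eps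

theorem isOdd_tauPerm : IsOdd tauPerm := ⟨1, one_mem _, tauPerm, tauPerm_mem, tauPerm_eq⟩

theorem isOdd_muPerm : IsOdd muPerm := ⟨1, one_mem _, muPerm⁻¹, inv_mem muPerm_mem, muPerm_eq⟩

theorem even_or_isOdd {y : WordPerm} (hy : y ∈ Gam) :
    (∃ p ∈ Gam, ∃ q ∈ Gam, y = pair (p, q)) ∨ IsOdd y := by
  have hmul : ∀ x y, ((∃ p ∈ Gam, ∃ q ∈ Gam, x = pair (p, q)) ∨ IsOdd x) → IsOdd y →
      (∃ p ∈ Gam, ∃ q ∈ Gam, x * y = pair (p, q)) ∨ IsOdd (x * y) := by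
    rintro _ _ (⟨p, hp, q, hq, rfl⟩ | ⟨p, hp, q, hq, rfl⟩) ⟨p', hp', q', hq', rfl⟩
    · exact Or.inr ⟨_, mul_mem hp hp', _, mul_mem hq hq', by rw [← mul_assoc, pair_mul]⟩
    · exact Or.inl ⟨_, mul_mem hp hq', _, mul_mem hq hp', odd_mul_odd _ _ _ _⟩
  have hinv : ∀ y, IsOdd y → IsOdd y⁻¹ := by
    rintro _ ⟨p, hp, q, hq, rfl⟩
    exact ⟨_, inv_mem hq, _, inv_mem hp, odd_inv _ _⟩
  induction hy using Subgroup.closure_induction_right with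
  | one => exact Or.inl ⟨1, one_mem _, 1, one_mem _, (map_one pair).symm⟩
  | mul_right x hx y hy ih =>
    refine hmul _ _ ih ?_
    rcases hy with rfl | rfl
    exacts [isOdd_tauPerm, isOdd_muPerm]
  | mul_inv_cancel x hx y hy ih =>
    refine hmul _ _ ih (hinv _ ?_)
    rcases hy with rfl | rfl
    exacts [isOdd_tauPerm, isOdd_muPerm]

/-- A property of elements of `Γ` that holds for odd elements and passes to products holds for
all elements. -/
theorem odd_induction {P : WordPerm → Prop} (hodd : ∀ y ∈ Gam, IsOdd y → P y)
    (hmul : ∀ y ∈ Gam, ∀ z ∈ Gam, P y → P z → P (y * z)) {y : WordPerm} (hy : y ∈ Gam) : P y := by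
  rcases even_or_isOdd hy with ⟨p, hp, q, hq, rfl⟩ | h
  · have ht := inv_mem tauPerm_mem
    have e : tauPerm⁻¹ = pair (tauPerm⁻¹, 1) * eps := by
      conv_lhs => rw [tauPerm_eq, odd_inv, inv_one]
    -- An even element is the product of the odd elements yτ⁻¹ and τ.
    have h1 : P (pair (p, q) * tauPerm⁻¹) :=
      hodd _ (mul_mem hy ht) ⟨_, mul_mem hp ht, _, hq, by conv_lhs => rw [e, ← mul_assoc, pair_mul, mul_one]⟩
    have h2 := hmul _ (mul_mem hy ht) _ tauPerm_mem h1 (hodd _ tauPerm_mem isOdd_tauPerm)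
    rwa [inv_mul_cancel_right] at h2
  · exact hodd _ hy h

theorem cm_mem_Gam' {y z : WordPerm} (hy : y ∈ Gam) (hz : z ∈ Gam) : cm y z ∈ Gam' := by
  have := Subgroup.commutator_mem_commutator (inv_mem hy) (inv_mem hz)
  simpa [commutatorElement_def, cm, Gam'] using this

theorem pair_mem {a b : WordPerm} (ha : a ∈ Gam') (hb : b ∈ Gam') : pair (a, b) ∈ Gam' := by
  have := mul_mem (pair_one_mem ha) (one_pair_mem hb)
  rwa [pair_mul, mul_one, one_mul] at this

theorem conj_mem_Gam'' {y a : WordPerm} (hy : y ∈ Gam) (ha : a ∈ Gam') : y⁻¹ * a * y ∈ Gam' := by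
  simpa using conj_mem_Gam' (inv_mem hy) ha

theorem conj_cPerm_zpow_pair (a b : WordPerm) (l : ℤ) :
    (cPerm ^ l)⁻¹ * pair (a, b) * cPerm ^ l =
      pair (xPerm ^ l * a * (xPerm ^ l)⁻¹, (xPerm ^ l)⁻¹ * b * xPerm ^ l) := by
  rw [cPerm_zpow, conj_pair_even, inv_inv]

theorem zpow_mul_pair_mul (k l : ℤ) (u b u' b' : WordPerm) :
    cPerm ^ k * pair (u * b, b) * (cPerm ^ l * pair (u' * b', b')) =
      cPerm ^ (k + l) * pair (xPerm ^ l * u * b * (xPerm ^ l)⁻¹ * u' * (xPerm ^ l)⁻¹ * b⁻¹ *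
        xPerm ^ l * ((xPerm ^ l)⁻¹ * b * xPerm ^ l * b'), (xPerm ^ l)⁻¹ * b * xPerm ^ l * b') := by
  have e : xPerm ^ l * u * b * (xPerm ^ l)⁻¹ * u' * (xPerm ^ l)⁻¹ * b⁻¹ * xPerm ^ l *
      ((xPerm ^ l)⁻¹ * b * xPerm ^ l * b') =
      xPerm ^ l * (u * b) * (xPerm ^ l)⁻¹ * (u' * b') := by group
  rw [e, ← pair_mul, ← conj_cPerm_zpow_pair, zpow_add]
  group

/-- Conjugation by an odd element swaps the sections x⁻ᵏ and xᵏ of c^k, so it inverts c^k up to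
commutators in the two sections. -/
theorem conj_cPerm_odd (p q : WordPerm) (k : ℤ) :
    (pair (p, q) * eps)⁻¹ * cPerm ^ k * (pair (p, q) * eps) =
      (cPerm ^ k)⁻¹ * pair (cm (xPerm ^ k) q, cm (xPerm ^ k)⁻¹ p) := by
  rw [cPerm_zpow, conj_pair_odd, pair_inv, pair_mul]
  simp only [cm]
  congr 2 <;> group

/-- `Γ'` is the normal closure of `c` in `Γ`. -/
theorem Gam'_le_of_normal {H : Subgroup WordPerm} (hnorm : ∀ y ∈ Gam, ∀ h ∈ H, y⁻¹ * h * y ∈ H)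
    (hcH : cPerm ∈ H) : Gam' ≤ H := by
  have : (H.subgroupOf Gam).Normal := ⟨fun h hh y => by
    have := hnorm _ (inv_mem y.2) _ hh
    rw [inv_inv] at this
    exact this⟩
  have hgen : ∀ y ∈ ({tauPerm, muPerm} : Set WordPerm), ∀ z ∈ Gam, cm z y ∈ H := by
    intro y hy z hz
    have hyG : y ∈ Gam := Subgroup.subset_closure hy
    have h0 : ∀ y' ∈ ({tauPerm, muPerm} : Set WordPerm), cm y' y ∈ H := by
      have hc' : cm muPerm tauPerm ∈ H := by
        rw [← cm_inv, cm_tauPerm_muPerm]; exact inv_mem hcH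
      have h1 : ∀ a : WordPerm, cm a a ∈ H := fun a => by
        rw [cm_eq_one_iff.2 (Commute.refl a)]; exact one_mem _
      rcases hy with rfl | rfl <;> rintro y' (rfl | rfl)
      exacts [h1 _, hc', hcH, h1 _]
    -- The elements that commute with the generator y modulo H form a subgroup, which contains τ and
    -- μ because [τ, μ]^(±1) lies in H; hence it is all of Γ. The same argument in the other
    -- variable then gives that Γ is abelian modulo H.
    let K : Subgroup Gam := (Subgroup.centralizer {QuotientGroup.mk' (H.subgroupOf Gam)
      ⟨y, hyG⟩}).comap (QuotientGroup.mk' (H.subgroupOf Gam))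
    have hK : Gam ≤ K.map Gam.subtype := by
      refine (Subgroup.closure_le _).2 fun y' hy' => ?_
      refine ⟨⟨y', Subgroup.subset_closure hy'⟩, ?_, rfl⟩
      have := (cm_mem_iff (H.subgroupOf Gam) (a := ⟨y', Subgroup.subset_closure hy'⟩)
        (b := ⟨y, hyG⟩)).1 (h0 y' hy')
      rintro _ rfl
      exact this.eq.symm
    obtain ⟨z', hz', rfl⟩ := hK hz
    exact (cm_mem_iff (H.subgroupOf Gam) (a := z') (b := ⟨y, hyG⟩)).2 (hz' _ rfl).symm
  have hall : ∀ z ∈ Gam, ∀ y ∈ Gam, cm z y ∈ H := by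
    intro z hz y hy
    let K : Subgroup Gam := (Subgroup.centralizer {QuotientGroup.mk' (H.subgroupOf Gam)
      ⟨z, hz⟩}).comap (QuotientGroup.mk' (H.subgroupOf Gam))
    have hK : Gam ≤ K.map Gam.subtype := by
      refine (Subgroup.closure_le _).2 fun y' hy' => ?_
      refine ⟨⟨y', Subgroup.subset_closure hy'⟩, ?_, rfl⟩
      have := (cm_mem_iff (H.subgroupOf Gam) (a := ⟨z, hz⟩)
        (b := ⟨y', Subgroup.subset_closure hy'⟩)).1 (hgen y' hy' z hz)
      rintro _ rfl
      exact this.eq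
    obtain ⟨z', hz', rfl⟩ := hK hy
    exact (cm_mem_iff (H.subgroupOf Gam) (a := ⟨z, hz⟩) (b := z')).2 (hz' _ rfl)
  refine Subgroup.commutator_le.2 fun a ha b hb => ?_
  have := hall _ (inv_mem ha) _ (inv_mem hb)
  simpa [cm, commutatorElement_def] using this

/-- `Γ' = ⟨c⟩(Γ' × Γ')`. -/
theorem exists_eq_zpow_mul_pair {g : WordPerm} (hg : g ∈ Gam') :
    ∃ k : ℤ, ∃ a ∈ Gam', ∃ b ∈ Gam', g = cPerm ^ k * pair (a, b) := by
  let H : Subgroup WordPerm :=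
    { carrier := {g | ∃ k : ℤ, ∃ a ∈ Gam', ∃ b ∈ Gam', g = cPerm ^ k * pair (a, b)}
      one_mem' := ⟨0, 1, one_mem _, 1, one_mem _, by
        rw [zpow_zero, one_mul]; exact (map_one pair).symm⟩
      mul_mem' := by
        rintro _ _ ⟨k, a, ha, b, hb, rfl⟩ ⟨l, a', ha', b', hb', rfl⟩
        have hx := zpow_mem xPerm_mem l
        refine ⟨k + l, xPerm ^ l * a * (xPerm ^ l)⁻¹ * a',
          mul_mem (conj_mem_Gam' hx ha) ha', (xPerm ^ l)⁻¹ * b * xPerm ^ l * b',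
          mul_mem (conj_mem_Gam'' hx hb) hb', ?_⟩
        rw [← pair_mul, ← conj_cPerm_zpow_pair, zpow_add]
        group
      inv_mem' := by
        rintro _ ⟨k, a, ha, b, hb, rfl⟩
        have hx := zpow_mem xPerm_mem (-k)
        refine ⟨-k, xPerm ^ (-k) * a⁻¹ * (xPerm ^ (-k))⁻¹, conj_mem_Gam' hx (inv_mem ha),
          (xPerm ^ (-k))⁻¹ * b⁻¹ * xPerm ^ (-k), conj_mem_Gam'' hx (inv_mem hb), ?_⟩
        rw [← conj_cPerm_zpow_pair, ← pair_inv]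
        group }
  have hHG : H ≤ Gam' := by
    rintro _ ⟨k, a, ha, b, hb, rfl⟩
    exact mul_mem (zpow_mem cPerm_mem k) (pair_mem ha hb)
  have hpair : ∀ a ∈ Gam', ∀ b ∈ Gam', pair (a, b) ∈ H := fun a ha b hb =>
    ⟨0, a, ha, b, hb, by simp⟩
  have hcH : cPerm ∈ H := ⟨1, 1, one_mem _, 1, one_mem _, by
    rw [zpow_one, show ((1 : WordPerm), (1 : WordPerm)) = 1 from rfl, map_one, mul_one]⟩
  have hnorm : ∀ y ∈ Gam, ∀ h ∈ H, y⁻¹ * h * y ∈ H := by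
    intro y hy
    -- For odd y, conjugation sends c^k to c^(-k) times a pair of commutators and swaps the two
    -- sections of a pair up to conjugation; both results stay in H.
    refine odd_induction (P := fun y => ∀ h ∈ H, y⁻¹ * h * y ∈ H) ?_ ?_ hy
    · rintro y hy ⟨p, hp, q, hq, rfl⟩ _ ⟨k, a, ha, b, hb, rfl⟩
      have hx := zpow_mem xPerm_mem k
      have e : ∀ y : WordPerm, y⁻¹ * (cPerm ^ k * pair (a, b)) * y =
          (y⁻¹ * cPerm ^ k * y) * (y⁻¹ * pair (a, b) * y) := by intro y; group
      rw [e, conj_cPerm_odd, conj_pair_odd]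
      exact mul_mem (mul_mem (inv_mem (zpow_mem hcH k))
        (hpair _ (cm_mem_Gam' hx hq) _ (cm_mem_Gam' (inv_mem hx) hp)))
        (hpair _ (conj_mem_Gam'' hq hb) _ (conj_mem_Gam'' hp ha))
    · intro y _ z _ h1 h2 h hh
      have := h2 _ (h1 h hh)
      rwa [show (y * z)⁻¹ * h * (y * z) = z⁻¹ * (y⁻¹ * h * y) * z by group]
  exact Gam'_le_of_normal hnorm hcH hg

end BSV

-- The weight filtration of Γ', and consequences of its estimates at a fixed depth

namespace BSV

theorem pow_two_pow_succ {G : Type*} [Group G] (y : G) (j : ℕ) :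
    y ^ 2 ^ (j + 1) = y ^ 2 ^ j * y ^ 2 ^ j := by
  rw [pow_succ 2 j, pow_mul, pow_two]

/-- The products `cᵏ(ub, b)` with `u ∈ A`, `b ∈ B` and `n ≤ 2ʲw` for some `2ʲ ∣ k`. -/
def blockSet (A B : Subgroup WordPerm) (w n : ℚ) : Set WordPerm :=
  {g | ∃ k : ℤ, ∃ u ∈ A, ∃ b ∈ B, (∃ j : ℕ, (2 ^ j : ℤ) ∣ k ∧ n ≤ 2 ^ j * w) ∧
    g = cPerm ^ k * pair (u * b, b)}

/-- A filtration of `Γ'` in which the element `W(c)^(2ʲ)` has weight `2ʲ(e + s)`, where `e + 1` is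
the degree of `W(c)`; words of length at least `N` are ignored. -/
def filt : ℕ → ℚ → ℚ → Subgroup WordPerm
  | 0, _, _ => Gam'
  | N + 1, s, n => Subgroup.closure
      (blockSet (filt N (s / 2) (n / 2)) (filt N ((1 + s) / 2) (n / 2)) (1 + s) n)

theorem mem_filt_of_blockSet {N : ℕ} {s n : ℚ} {k : ℤ} {u b : WordPerm}
    (hu : u ∈ filt N (s / 2) (n / 2)) (hb : b ∈ filt N ((1 + s) / 2) (n / 2)) {j : ℕ}
    (hk : (2 ^ j : ℤ) ∣ k) (hn : n ≤ 2 ^ j * (1 + s)) :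
    cPerm ^ k * pair (u * b, b) ∈ filt (N + 1) s n :=
  Subgroup.subset_closure ⟨k, u, hu, b, hb, ⟨j, hk, hn⟩, rfl⟩

theorem filt_le_Gam' (N : ℕ) (s n : ℚ) : filt N s n ≤ Gam' := by
  induction N generalizing s n with
  | zero => exact le_rfl
  | succ N ih =>
    refine (Subgroup.closure_le _).2 ?_
    rintro _ ⟨k, u, hu, b, hb, -, rfl⟩
    exact mul_mem (zpow_mem cPerm_mem k) (pair_mem (mul_mem (ih _ _ hu) (ih _ _ hb)) (ih _ _ hb))

theorem filt_le_Gam (N : ℕ) (s n : ℚ) : filt N s n ≤ Gam := (filt_le_Gam' N s n).trans Gam'_le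

/-- The least weight is 1 + s, that of c. The hypothesis passes to both components, since n/2 ≤ 1 +
s/2 and n/2 ≤ 1 + (1 + s)/2. -/
theorem filt_eq_Gam' (N : ℕ) {s n : ℚ} (hs : 0 ≤ s) (hn : n ≤ 1 + s) : filt N s n = Gam' := by
  refine le_antisymm (filt_le_Gam' N s n) ?_
  induction N generalizing s n with
  | zero => exact le_rfl
  | succ N ih =>
    intro g hg
    obtain ⟨k, a, ha, b, hb, rfl⟩ := exists_eq_zpow_mul_pair hg
    have := mem_filt_of_blockSet (N := N) (s := s) (n := n) (k := k) (u := a * b⁻¹) (b := b)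
      (ih (by linarith) (by linarith) (mul_mem ha (inv_mem hb)))
      (ih (by linarith) (by linarith) hb) (j := 0) (by simp) (by linarith)
    rwa [inv_mul_cancel_right] at this

/-- The pair (s, n) matters only through the inequalities n ≤ P(e + s), with P a power of 2 and e
the index of a word. Comparing these for all rational P, e ≥ 1 is a condition that survives the
passage to components, where e is replaced by 2e and 2e + 1. -/
theorem filt_mono (N : ℕ) {s n s' n' : ℚ}
    (h : ∀ P e : ℚ, 1 ≤ P → 1 ≤ e → n ≤ P * (e + s) → n' ≤ P * (e + s')) :
    filt N s n ≤ filt N s' n' := by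
  induction N generalizing s n s' n' with
  | zero => exact le_rfl
  | succ N ih =>
    refine Subgroup.closure_mono ?_
    rintro _ ⟨k, u, hu, b, hb, ⟨j, hj, hn⟩, rfl⟩
    refine ⟨k, u, ih ?_ hu, b, ih ?_ hb, ⟨j, hj, h _ _ (one_le_pow₀ one_le_two) le_rfl hn⟩, rfl⟩
    · intro P e hP he hn
      have := h P (2 * e) hP (by linarith) (by linarith)
      linarith
    · intro P e hP he hn
      have := h P (2 * e + 1) hP (by linarith) (by linarith)
      linarith

theorem filt_anti (N : ℕ) {s n n' : ℚ} (h : n' ≤ n) : filt N s n ≤ filt N s n' :=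
  filt_mono N fun _ _ _ _ h' => h.trans h'

theorem exists_le_two_pow_mul {n w : ℚ} (hw : 1 ≤ w) : ∃ j : ℕ, n ≤ 2 ^ j * w := by
  obtain ⟨j, hj⟩ := pow_unbounded_of_one_lt n (one_lt_two (α := ℚ))
  exact ⟨j, by nlinarith [pow_pos (two_pos (α := ℚ)) j]⟩

theorem exists_dvd_le_pair {j j' : ℕ} {k k' : ℤ} {n w : ℚ} (h : (2 ^ j : ℤ) ∣ k)
    (hn : n ≤ 2 ^ j * w) (h' : (2 ^ j' : ℤ) ∣ k') (hn' : n ≤ 2 ^ j' * w) :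
    ∃ i : ℕ, (2 ^ i : ℤ) ∣ k ∧ (2 ^ i : ℤ) ∣ k' ∧ n ≤ 2 ^ i * w := by
  rcases le_total j j' with hj | hj
  · exact ⟨j, h, (pow_dvd_pow 2 hj).trans h', hn⟩
  · exact ⟨j', (pow_dvd_pow 2 hj).trans h, h', hn'⟩

/-- The commutator and square estimates for the filtration of depth `N`. -/
structure FiltEstimates (N : ℕ) : Prop where
  -- A commutator with an element of Γ may lower the parameter by any r ≤ t; it then gains only 1 -
  -- r in weight. Different r are needed because u and b have different parameters but must land in
  -- the same subgroup.
  cm_Gam : ∀ {t r n : ℚ}, 0 ≤ r → r ≤ t → t ≤ 1 → 0 ≤ n → ∀ {g}, g ∈ filt N t n →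
    ∀ {y}, y ∈ Gam → cm g y ∈ filt N (t - r) (n + 1 - r)
  sq : ∀ {t n : ℚ}, 0 ≤ t → t ≤ 1 → 0 ≤ n → ∀ {g}, g ∈ filt N t n → g ^ 2 ∈ filt N t (2 * n)
  cm_filt : ∀ {t t' n m : ℚ}, t ≤ 1 → t' ≤ 1 → 1 ≤ t + t' → 0 ≤ n → 0 ≤ m →
    ∀ {g}, g ∈ filt N t n → ∀ {h}, h ∈ filt N t' m → cm g h ∈ filt N (t + t' - 1) (n + m)

namespace FiltEstimates

variable {N : ℕ} (E : FiltEstimates N)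
include E

theorem conj_mem {s n : ℚ} (hs : 0 ≤ s) (hs' : s ≤ 1) (hn : 0 ≤ n) {y g : WordPerm} (hy : y ∈ Gam)
    (hg : g ∈ filt N s n) : y⁻¹ * g * y ∈ filt N s n := by
  rw [conj_eq_mul_cm]
  have := E.cm_Gam le_rfl hs hs' hn hg hy
  rw [sub_zero] at this
  exact mul_mem hg (filt_anti N (by linarith) this)

theorem conj_mem' {s n : ℚ} (hs : 0 ≤ s) (hs' : s ≤ 1) (hn : 0 ≤ n) {y g : WordPerm} (hy : y ∈ Gam)
    (hg : g ∈ filt N s n) : y * g * y⁻¹ ∈ filt N s n := by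
  simpa using E.conj_mem hs hs' hn (inv_mem hy) hg

theorem normal {s n : ℚ} (hs : 0 ≤ s) (hs' : s ≤ 1) (hn : 0 ≤ n) :
    ((filt N s n).subgroupOf Gam).Normal :=
  ⟨fun _ hg y => E.conj_mem' hs hs' hn y.2 hg⟩

/-- Induction through [g, z²] = [g, z]² [[g, z], z] with z = y^(2^j). The square doubles the weight;
in the double commutator the loss r is shared equally between the two steps. -/
theorem cm_pow (j : ℕ) {y : WordPerm} (hy : y ∈ Gam) {t r n : ℚ} (hr : 0 ≤ r) (hrt : r ≤ t)
    (ht : t ≤ 1) (hn : 0 ≤ n) {g : WordPerm} (hg : g ∈ filt N t n) :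
    cm g (y ^ 2 ^ j) ∈ filt N (t - r) (n + 2 ^ j * (1 - r)) := by
  induction j generalizing t r n g with
  | zero =>
    have := E.cm_Gam hr hrt ht hn hg hy
    simpa [add_sub_assoc] using this
  | succ j ih =>
    have hJ : (0 : ℚ) < 2 ^ j := by positivity
    rw [pow_two_pow_succ, cm_mul_self_right]
    refine mul_mem ?_ ?_
    · have h1 := ih hr hrt ht hn hg
      refine filt_anti N ?_ (E.sq (by linarith) (by linarith)
        (add_nonneg hn (mul_nonneg hJ.le (by linarith))) h1)
      rw [pow_succ]
      linarith
    · have h1 := ih (r := r / 2) (by linarith) (by linarith) ht hn hg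
      have h2 := ih (r := r / 2) (by linarith) (by linarith) (by linarith)
        (add_nonneg hn (mul_nonneg hJ.le (by linarith))) h1
      rw [show t - r / 2 - r / 2 = t - r by ring] at h2
      refine filt_anti N ?_ h2
      rw [pow_succ]
      nlinarith

/-- Sharper than `cm_pow` at j + 1 with loss r + 1/2, which would gain only 2^j(1 - 2r). The extra
loss of 1/2 is absorbed by the square of [g, y^(2^j)], whose weight is doubled, and is spent only
once in the double commutator. -/
theorem cm_pow_succ (j : ℕ) {y : WordPerm} (hy : y ∈ Gam) {t r n : ℚ} (hr : 0 ≤ r)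
    (hrt : r + 1 / 2 ≤ t) (ht : t ≤ 1) (hn : 0 ≤ n) {g : WordPerm} (hg : g ∈ filt N t n) :
    cm g (y ^ 2 ^ j * y ^ 2 ^ j) ∈ filt N (t - r - 1 / 2) (n + 2 ^ j * (1 - r)) := by
  have hJ : (0 : ℚ) < 2 ^ j := by positivity
  rw [cm_mul_self_right]
  have h1 := E.cm_pow j hy hr (by linarith) ht hn hg
  have h0 : 0 ≤ n + 2 ^ j * (1 - r) := add_nonneg hn (mul_nonneg hJ.le (by linarith))
  refine mul_mem ?_ ?_
  · refine filt_mono N (fun P e hP he h => ?_) (E.sq (by linarith) (by linarith) h0 h1)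
    nlinarith
  · refine filt_anti N ?_ (E.cm_pow j hy (r := 1 / 2) (by norm_num) (by linarith) (by linarith)
      h0 h1)
    nlinarith

/-- A commutator of elements of Γ lies in Γ', which is everything of weight at least 1 at s = 0.
Each squaring of y doubles the weight, by [z², w] = v[v, z]v with v = [z, w]. -/
theorem pow_cm (j : ℕ) {y z : WordPerm} (hy : y ∈ Gam) (hz : z ∈ Gam) :
    cm (y ^ 2 ^ j) z ∈ filt N 0 (2 ^ j) := by
  induction j with
  | zero =>
    rw [filt_eq_Gam' N le_rfl (by simp)]
    exact cm_mem_Gam' (pow_mem hy _) hz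
  | succ j ih =>
    have hJ : (0 : ℚ) ≤ 2 ^ j := by positivity
    rw [pow_two_pow_succ, cm_mul_self_left]
    have h1 := E.sq le_rfl zero_le_one hJ ih
    have h2 := E.cm_pow j hy le_rfl le_rfl zero_le_one hJ ih
    have h3 := E.conj_mem (n := 2 ^ (j + 1)) le_rfl zero_le_one (by positivity)
      (filt_le_Gam _ _ _ ih) (g := cm (cm (y ^ 2 ^ j) z) (y ^ 2 ^ j))
      (by rw [pow_succ, mul_two]; simpa using h2)
    have h4 : cm (y ^ 2 ^ j) z ^ 2 ∈ filt N 0 (2 ^ (j + 1)) :=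
      filt_anti N (by rw [pow_succ]; linarith) h1
    have := mul_mem h4 h3
    rwa [show ∀ v w : WordPerm, v ^ 2 * (v⁻¹ * w * v) = v * w * v by
      intro v w; rw [pow_two]; group] at this

theorem pow_cm_pow (i j : ℕ) {y z : WordPerm} (hy : y ∈ Gam) (hz : z ∈ Gam) :
    cm (y ^ 2 ^ j) (z ^ 2 ^ i) ∈ filt N 1 (2 ^ j + 2 ^ i) := by
  induction i with
  | zero =>
    -- Raising s from 0 to 1 adds P ≥ 1 to every weight Pe, which accounts for the summand 2^0.
    refine filt_mono N (fun P e hP he h => ?_) (E.pow_cm j hy (pow_mem hz _))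
    rw [pow_zero]
    linarith
  | succ i ih =>
    have hJ : (0 : ℚ) < 2 ^ j := by positivity
    have hI : (0 : ℚ) < 2 ^ i := by positivity
    rw [pow_two_pow_succ, cm_mul_self_right]
    refine mul_mem ?_ ?_
    · refine filt_anti N ?_ (E.sq zero_le_one le_rfl (by positivity) ih)
      rw [pow_succ]
      linarith
    · have := E.cm_pow i hz le_rfl zero_le_one le_rfl (by positivity) ih
      rw [sub_zero] at this
      refine filt_anti N ?_ this
      rw [pow_succ]
      linarith

/-- The generating blocks already form a subgroup, so every element of the filtration has components
satisfying the bounds; this is what lets coordinates be read off. The corrections in products and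
inverses are commutators [b, L²], and they fit into the 𝟖-component because commuting with Γ at loss
1/2 takes the parameter (1 + s)/2 of b to s/2. -/
theorem filt_succ_eq {s n : ℚ} (hs : 0 ≤ s) (hs' : s ≤ 1) (hn : 0 ≤ n) :
    (filt (N + 1) s n : Set WordPerm) =
      blockSet (filt N (s / 2) (n / 2)) (filt N ((1 + s) / 2) (n / 2)) (1 + s) n := by
  have hnorm := E.normal (s := s / 2) (n := n / 2) (by linarith) (by linarith) (by linarith)
  have hT : ∀ {b y : WordPerm}, b ∈ filt N ((1 + s) / 2) (n / 2) → y ∈ Gam →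
      cm b y ∈ filt N (s / 2) (n / 2) := by
    intro b y hb hy
    have := E.cm_Gam (r := 1 / 2) (by norm_num) (by linarith) (by linarith) (by linarith) hb hy
    rw [show (1 + s) / 2 - 1 / 2 = s / 2 by ring] at this
    exact filt_anti N (by linarith) this
  let H : Subgroup WordPerm :=
    { carrier := blockSet (filt N (s / 2) (n / 2)) (filt N ((1 + s) / 2) (n / 2)) (1 + s) n
      one_mem' := by
        -- The exponent 0 is divisible by every 2^j, so j may be taken large enough.
        obtain ⟨j, hj⟩ := exists_le_two_pow_mul (n := n) (w := 1 + s) (by linarith)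
        refine ⟨0, 1, one_mem _, 1, one_mem _, ⟨j, dvd_zero _, hj⟩, ?_⟩
        rw [zpow_zero, one_mul, one_mul]
        exact (map_one pair).symm
      mul_mem' := by
        rintro _ _ ⟨k, u, hu, b, hb, ⟨j, hj, hjn⟩, rfl⟩ ⟨l, u', hu', b', hb', ⟨j', hj', hjn'⟩, rfl⟩
        obtain ⟨i, hi, hi', hin⟩ := exists_dvd_le_pair hj hjn hj' hjn'
        have hx := zpow_mem xPerm_mem l
        refine ⟨k + l, _, product_part_mem ((filt N (s / 2) (n / 2)).subgroupOf Gam)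
          (u := ⟨u, filt_le_Gam _ _ _ hu⟩) (u' := ⟨u', filt_le_Gam _ _ _ hu'⟩)
          (b := ⟨b, filt_le_Gam _ _ _ hb⟩) (L := ⟨_, hx⟩) hu hu' (hT hb (mul_mem hx hx)),
          (xPerm ^ l)⁻¹ * b * xPerm ^ l * b', mul_mem (E.conj_mem (by linarith) (by linarith)
            (by linarith) hx hb) hb', ⟨i, dvd_add hi hi', hin⟩, ?_⟩
        exact zpow_mul_pair_mul k l u b u' b'
      inv_mem' := by
        rintro _ ⟨k, u, hu, b, hb, ⟨j, hj, hjn⟩, rfl⟩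
        have hx := zpow_mem xPerm_mem k
        refine ⟨-k, _, inverse_part_mem ((filt N (s / 2) (n / 2)).subgroupOf Gam)
          (u := ⟨u, filt_le_Gam _ _ _ hu⟩)
          (b := ⟨b, filt_le_Gam _ _ _ hb⟩) (L := ⟨_, hx⟩) hu (hT hb (mul_mem hx hx)),
          xPerm ^ k * b⁻¹ * (xPerm ^ k)⁻¹, E.conj_mem' (by linarith) (by linarith)
            (by linarith) hx (inv_mem hb), ⟨j, (dvd_neg).2 hj, hjn⟩, ?_⟩
        have e : (xPerm ^ k)⁻¹ * b⁻¹ * u⁻¹ * xPerm ^ k * (xPerm ^ k)⁻¹ * xPerm ^ k * xPerm ^ k *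
            b * (xPerm ^ k)⁻¹ * (xPerm ^ k * b⁻¹ * (xPerm ^ k)⁻¹) =
            xPerm ^ (-k) * (u * b)⁻¹ * (xPerm ^ (-k))⁻¹ := by group
        have e' : xPerm ^ k * b⁻¹ * (xPerm ^ k)⁻¹ = (xPerm ^ (-k))⁻¹ * b⁻¹ * xPerm ^ (-k) := by
          group
        refine Eq.trans ?_ (congrArg (fun a => cPerm ^ (-k) *
          pair (a, xPerm ^ k * b⁻¹ * (xPerm ^ k)⁻¹)) e.symm)
        rw [e', ← conj_cPerm_zpow_pair, ← pair_inv]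
        group }
  exact le_antisymm ((Subgroup.closure_le H).2 fun _ h => h) Subgroup.subset_closure

end FiltEstimates

end BSV

-- Induction on the depth for the commutator and square estimates

namespace BSV

theorem exists_zpow_eq_pow {x : WordPerm} (hx : x ∈ Gam) {j : ℕ} {k : ℤ} (hk : (2 ^ j : ℤ) ∣ k) :
    ∃ y ∈ Gam, x ^ k = y ^ 2 ^ j := by
  obtain ⟨m, rfl⟩ := hk
  refine ⟨x ^ m, zpow_mem hx m, ?_⟩
  rw [mul_comm, zpow_mul, ← zpow_natCast]
  norm_cast

theorem filtEstimates_zero : FiltEstimates 0 where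
  cm_Gam _ _ _ _ _ hg _ hy := cm_mem_Gam' (Gam'_le hg) hy
  sq _ _ _ _ hg := pow_mem hg 2
  cm_filt _ _ _ _ _ _ hg _ hh := cm_mem_Gam' (Gam'_le hg) (Gam'_le hh)

namespace FiltEstimates

variable {N : ℕ} (E : FiltEstimates N)
include E

theorem exists_of_mem_succ {s n : ℚ} (hs : 0 ≤ s) (hs' : s ≤ 1) (hn : 0 ≤ n) {g : WordPerm}
    (hg : g ∈ filt (N + 1) s n) : ∃ k : ℤ, ∃ u ∈ filt N (s / 2) (n / 2),
      ∃ b ∈ filt N ((1 + s) / 2) (n / 2), ∃ j : ℕ, (2 ^ j : ℤ) ∣ k ∧ n ≤ 2 ^ j * (1 + s) ∧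
        g = cPerm ^ k * pair (u * b, b) := by
  rw [← SetLike.mem_coe, E.filt_succ_eq hs hs' hn] at hg
  obtain ⟨k, u, hu, b, hb, ⟨j, hj, hjn⟩, rfl⟩ := hg
  exact ⟨k, u, hu, b, hb, j, hj, hjn, rfl⟩

theorem cm_zpow_mem {x y : WordPerm} (hx : x ∈ Gam) (hy : y ∈ Gam) {j : ℕ} {k : ℤ}
    (hk : (2 ^ j : ℤ) ∣ k) : cm (x ^ k) y ∈ filt N 0 (2 ^ j) := by
  obtain ⟨z, hz, e⟩ := exists_zpow_eq_pow hx hk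
  rw [e]
  exact E.pow_cm j hz hy

/-- With g = c^k(ub, b), X = x^k and y = (p, q)ε, the commutator is c^(-2k)(AB, B). The losses fit
exactly: b goes from (1 + t)/2 to (t - r)/2 at loss (1 + r)/2, gaining (1 - r)/2, and u goes from
t/2 to (t - r)/2 at loss r/2. Commutators with X are covered by `cm_zpow_mem`, because n ≤ 2^j(1 +
t) with 2^j dividing k. -/
theorem cm_odd_succ {t r n : ℚ} (hr : 0 ≤ r) (hrt : r ≤ t) (ht : t ≤ 1) (hn : 0 ≤ n)
    {g : WordPerm} (hg : g ∈ filt (N + 1) t n) {y : WordPerm} (hy : IsOdd y) :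
    cm g y ∈ filt (N + 1) (t - r) (n + 1 - r) := by
  obtain ⟨k, u, hu, b, hb, j, hj, hjn, rfl⟩ := E.exists_of_mem_succ (by linarith) ht hn hg
  obtain ⟨p, hp, q, hq, rfl⟩ := hy
  have hJ : (1 : ℚ) ≤ 2 ^ j := one_le_pow₀ one_le_two
  have hX := zpow_mem xPerm_mem k
  have hT8 := E.normal (s := (t - r) / 2) (n := (n + 1 - r) / 2) (by linarith) (by linarith)
    (by linarith)
  have hT9 := E.normal (s := (1 + (t - r)) / 2) (n := (n + 1 - r) / 2) (by linarith) (by linarith)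
    (by linarith)
  have hle : filt N ((t - r) / 2) ((n + 1 - r) / 2) ≤
      filt N ((1 + (t - r)) / 2) ((n + 1 - r) / 2) :=
    filt_mono N fun P e hP he h => by nlinarith
  have hb8 : ∀ y ∈ Gam, cm b y ∈ filt N ((t - r) / 2) ((n + 1 - r) / 2) := by
    intro y hy
    have := E.cm_Gam (r := (1 + r) / 2) (by linarith) (by linarith) (by linarith) (by linarith)
      hb hy
    rw [show (1 + t) / 2 - (1 + r) / 2 = (t - r) / 2 by ring] at this
    exact filt_anti N (by linarith) this
  have hu8 : ∀ y ∈ Gam, cm u y ∈ filt N ((t - r) / 2) ((n + 1 - r) / 2) := by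
    intro y hy
    have := E.cm_Gam (r := r / 2) (by linarith) (by linarith) (by linarith) (by linarith) hu hy
    rw [show t / 2 - r / 2 = (t - r) / 2 by ring] at this
    exact filt_anti N (by linarith) this
  have hX8 : ∀ y ∈ Gam, cm (xPerm ^ k) y ∈ filt N ((t - r) / 2) ((n + 1 - r) / 2) := by
    intro y hy
    refine filt_mono N (fun P e hP he h => ?_) (E.cm_zpow_mem xPerm_mem hy hj)
    nlinarith
  have hu2 : u ^ 2 ∈ filt N ((t - r) / 2) ((n + 1 - r) / 2) := by
    -- For n ≤ 1 + t the target is all of Γ'. For larger n the weight n of u² exceeds the required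
    -- (n + 1 - r)/2 by enough to pay for lowering the parameter from t/2 to (t - r)/2.
    by_cases h : n ≤ 1 + t
    · rw [filt_eq_Gam' N (by linarith) (by linarith)]
      exact pow_mem (filt_le_Gam' _ _ _ hu) 2
    · have := E.sq (by linarith) (by linarith) (by linarith) hu
      refine filt_mono N (fun P e hP he h' => ?_) this
      have h1 : n * (1 - r / 2) ≤ P * (e + (t - r) / 2) := by
        have h2 : n * (1 - r / 2) ≤ P * (e + t / 2) * (1 - r / 2) :=
          mul_le_mul_of_nonneg_right (by linarith) (by linarith)
        have h3 : 0 ≤ P * (r / 2) * (e + t / 2 - 1) := by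
          apply mul_nonneg (mul_nonneg _ _) <;> linarith
        nlinarith
      nlinarith
  have hu9 : u ∈ filt N ((1 + (t - r)) / 2) ((n + 1 - r) / 2) :=
    filt_mono N (fun P e hP he h => by nlinarith) hu
  have hB := bracket_second_part_mem
    ((filt N ((1 + (t - r)) / 2) ((n + 1 - r) / 2)).subgroupOf Gam)
    (u := ⟨u, filt_le_Gam _ _ _ hu⟩) (b := ⟨b, filt_le_Gam _ _ _ hb⟩) (X := ⟨_, hX⟩) (p := ⟨p, hp⟩)
    hu9 (fun y => hle (hb8 y y.2)) (fun y => hle (hX8 y y.2))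
  have hA := bracket_first_part_mem ((filt N ((t - r) / 2) ((n + 1 - r) / 2)).subgroupOf Gam)
    (u := ⟨u, filt_le_Gam _ _ _ hu⟩) (b := ⟨b, filt_le_Gam _ _ _ hb⟩) (X := ⟨_, hX⟩) (p := ⟨p, hp⟩)
    (q := ⟨q, hq⟩) (fun y => hu8 y y.2) (fun y => hb8 y y.2) (fun y => hX8 y y.2) hu2
  have hres := mem_filt_of_blockSet hA hB (k := -(k + k)) (j := j + 1)
    ((dvd_neg).2 (by rw [← two_mul, pow_succ, mul_comm]; exact mul_dvd_mul_left 2 hj))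
    (by rw [pow_succ]; nlinarith)
  convert hres using 1
  refine Eq.trans ?_ (congrArg (fun a => cPerm ^ (-(k + k)) * pair (a, _))
    (inv_mul_cancel_right _ _).symm)
  rw [cPerm_zpow, cPerm_zpow, pair_mul, cm_pair_odd]
  rw [pair_mul, zpow_neg, zpow_add]
  refine congrArg pair (Prod.ext ?_ ?_)
  · change _ = _ * ((xPerm ^ k)⁻¹ * (xPerm ^ k)⁻¹ * (u * b)⁻¹ * xPerm ^ k * q⁻¹ * xPerm ^ k * b * q)
    generalize xPerm ^ k = X
    group
  · change _ = _ * (xPerm ^ k * xPerm ^ k * b⁻¹ * (xPerm ^ k)⁻¹ * p⁻¹ * (xPerm ^ k)⁻¹ * (u * b) * p)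
    generalize xPerm ^ k = X
    group

theorem cm_Gam_succ {t r n : ℚ} (hr : 0 ≤ r) (hrt : r ≤ t) (ht : t ≤ 1) (hn : 0 ≤ n)
    {g : WordPerm} (hg : g ∈ filt (N + 1) t n) {y : WordPerm} (hy : y ∈ Gam) :
    cm g y ∈ filt (N + 1) (t - r) (n + 1 - r) := by
  -- Loss 0 gives invariance under conjugation by odd elements, hence by Γ. The formula [g, yz] =
  -- [g, z] · z⁻¹[g, y]z then extends the estimate from odd elements to products.
  have hconj : ∀ {s m : ℚ}, 0 ≤ s → s ≤ 1 → 0 ≤ m → ∀ z ∈ Gam, ∀ g ∈ filt (N + 1) s m,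
      z⁻¹ * g * z ∈ filt (N + 1) s m := by
    intro s m hs hs' hm z hz
    refine odd_induction (P := fun z => ∀ g ∈ filt (N + 1) s m, z⁻¹ * g * z ∈ filt (N + 1) s m)
      ?_ ?_ hz
    · intro z _ hz g hg
      rw [conj_eq_mul_cm]
      have := E.cm_odd_succ le_rfl hs hs' hm hg hz
      rw [sub_zero] at this
      exact mul_mem hg (filt_anti _ (by linarith) this)
    · intro y _ z _ h1 h2 h hh
      have := h2 _ (h1 h hh)
      rwa [show (y * z)⁻¹ * h * (y * z) = z⁻¹ * (y⁻¹ * h * y) * z by group]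
  refine odd_induction (P := fun y => cm g y ∈ filt (N + 1) (t - r) (n + 1 - r)) ?_ ?_ hy
  · exact fun y _ h => E.cm_odd_succ hr hrt ht hn hg h
  · intro y _ z hz h1 h2
    rw [cm_mul_right]
    exact mul_mem h2 (hconj (by linarith) (by linarith) (by linarith) z hz _ h1)

theorem sq_succ {t n : ℚ} (ht : 0 ≤ t) (ht' : t ≤ 1) (hn : 0 ≤ n) {g : WordPerm}
    (hg : g ∈ filt (N + 1) t n) : g ^ 2 ∈ filt (N + 1) t (2 * n) := by
  obtain ⟨k, u, hu, b, hb, j, hj, hjn, rfl⟩ := E.exists_of_mem_succ ht ht' hn hg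
  have hJ : (1 : ℚ) ≤ 2 ^ j := one_le_pow₀ one_le_two
  -- From n ≤ 2^j(1 + t) and t ≤ 1. Commuting u or b with X, a 2^j-th power, at loss 0 therefore
  -- gains at least n/2, which doubles the weight.
  have hJn : n / 2 ≤ 2 ^ j := by nlinarith
  have hX := zpow_mem xPerm_mem k
  obtain ⟨y, hy, hXy⟩ := exists_zpow_eq_pow xPerm_mem hj
  have hT8 := E.normal (s := t / 2) (n := 2 * n / 2) (by linarith) (by linarith)
    (by linarith)
  have hu2 : u ^ 2 ∈ filt N (t / 2) (2 * n / 2) :=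
    filt_anti N (by linarith) (E.sq (by linarith) (by linarith) (by linarith) hu)
  have huX : cm u (xPerm ^ k) ∈ filt N (t / 2) (2 * n / 2) := by
    rw [hXy]
    have := E.cm_pow j hy le_rfl (by linarith) (by linarith) (by linarith) hu
    rw [sub_zero] at this
    exact filt_anti N (by linarith) this
  have hbX := E.conj_mem' (by linarith) (by linarith) (by linarith) hX hb
  have hub : cm u (xPerm ^ k * b * (xPerm ^ k)⁻¹) ∈ filt N (t / 2) (2 * n / 2) := by
    -- The parameter of the conjugate of b is raised to 1, so that the commutator with u keeps the
    -- parameter t/2 + 1 - 1 = t/2. This is why squares and commutators have to be treated in the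
    -- same induction.
    have := E.cm_filt (by linarith) le_rfl (by linarith) (by linarith) (by linarith) hu
      (filt_mono N (s' := 1) (n' := n / 2) (fun P e hP he h => by nlinarith) hbX)
    rw [add_sub_cancel_right] at this
    exact filt_anti N (by linarith) this
  have hb8 : cm b (xPerm ^ k * xPerm ^ k) ∈ filt N (t / 2) (2 * n / 2) := by
    rw [hXy]
    have := E.cm_pow_succ j hy (r := 0) le_rfl (by linarith) (by linarith) (by linarith) hb
    rw [show (1 + t) / 2 - 0 - 1 / 2 = t / 2 by ring] at this
    exact filt_anti N (by linarith) this
  have hA := square_first_part_mem ((filt N (t / 2) (2 * n / 2)).subgroupOf Gam)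
    (u := ⟨u, filt_le_Gam _ _ _ hu⟩) (b := ⟨b, filt_le_Gam _ _ _ hb⟩) (X := ⟨_, hX⟩)
    hu2 huX hub hb8
  have hB : (xPerm ^ k)⁻¹ * b * xPerm ^ k * b ∈ filt N ((1 + t) / 2) (2 * n / 2) := by
    have h1 := filt_anti N (n' := 2 * n / 2) (by linarith)
      (E.sq (by linarith) (by linarith) (by linarith) hb)
    have h2 : cm b (xPerm ^ k) ∈ filt N ((1 + t) / 2) (2 * n / 2) := by
      rw [hXy]
      have := E.cm_pow j hy le_rfl (by linarith) (by linarith) (by linarith) hb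
      rw [sub_zero] at this
      exact filt_anti N (by linarith) this
    have := mul_mem h1 (E.conj_mem (by linarith) (by linarith) (by linarith)
      (filt_le_Gam _ _ _ hb) h2)
    rwa [show b ^ 2 * (b⁻¹ * cm b (xPerm ^ k) * b) = (xPerm ^ k)⁻¹ * b * xPerm ^ k * b by
      simp only [cm, pow_two]; group] at this
  have hres := mem_filt_of_blockSet hA hB (k := k + k) (j := j + 1)
    (by rw [← two_mul, pow_succ, mul_comm]; exact mul_dvd_mul_left 2 hj)
    (by rw [pow_succ]; linarith)
  convert hres using 1
  refine Eq.trans ?_ (congrArg (fun a => cPerm ^ (k + k) * pair (a, _))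
    (inv_mul_cancel_right _ _).symm)
  rw [cPerm_zpow, cPerm_zpow, pair_mul, pow_two, pair_mul]
  rw [pair_mul, zpow_add]
  refine congrArg pair (Prod.ext ?_ ?_)
  · change _ = _ * (xPerm ^ k * (u * b) * (xPerm ^ k)⁻¹ * (u * b))
    generalize xPerm ^ k = X
    group
  · change _ = _ * ((xPerm ^ k)⁻¹ * b * xPerm ^ k * b)
    generalize xPerm ^ k = X
    group

/-- The powers of c commute, so the commutator has c-exponent 0. Commuting u or b with L = x^l at
loss (1 - t')/2 gains 2^i(1 + t')/2 ≥ m/2 and lands on the required parameter; X is treated in the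
same way with t. For b against L², landing at (t + t' - 1)/2 with the same gain needs the sharp form
`cm_pow_succ`. -/
theorem cm_filt_succ {t t' n m : ℚ} (ht : t ≤ 1) (ht' : t' ≤ 1) (htt : 1 ≤ t + t') (hn : 0 ≤ n)
    (hm : 0 ≤ m) {g : WordPerm} (hg : g ∈ filt (N + 1) t n) {h : WordPerm}
    (hh : h ∈ filt (N + 1) t' m) : cm g h ∈ filt (N + 1) (t + t' - 1) (n + m) := by
  obtain ⟨k, u, hu, b, hb, j, hj, hjn, rfl⟩ := E.exists_of_mem_succ (by linarith) ht hn hg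
  obtain ⟨l, u', hu', b', hb', i, hi, hin, rfl⟩ :=
    E.exists_of_mem_succ (by linarith) ht' hm hh
  have hJ : (1 : ℚ) ≤ 2 ^ j := one_le_pow₀ one_le_two
  have hI : (1 : ℚ) ≤ 2 ^ i := one_le_pow₀ one_le_two
  have hX := zpow_mem xPerm_mem k
  have hL := zpow_mem xPerm_mem l
  obtain ⟨y, hy, hXy⟩ := exists_zpow_eq_pow xPerm_mem hj
  obtain ⟨z, hz, hLz⟩ := exists_zpow_eq_pow xPerm_mem hi
  have hT8 := E.normal (s := (t + t' - 1) / 2) (n := (n + m) / 2) (by linarith) (by linarith)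
    (by linarith)
  have hT9 := E.normal (s := (1 + (t + t' - 1)) / 2) (n := (n + m) / 2) (by linarith)
    (by linarith) (by linarith)
  have cast : ∀ {s₁ n₁ s₂ n₂ : ℚ} {g : WordPerm}, g ∈ filt N s₁ n₁ → s₁ = s₂ → n₂ ≤ n₁ →
      g ∈ filt N s₂ n₂ := by
    rintro s₁ n₁ _ n₂ g hg rfl h
    exact filt_anti N h hg
  have hu'' := filt_mono N (s' := (1 + t') / 2) (n' := m / 2)
    (fun P e hP he h => by nlinarith) hu'
  have hA := commutator_first_part_mem ((filt N ((t + t' - 1) / 2) ((n + m) / 2)).subgroupOf Gam)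
    (u := ⟨u, filt_le_Gam _ _ _ hu⟩) (b := ⟨b, filt_le_Gam _ _ _ hb⟩) (X := ⟨_, hX⟩)
    (u' := ⟨u', filt_le_Gam _ _ _ hu'⟩) (b' := ⟨b', filt_le_Gam _ _ _ hb'⟩) (L := ⟨_, hL⟩)
    (Subtype.ext ((Commute.refl xPerm).zpow_zpow k l))
    (cast (E.cm_filt (by linarith) (by linarith) (by linarith) (by linarith) (by linarith) hu hu'')
      (by ring) (by linarith))
    (by
      change cm u (xPerm ^ l) ∈ filt N ((t + t' - 1) / 2) ((n + m) / 2)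
      rw [hLz]
      exact cast (E.cm_pow i hz (r := (1 - t') / 2) (by linarith) (by linarith) (by linarith)
        (by linarith) hu) (by ring) (by linarith))
    (by
      change cm u' (xPerm ^ k) ∈ filt N ((t + t' - 1) / 2) ((n + m) / 2)
      rw [hXy]
      exact cast (E.cm_pow j hy (r := (1 - t) / 2) (by linarith) (by linarith) (by linarith)
        (by linarith) hu') (by ring) (by linarith))
    (cast (E.cm_filt (by linarith) (by linarith) (by linarith) (by linarith) (by linarith) hu
      (E.conj_mem' (by linarith) (by linarith) (by linarith) hX hb')) (by ring) (by linarith))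
    (cast (E.cm_filt (by linarith) (by linarith) (by linarith) (by linarith) (by linarith) hu'
      (E.conj_mem' (by linarith) (by linarith) (by linarith) hL hb)) (by ring) (by linarith))
    (by
      change cm b (xPerm ^ l * xPerm ^ l) ∈ filt N ((t + t' - 1) / 2) ((n + m) / 2)
      rw [hLz]
      exact cast (E.cm_pow_succ i hz (r := (1 - t') / 2) (by linarith) (by linarith) (by linarith)
        (by linarith) hb) (by ring) (by linarith))
    (by
      change cm b' (xPerm ^ k * xPerm ^ k) ∈ filt N ((t + t' - 1) / 2) ((n + m) / 2)
      rw [hXy]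
      exact cast (E.cm_pow_succ j hy (r := (1 - t) / 2) (by linarith) (by linarith) (by linarith)
        (by linarith) hb') (by ring) (by linarith))
  have hB := commutator_second_part_mem
    ((filt N ((1 + (t + t' - 1)) / 2) ((n + m) / 2)).subgroupOf Gam)
    (b := ⟨b, filt_le_Gam _ _ _ hb⟩) (X := ⟨_, hX⟩) (b' := ⟨b', filt_le_Gam _ _ _ hb'⟩)
    (L := ⟨_, hL⟩) (Subtype.ext ((Commute.refl xPerm).zpow_zpow k l))
    (cast (E.cm_filt (by linarith) (by linarith) (by linarith) (by linarith) (by linarith) hb hb')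
      (by ring) (by linarith))
    (by
      change cm b (xPerm ^ l) ∈ filt N ((1 + (t + t' - 1)) / 2) ((n + m) / 2)
      rw [hLz]
      exact cast (E.cm_pow i hz (r := (1 - t') / 2) (by linarith) (by linarith) (by linarith)
        (by linarith) hb) (by ring) (by linarith))
    (by
      change cm b' (xPerm ^ k) ∈ filt N ((1 + (t + t' - 1)) / 2) ((n + m) / 2)
      rw [hXy]
      exact cast (E.cm_pow j hy (r := (1 - t) / 2) (by linarith) (by linarith) (by linarith)
        (by linarith) hb') (by ring) (by linarith))
  obtain ⟨i, hi⟩ := exists_le_two_pow_mul (n := n + m) (w := 1 + (t + t' - 1)) (by linarith)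
  have hres := mem_filt_of_blockSet hA hB (dvd_zero _) hi
  convert hres using 1
  refine Eq.trans ?_ (congrArg (fun a => cPerm ^ (0 : ℤ) * pair (a, _))
    (inv_mul_cancel_right _ _).symm)
  rw [cPerm_zpow, cPerm_zpow, pair_mul, pair_mul, cm_pair_pair, zpow_zero, one_mul]
  rfl

theorem succ : FiltEstimates (N + 1) where
  cm_Gam := E.cm_Gam_succ
  sq := E.sq_succ
  cm_filt := E.cm_filt_succ

end FiltEstimates

theorem filtEstimates (N : ℕ) : FiltEstimates N := by
  induction N with
  | zero => exact filtEstimates_zero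
  | succ N ih => exact ih.succ

end BSV

-- Exponent sums, uniqueness of components, and coordinates on Γ'

namespace BSV

/-- `g` is the value of a word in `τ` and `μ` with exponent sums `i` and `j`. -/
inductive HasExp : WordPerm → ℤ → ℤ → Prop
  | one : HasExp 1 0 0
  | mul_tau {g i j} : HasExp g i j → HasExp (g * tauPerm) (i + 1) j
  | mul_tau_inv {g i j} : HasExp g i j → HasExp (g * tauPerm⁻¹) (i - 1) j
  | mul_mu {g i j} : HasExp g i j → HasExp (g * muPerm) i (j + 1)
  | mul_mu_inv {g i j} : HasExp g i j → HasExp (g * muPerm⁻¹) i (j - 1)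

theorem HasExp.tau : HasExp tauPerm 1 0 := by simpa using HasExp.one.mul_tau

theorem HasExp.mu : HasExp muPerm 0 1 := by simpa using HasExp.one.mul_mu

theorem HasExp.mul {g h : WordPerm} {i j i' j' : ℤ} (hg : HasExp g i j) (hh : HasExp h i' j') :
    HasExp (g * h) (i + i') (j + j') := by
  induction hh with
  | one => simpa using hg
  | mul_tau _ ih => rw [← mul_assoc, ← add_assoc]; exact ih.mul_tau
  | mul_tau_inv _ ih => rw [← mul_assoc, ← add_sub_assoc]; exact ih.mul_tau_inv
  | mul_mu _ ih => rw [← mul_assoc, ← add_assoc]; exact ih.mul_mu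
  | mul_mu_inv _ ih => rw [← mul_assoc, ← add_sub_assoc]; exact ih.mul_mu_inv

theorem HasExp.inv {g : WordPerm} {i j : ℤ} (hg : HasExp g i j) : HasExp g⁻¹ (-i) (-j) := by
  induction hg with
  | one => simpa using HasExp.one
  | mul_tau _ ih =>
    rw [mul_inv_rev]; simpa [neg_add] using HasExp.one.mul_tau_inv.mul ih
  | mul_tau_inv _ ih =>
    rw [mul_inv_rev, inv_inv]; simpa [sub_eq_add_neg] using HasExp.tau.mul ih
  | mul_mu _ ih =>
    rw [mul_inv_rev]; simpa [neg_add] using HasExp.one.mul_mu_inv.mul ih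
  | mul_mu_inv _ ih =>
    rw [mul_inv_rev, inv_inv]; simpa [sub_eq_add_neg] using HasExp.mu.mul ih

theorem HasExp.pow {g : WordPerm} {i j : ℤ} (hg : HasExp g i j) (n : ℕ) :
    HasExp (g ^ n) (n * i) (n * j) := by
  induction n with
  | zero => simpa using HasExp.one
  | succ n ih =>
    rw [pow_succ]
    convert ih.mul hg using 1 <;> push_cast <;> ring

theorem HasExp.zpow {g : WordPerm} {i j : ℤ} (hg : HasExp g i j) (n : ℤ) :
    HasExp (g ^ n) (n * i) (n * j) := by
  obtain ⟨n, rfl | rfl⟩ := n.eq_nat_or_neg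
  · simpa using hg.pow n
  · simpa using (hg.pow n).inv

theorem tauPerm_inv_eq : tauPerm⁻¹ = pair (tauPerm⁻¹, 1) * eps := by
  conv_lhs => rw [tauPerm_eq, odd_inv, inv_one]

theorem muPerm_inv_eq : muPerm⁻¹ = pair (muPerm, 1) * eps := by
  conv_lhs => rw [muPerm_eq, odd_inv, inv_one, inv_inv]

theorem even_mul_odd (p q p' q' : WordPerm) :
    pair (p, q) * (pair (p', q') * eps) = pair (p * p', q * q') * eps := by
  rw [← mul_assoc, pair_mul]

/-- The exponent sums of the two sections of a word. -/
theorem HasExp.sections {g : WordPerm} {i j : ℤ} (hg : HasExp g i j) :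
    ∃ g₀ g₁ : WordPerm, ∃ i₀ j₀ i₁ j₁ : ℤ, HasExp g₀ i₀ j₀ ∧ HasExp g₁ i₁ j₁ ∧ i₀ + i₁ = i ∧
      j₀ + j₁ = -j ∧
      ((g = pair (g₀, g₁) ∧ 2 * (i₀ - j₀) = i + j) ∨
        (g = pair (g₀, g₁) * eps ∧ 2 * (i₀ - j₀) = i + j - 1)) := by
  induction hg with
  | one => exact ⟨1, 1, 0, 0, 0, 0, .one, .one, rfl, rfl, Or.inl ⟨(map_one pair).symm, rfl⟩⟩
  | mul_tau _ ih =>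
    obtain ⟨g₀, g₁, i₀, j₀, i₁, j₁, h₀, h₁, hi, hj, ⟨rfl, h⟩ | ⟨rfl, h⟩⟩ := ih
    · refine ⟨_, _, _, _, _, _, h₀, h₁.mul_tau, by omega, hj, Or.inr ⟨?_, by omega⟩⟩
      conv_lhs => rw [tauPerm_eq, even_mul_odd, mul_one]
    · refine ⟨_, _, _, _, _, _, h₀.mul_tau, h₁, by omega, hj, Or.inl ⟨?_, by omega⟩⟩
      conv_lhs => rw [tauPerm_eq, odd_mul_odd, mul_one]
  | mul_tau_inv _ ih =>
    obtain ⟨g₀, g₁, i₀, j₀, i₁, j₁, h₀, h₁, hi, hj, ⟨rfl, h⟩ | ⟨rfl, h⟩⟩ := ih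
    · refine ⟨_, _, _, _, _, _, h₀.mul_tau_inv, h₁, by omega, hj, Or.inr ⟨?_, by omega⟩⟩
      conv_lhs => rw [tauPerm_inv_eq, even_mul_odd, mul_one]
    · refine ⟨_, _, _, _, _, _, h₀, h₁.mul_tau_inv, by omega, hj, Or.inl ⟨?_, by omega⟩⟩
      conv_lhs => rw [tauPerm_inv_eq, odd_mul_odd, mul_one]
  | mul_mu _ ih =>
    obtain ⟨g₀, g₁, i₀, j₀, i₁, j₁, h₀, h₁, hi, hj, ⟨rfl, h⟩ | ⟨rfl, h⟩⟩ := ih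
    · refine ⟨_, _, _, _, _, _, h₀, h₁.mul_mu_inv, hi, by omega, Or.inr ⟨?_, by omega⟩⟩
      conv_lhs => rw [muPerm_eq, even_mul_odd, mul_one]
    · refine ⟨_, _, _, _, _, _, h₀.mul_mu_inv, h₁, hi, by omega, Or.inl ⟨?_, by omega⟩⟩
      conv_lhs => rw [muPerm_eq, odd_mul_odd, mul_one]
  | mul_mu_inv _ ih =>
    obtain ⟨g₀, g₁, i₀, j₀, i₁, j₁, h₀, h₁, hi, hj, ⟨rfl, h⟩ | ⟨rfl, h⟩⟩ := ih
    · refine ⟨_, _, _, _, _, _, h₀.mul_mu, h₁, hi, by omega, Or.inr ⟨?_, by omega⟩⟩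
      conv_lhs => rw [muPerm_inv_eq, even_mul_odd, mul_one]
    · refine ⟨_, _, _, _, _, _, h₀, h₁.mul_mu, hi, by omega, Or.inl ⟨?_, by omega⟩⟩
      conv_lhs => rw [muPerm_inv_eq, odd_mul_odd, mul_one]

theorem pair_mul_eps_ne_one (p : WordPerm × WordPerm) : pair p * eps ≠ 1 := by
  intro h
  have := congrArg (fun g => WordPerm.act g [false]) h
  simp [WordPerm.act, pair, pairFun, eps, epsFun] at this

/-- A 2-adic descent. Both sections of a word representing 1 represent 1, with i + j = 2(i₀ - j₀)
and i - j = (i₀ + j₀) + (i₁ + j₁). Divisibility of differences by 2^k gives divisibility of sums by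
2^(k+1), and then of differences by 2^(k+1). -/
theorem HasExp.two_pow_dvd (k : ℕ) : ∀ {i j : ℤ}, HasExp 1 i j →
    (2 ^ k : ℤ) ∣ i + j ∧ (2 ^ k : ℤ) ∣ i - j := by
  have hsec : ∀ {i j : ℤ}, HasExp 1 i j → ∃ i₀ j₀ i₁ j₁ : ℤ, HasExp 1 i₀ j₀ ∧ HasExp 1 i₁ j₁ ∧
      i₀ + i₁ = i ∧ j₀ + j₁ = -j ∧ 2 * (i₀ - j₀) = i + j := by
    intro i j h
    obtain ⟨g₀, g₁, i₀, j₀, i₁, j₁, h₀, h₁, hi, hj, ⟨hg, h⟩ | ⟨hg, h⟩⟩ := h.sections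
    · rw [← map_one pair] at hg
      obtain ⟨rfl, rfl⟩ := Prod.ext_iff.1 (pair_injective hg)
      exact ⟨_, _, _, _, h₀, h₁, hi, hj, h⟩
    · exact absurd hg.symm (pair_mul_eps_ne_one _)
  induction k with
  | zero => intro i j _; simp
  | succ k ih =>
    have hadd : ∀ {i j : ℤ}, HasExp 1 i j → (2 ^ (k + 1) : ℤ) ∣ i + j := by
      intro i j h
      obtain ⟨i₀, j₀, i₁, j₁, h₀, h₁, hi, hj, h⟩ := hsec h
      rw [← h, pow_succ, mul_comm]
      exact mul_dvd_mul_left 2 (ih h₀).2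
    intro i j h
    refine ⟨hadd h, ?_⟩
    obtain ⟨i₀, j₀, i₁, j₁, h₀, h₁, hi, hj, h⟩ := hsec h
    rw [show i - j = (i₀ + j₀) + (i₁ + j₁) by omega]
    exact dvd_add (hadd h₀) (hadd h₁)

/-- An integer divisible by every power of 2 is 0. Thus Γ/Γ' is free abelian on τ and μ. -/
theorem HasExp.unique {g : WordPerm} {i j i' j' : ℤ} (h : HasExp g i j) (h' : HasExp g i' j') :
    i = i' ∧ j = j' := by
  have h1 := h.mul h'.inv
  rw [mul_inv_cancel] at h1
  have key : ∀ z : ℤ, (∀ k : ℕ, (2 ^ k : ℤ) ∣ z) → z = 0 := by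
    intro z hz
    by_contra hne
    refine absurd (Int.le_of_dvd (abs_pos.2 hne) ((dvd_abs _ _).2 (hz z.natAbs))) (not_le.2 ?_)
    rw [Int.abs_eq_natAbs]
    exact_mod_cast Nat.lt_two_pow_self
  have h2 := key _ fun k => (HasExp.two_pow_dvd k h1).1
  have h3 := key _ fun k => (HasExp.two_pow_dvd k h1).2
  omega

theorem exists_hasExp {g : WordPerm} (hg : g ∈ Gam) : ∃ i j, HasExp g i j := by
  induction hg using Subgroup.closure_induction with
  | mem x hx =>
    rcases hx with rfl | rfl
    exacts [⟨1, 0, .tau⟩, ⟨0, 1, .mu⟩]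
  | one => exact ⟨0, 0, .one⟩
  | mul x y _ _ hx hy =>
    obtain ⟨i, j, h⟩ := hx
    obtain ⟨i', j', h'⟩ := hy
    exact ⟨_, _, h.mul h'⟩
  | inv x _ hx =>
    obtain ⟨i, j, h⟩ := hx
    exact ⟨_, _, h.inv⟩

theorem hasExp_of_mem_Gam' {g : WordPerm} (hg : g ∈ Gam') : HasExp g 0 0 := by
  let H : Subgroup WordPerm :=
    { carrier := {g | HasExp g 0 0}
      one_mem' := .one
      mul_mem' := fun h h' => by simpa using HasExp.mul h h'
      inv_mem' := fun h => by simpa using HasExp.inv h }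
  have : Gam' ≤ H := by
    refine Subgroup.commutator_le.2 fun x hx y hy => ?_
    obtain ⟨i, j, h⟩ := exists_hasExp hx
    obtain ⟨i', j', h'⟩ := exists_hasExp hy
    have := ((h.mul h').mul h.inv).mul h'.inv
    change HasExp (x * y * x⁻¹ * y⁻¹) 0 0
    simpa [add_assoc, add_comm, add_left_comm] using this
  exact this hg

theorem HasExp.exists_eq {g : WordPerm} {i j : ℤ} (h : HasExp g i j) :
    ∃ d ∈ Gam', g = tauPerm ^ i * muPerm ^ j * d := by
  have hτ : ∀ (j : ℤ) {d y : WordPerm}, y ∈ Gam → d ∈ Gam' →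
      cm (muPerm ^ j) y * (y⁻¹ * d * y) ∈ Gam' := fun _ _ _ hy hd =>
    mul_mem (cm_mem_Gam' (zpow_mem muPerm_mem _) hy) (conj_mem_Gam'' hy hd)
  induction h with
  | one => exact ⟨1, one_mem _, by simp⟩
  | @mul_tau _ _ j _ ih =>
    obtain ⟨d, hd, rfl⟩ := ih
    refine ⟨_, hτ j tauPerm_mem hd, ?_⟩
    rw [cm, zpow_add, zpow_one]; group
  | @mul_tau_inv _ _ j _ ih =>
    obtain ⟨d, hd, rfl⟩ := ih
    refine ⟨_, hτ j (inv_mem tauPerm_mem) hd, ?_⟩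
    rw [cm, zpow_sub, zpow_one]; group
  | mul_mu _ ih =>
    obtain ⟨d, hd, rfl⟩ := ih
    refine ⟨_, conj_mem_Gam'' muPerm_mem hd, ?_⟩
    rw [zpow_add, zpow_one]; group
  | mul_mu_inv _ ih =>
    obtain ⟨d, hd, rfl⟩ := ih
    refine ⟨_, conj_mem_Gam'' (inv_mem muPerm_mem) hd, ?_⟩
    rw [zpow_sub, zpow_one]; group

theorem hasExp_zpow_mul_zpow_mul (i j : ℤ) {d : WordPerm} (hd : d ∈ Gam') :
    HasExp (tauPerm ^ i * muPerm ^ j * d) i j := by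
  simpa using ((HasExp.tau.zpow i).mul (HasExp.mu.zpow j)).mul (hasExp_of_mem_Gam' hd)

/-- The second section is x^k b, whose exponent sums are (k, k) because b lies in Γ' and x = μτ;
this determines k. -/
theorem zpow_mul_pair_injective {k k' : ℤ} {a b a' b' : WordPerm} (hb : b ∈ Gam') (hb' : b' ∈ Gam')
    (h : cPerm ^ k * pair (a, b) = cPerm ^ k' * pair (a', b')) : k = k' ∧ a = a' ∧ b = b' := by
  have hk : k = k' := by
    rw [cPerm_zpow, cPerm_zpow, pair_mul, pair_mul] at h
    have h2 := (Prod.ext_iff.1 (pair_injective h)).2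
    have hx : ∀ {k : ℤ} {b}, b ∈ Gam' → HasExp (xPerm ^ k * b) (k * (0 + 1)) (k * (1 + 0)) := by
      intro k b hb
      have := ((HasExp.mu.mul HasExp.tau).zpow k).mul (hasExp_of_mem_Gam' hb)
      rwa [add_zero, add_zero] at this
    have h3 := hx (k := k) hb
    have h4 := hx (k := k') hb'
    dsimp only at h2
    rw [h2] at h3
    simpa using (h3.unique h4).1
  subst hk
  have := Prod.ext_iff.1 (pair_injective (mul_left_cancel h))
  exact ⟨rfl, this.1, this.2⟩

/-- The endomorphism `g ↦ (g, 1)` for `𝟖` and `g ↦ (g, g)` for `𝟗`. -/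
def Letter.hom : Letter → (WordPerm →* WordPerm)
  | .eight => pair.comp (MonoidHom.inl WordPerm WordPerm)
  | .nine => pair.comp ((MonoidHom.id WordPerm).prod (MonoidHom.id WordPerm))

theorem Letter.eight_hom (g : WordPerm) : Letter.eight.hom g = pair (g, 1) := rfl

theorem Letter.nine_hom (g : WordPerm) : Letter.nine.hom g = pair (g, g) := rfl

/-- The endomorphism `g ↦ W(g)`. -/
def wordHom : List Letter → (WordPerm →* WordPerm)
  | [] => MonoidHom.id WordPerm
  | l :: W => l.hom.comp (wordHom W)

theorem wordHom_cons (l : Letter) (W : List Letter) (g : WordPerm) :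
    wordHom (l :: W) g = l.hom (wordHom W g) := rfl

theorem wordHom_nil (g : WordPerm) : wordHom [] g = g := rfl

theorem coe_applyWord (W : List Letter) (g : Gam') :
    (applyWord W g : WordPerm) = wordHom W g := by
  induction W with
  | nil => rfl
  | cons l W ih =>
    rw [wordHom_cons, ← ih]
    cases l <;> rfl

theorem coe_wordC (W : List Letter) : (wordC W : WordPerm) = wordHom W cPerm :=
  coe_applyWord W c

theorem wordHom_mem (W : List Letter) {g : WordPerm} (hg : g ∈ Gam') : wordHom W g ∈ Gam' := by
  rw [← coe_applyWord W ⟨g, hg⟩]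
  exact Subtype.property _

/-- The binary number `1Wₘ⋯W₁`: the degree of `W(c)` is `wordIndex W + 1`. -/
def wordIndex : List Letter → ℕ
  | [] => 1
  | .eight :: W => 2 * wordIndex W
  | .nine :: W => 2 * wordIndex W + 1

theorem sum_digit_add (W : List Letter) :
    ∑ i : Fin W.length, (W.get i).digit * 2 ^ (i : ℕ) + 2 ^ W.length = wordIndex W := by
  induction W with
  | nil => simp [wordIndex]
  | cons l W ih =>
    simp only [List.length_cons, Fin.sum_univ_succ, Fin.val_succ]
    have : ∑ i : Fin W.length, (W.get i).digit * 2 ^ ((i : ℕ) + 1) =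
        2 * ∑ i : Fin W.length, (W.get i).digit * 2 ^ (i : ℕ) := by
      rw [Finset.mul_sum]
      exact Finset.sum_congr rfl fun i _ => by ring
    change l.digit * 2 ^ 0 + ∑ i : Fin W.length, (W.get i).digit * 2 ^ ((i : ℕ) + 1) + _ = _
    rw [this, pow_succ]
    cases l <;> simp only [wordIndex, Letter.digit, ← ih] <;> ring

theorem BasisLabel.deg_word (W : List Letter) (n : ℕ) :
    (BasisLabel.word W n).deg = 2 ^ n * (wordIndex W + 1) := by
  rw [BasisLabel.deg, sum_digit_add]

theorem one_le_wordIndex (W : List Letter) : 1 ≤ wordIndex W := by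
  induction W with
  | nil => exact le_rfl
  | cons l W ih => cases l <;> simp only [wordIndex] <;> omega

/-- The element `cᵏ(ub, b)` of `Γ'` has the components `(k, u, b)`. -/
noncomputable def components (g : WordPerm) : ℤ × WordPerm × WordPerm :=
  Classical.epsilon fun p => p.2.2 ∈ Gam' ∧ g = cPerm ^ p.1 * pair (p.2.1 * p.2.2, p.2.2)

theorem components_eq (k : ℤ) (u : WordPerm) {b : WordPerm} (hb : b ∈ Gam') :
    components (cPerm ^ k * pair (u * b, b)) = (k, u, b) := by
  have hex : ∃ p : ℤ × WordPerm × WordPerm, p.2.2 ∈ Gam' ∧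
      cPerm ^ k * pair (u * b, b) = cPerm ^ p.1 * pair (p.2.1 * p.2.2, p.2.2) :=
    ⟨(k, u, b), hb, rfl⟩
  obtain ⟨h1, h2⟩ := Classical.epsilon_spec hex
  obtain ⟨e1, e2, e3⟩ := zpow_mul_pair_injective hb h1 h2
  rw [← e3] at e2
  exact (Prod.ext e1 (Prod.ext (mul_right_cancel e2) e3)).symm

/-- The coordinate of an element of `Γ'` at the element `W(c)`. -/
noncomputable def coord : List Letter → WordPerm → ℤ
  | [], g => (components g).1
  | .eight :: W, g => coord W (components g).2.1
  | .nine :: W, g => coord W (components g).2.2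

theorem coord_nil (k : ℤ) (u : WordPerm) {b : WordPerm} (hb : b ∈ Gam') :
    coord [] (cPerm ^ k * pair (u * b, b)) = k := by
  rw [coord, components_eq k u hb]

theorem coord_eight (W : List Letter) (k : ℤ) (u : WordPerm) {b : WordPerm} (hb : b ∈ Gam') :
    coord (.eight :: W) (cPerm ^ k * pair (u * b, b)) = coord W u := by
  rw [coord, components_eq k u hb]

theorem coord_nine (W : List Letter) (k : ℤ) (u : WordPerm) {b : WordPerm} (hb : b ∈ Gam') :
    coord (.nine :: W) (cPerm ^ k * pair (u * b, b)) = coord W b := by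
  rw [coord, components_eq k u hb]

theorem eight_hom_eq (g : WordPerm) : Letter.eight.hom g = cPerm ^ (0 : ℤ) * pair (g * 1, 1) := by
  rw [zpow_zero, one_mul, mul_one, Letter.eight_hom]

theorem nine_hom_eq (g : WordPerm) : Letter.nine.hom g = cPerm ^ (0 : ℤ) * pair (1 * g, g) := by
  rw [zpow_zero, one_mul, one_mul, Letter.nine_hom]

theorem zpow_cPerm_eq (k : ℤ) : cPerm ^ k = cPerm ^ k * pair (1 * 1, 1) := by
  rw [one_mul, show ((1 : WordPerm), (1 : WordPerm)) = 1 from rfl, map_one, mul_one]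

theorem coord_one (W : List Letter) : coord W 1 = 0 := by
  have e : (1 : WordPerm) = cPerm ^ (0 : ℤ) * pair (1 * 1, 1) := by
    rw [← zpow_cPerm_eq, zpow_zero]
  induction W with
  | nil => rw [e, coord_nil _ _ (one_mem _)]
  | cons l W ih =>
    cases l
    · rw [e, coord_eight _ _ _ (one_mem _), ih]
    · rw [e, coord_nine _ _ _ (one_mem _), ih]

theorem coord_wordHom_self (W : List Letter) (k : ℤ) : coord W (wordHom W (cPerm ^ k)) = k := by
  induction W with
  | nil => rw [wordHom_nil, zpow_cPerm_eq, coord_nil _ _ (one_mem _)]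
  | cons l W ih =>
    rw [wordHom_cons]
    cases l
    · rw [eight_hom_eq, coord_eight _ _ _ (one_mem _), ih]
    · rw [nine_hom_eq, coord_nine _ _ _ (wordHom_mem W (zpow_mem cPerm_mem k)), ih]

theorem coord_wordHom_of_ne {W V : List Letter} (h : W ≠ V) (k : ℤ) :
    coord W (wordHom V (cPerm ^ k)) = 0 := by
  induction V generalizing W with
  | nil =>
    rw [wordHom_nil, zpow_cPerm_eq]
    rcases W with _ | ⟨_ | _, W⟩
    · exact absurd rfl h
    · rw [coord_eight _ _ _ (one_mem _), coord_one]
    · rw [coord_nine _ _ _ (one_mem _), coord_one]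
  | cons l V ih =>
    have hV := wordHom_mem V (zpow_mem cPerm_mem k)
    rw [wordHom_cons]
    cases l
    · rw [eight_hom_eq]
      rcases W with _ | ⟨_ | _, W⟩
      · rw [coord_nil _ _ (one_mem _)]
      · rw [coord_eight _ _ _ (one_mem _), ih (fun e => h (by rw [e]))]
      · rw [coord_nine _ _ _ (one_mem _), coord_one]
    · rw [nine_hom_eq]
      rcases W with _ | ⟨_ | _, W⟩
      · rw [coord_nil _ _ hV]
      · rw [coord_eight _ _ _ hV, coord_one]
      · rw [coord_nine _ _ _ hV, ih (fun e => h (by rw [e]))]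

/-- Unwinding the components along W turns the bound at c into the bound at W(c), since 2(e + s/2) =
2e + s and 2(e + (1 + s)/2) = 2e + 1 + s. Depth N only sees words shorter than N. -/
theorem coord_mem {N : ℕ} {W : List Letter} (hW : W.length < N) {s n : ℚ} (hs : 0 ≤ s)
    (hs' : s ≤ 1) (hn : 0 ≤ n) {g : WordPerm} (hg : g ∈ filt N s n) :
    ∃ j : ℕ, (2 ^ j : ℤ) ∣ coord W g ∧ n ≤ 2 ^ j * (wordIndex W + s) := by
  induction W generalizing N s n g with
  | nil =>
    obtain _ | N := N
    · simp at hW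
    obtain ⟨k, u, hu, b, hb, j, hj, hjn, rfl⟩ :=
      (filtEstimates N).exists_of_mem_succ hs hs' hn hg
    rw [coord_nil _ _ (filt_le_Gam' _ _ _ hb)]
    exact ⟨j, hj, by simpa [wordIndex] using hjn⟩
  | cons l W ih =>
    obtain _ | N := N
    · simp at hW
    obtain ⟨k, u, hu, b, hb, -, -, -, rfl⟩ :=
      (filtEstimates N).exists_of_mem_succ hs hs' hn hg
    have hW' : W.length < N := by simpa using hW
    cases l
    · rw [coord_eight _ _ _ (filt_le_Gam' _ _ _ hb)]
      obtain ⟨j, hj, hjn⟩ := ih hW' (by linarith) (by linarith) (by linarith) hu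
      refine ⟨j, hj, ?_⟩
      simp only [wordIndex]
      push_cast
      linarith
    · rw [coord_nine _ _ _ (filt_le_Gam' _ _ _ hb)]
      obtain ⟨j, hj, hjn⟩ := ih hW' (by linarith) (by linarith) (by linarith) hb
      refine ⟨j, hj, ?_⟩
      simp only [wordIndex]
      push_cast
      linarith

theorem coord_dvd_of_lt {N : ℕ} {W : List Letter} (hW : W.length < N) {s n : ℚ} (hs : 0 ≤ s)
    (hs' : s ≤ 1) {j : ℕ} (hj : 2 ^ j * (wordIndex W + s) < n) {g : WordPerm}
    (hg : g ∈ filt N s n) : (2 ^ (j + 1) : ℤ) ∣ coord W g := by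
  have h0 : (0 : ℚ) < wordIndex W + s := by
    have : (1 : ℚ) ≤ wordIndex W := by exact_mod_cast one_le_wordIndex W
    linarith
  obtain ⟨i, hi, hin⟩ := coord_mem hW hs hs' (le_trans (by positivity) hj.le) hg
  have := lt_of_mul_lt_mul_right (hj.trans_le hin) h0.le
  exact (pow_dvd_pow 2 ((pow_lt_pow_iff_right₀ one_lt_two).1 this)).trans hi

section

variable {G : Type*} [Group G] (T : Subgroup G) [T.Normal]

/-- A refinement of `product_part_mem`: modulo elements of higher weight, the 𝟖-component of a
product is uu' itself. -/
theorem product_first_part_mem {u u' b L : G} (hu : ∀ y, cm u y ∈ T) (hu' : ∀ y, cm u' y ∈ T)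
    (hb : cm b (L * L) ∈ T) :
    (u * u')⁻¹ * (L * u * b * L⁻¹ * u' * L⁻¹ * b⁻¹ * L) ∈ T := by
  simp only [cm_mem_iff] at *
  rw [mem_iff_mk'_eq_one]
  simp only [map_mul, map_inv] at *
  have h1 := hu L
  have h2 := hu' L
  have h3 := hu' b
  generalize QuotientGroup.mk' T b = b at *
  generalize QuotientGroup.mk' T L = L at *
  generalize QuotientGroup.mk' T u = u at *
  generalize QuotientGroup.mk' T u' = u' at *
  calc _ = u'⁻¹ * u⁻¹ * (L * u * L⁻¹) * ((L * b * L⁻¹) * u' * (L * b * L⁻¹)⁻¹) *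
        (L * (b * (L * L)⁻¹ * b⁻¹) * L) := by group
    _ = u'⁻¹ * u⁻¹ * u * u' * (L * (L * L)⁻¹ * L) := by
        rw [h1.eq_conj, ((h2.mul_right h3).mul_right h2.inv_right).eq_conj, hb.inv_right.eq]
        group
    _ = 1 := by group

end

/-- The coordinate at `W(c)` is additive modulo `2ʲ⁺¹` on the elements of weight `2ʲ(e + s)`. -/
theorem coord_mul {N : ℕ} {W : List Letter} (hW : W.length < N) {s : ℚ} (hs : 0 ≤ s)
    (hs' : s ≤ 1) (j : ℕ) {g h : WordPerm} (hg : g ∈ filt N s (2 ^ j * (wordIndex W + s)))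
    (hh : h ∈ filt N s (2 ^ j * (wordIndex W + s))) :
    coord W (g * h) ≡ coord W g + coord W h [ZMOD 2 ^ (j + 1)] := by
  induction W generalizing N s g h with
  | nil =>
    obtain _ | N := N
    · simp at hW
    have hn : (0 : ℚ) ≤ 2 ^ j * (wordIndex [] + s) := by positivity
    obtain ⟨k, u, -, b, hb, -, -, -, rfl⟩ :=
      (filtEstimates N).exists_of_mem_succ hs hs' hn hg
    obtain ⟨l, u', -, b', hb', -, -, -, rfl⟩ :=
      (filtEstimates N).exists_of_mem_succ hs hs' hn hh
    have hb1 := filt_le_Gam' _ _ _ hb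
    have hb2 := filt_le_Gam' _ _ _ hb'
    rw [zpow_mul_pair_mul, coord_nil _ _ hb1, coord_nil _ _ hb2, coord_nil]
    exact mul_mem (conj_mem_Gam'' (zpow_mem xPerm_mem l) hb1) hb2
  | cons a W ih =>
    obtain _ | N := N
    · simp at hW
    have hW' : W.length < N := by simpa using hW
    have E := filtEstimates N
    have hn : (0 : ℚ) ≤ 2 ^ j * (wordIndex (a :: W) + s) := by positivity
    obtain ⟨k, u, hu, b, hb, -, -, -, rfl⟩ := E.exists_of_mem_succ hs hs' hn hg
    obtain ⟨l, u', hu', b', hb', -, -, -, rfl⟩ := E.exists_of_mem_succ hs hs' hn hh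
    have hL := zpow_mem xPerm_mem l
    have hb1 := filt_le_Gam' _ _ _ hb
    have hb2 := filt_le_Gam' _ _ _ hb'
    have hb3 := mul_mem (conj_mem_Gam'' hL hb1) hb2
    -- A factor t of weight strictly above 2^j(e + s') has coordinate 0 modulo 2^(j+1), so the
    -- correction terms in the product formula are invisible.
    have key : ∀ {s' m : ℚ} {v v' t : WordPerm}, 0 ≤ s' → s' ≤ 1 →
        2 ^ j * (wordIndex W + s') < m →
        v ∈ filt N s' (2 ^ j * (wordIndex W + s')) → v' ∈ filt N s' (2 ^ j * (wordIndex W + s')) →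
        t ∈ filt N s' m →
        coord W (v * v' * t) ≡ coord W v + coord W v' [ZMOD 2 ^ (j + 1)] := by
      intro s' m v v' t hs hs' hm hv hv' ht
      have h1 := ih hW' hs hs' (mul_mem hv hv') (filt_anti N hm.le ht)
      have h2 := (Int.modEq_zero_iff_dvd.2 (coord_dvd_of_lt hW' hs hs' hm ht))
      simpa using h1.trans ((ih hW' hs hs' hv hv').add h2)
    rw [zpow_mul_pair_mul]
    cases a
    · have en : (2 : ℚ) ^ j * (wordIndex (.eight :: W) + s) / 2 =
          2 ^ j * (wordIndex W + s / 2) := by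
        simp only [wordIndex]; push_cast; ring
      rw [coord_eight _ _ _ hb1, coord_eight _ _ _ hb2, coord_eight _ _ _ hb3]
      rw [en] at hu hu' hb hb'
      have h0 : (0 : ℚ) ≤ 2 ^ j * (wordIndex W + s / 2) := by positivity
      have hT := E.normal (s := s / 2) (n := 2 ^ j * (wordIndex W + s / 2) + 1 / 2) (by linarith)
        (by linarith) (by linarith)
      have hu1 : ∀ {u}, u ∈ filt N (s / 2) (2 ^ j * (wordIndex W + s / 2)) → ∀ y ∈ Gam,
          cm u y ∈ filt N (s / 2) (2 ^ j * (wordIndex W + s / 2) + 1 / 2) := by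
        intro u hu y hy
        have := E.cm_Gam le_rfl (by linarith) (by linarith) h0 hu hy
        rw [sub_zero] at this
        exact filt_anti N (by linarith) this
      have ht : (u * u')⁻¹ * (xPerm ^ l * u * b * (xPerm ^ l)⁻¹ * u' * (xPerm ^ l)⁻¹ * b⁻¹ *
          xPerm ^ l) ∈ filt N (s / 2) (2 ^ j * (wordIndex W + s / 2) + 1 / 2) :=
        product_first_part_mem ((filt N (s / 2)
        (2 ^ j * (wordIndex W + s / 2) + 1 / 2)).subgroupOf Gam)
        (u := ⟨u, filt_le_Gam _ _ _ hu⟩) (u' := ⟨u', filt_le_Gam _ _ _ hu'⟩)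
        (b := ⟨b, filt_le_Gam _ _ _ hb⟩) (L := ⟨_, hL⟩) (fun y => hu1 hu y y.2)
        (fun y => hu1 hu' y y.2) (by
          have := E.cm_Gam (r := 1 / 2) (by norm_num) (by linarith) (by linarith) h0 hb
            (mul_mem hL hL)
          rw [show (1 + s) / 2 - 1 / 2 = s / 2 by ring] at this
          exact filt_anti N (by linarith) this)
      have := key (by linarith) (by linarith) (by linarith) hu hu' ht
      rwa [mul_inv_cancel_left] at this
    · have en : (2 : ℚ) ^ j * (wordIndex (.nine :: W) + s) / 2 =
          2 ^ j * (wordIndex W + (1 + s) / 2) := by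
        simp only [wordIndex]; push_cast; ring
      rw [coord_nine _ _ _ hb1, coord_nine _ _ _ hb2, coord_nine _ _ _ hb3]
      rw [en] at hb hb'
      have h0 : (0 : ℚ) ≤ 2 ^ j * (wordIndex W + (1 + s) / 2) := by positivity
      have h1 := E.cm_Gam le_rfl (by linarith) (by linarith) h0 hb hL
      rw [sub_zero, sub_zero] at h1
      have h2 := E.conj_mem (by linarith) (by linarith) (by linarith) (Gam'_le hb2) h1
      have := key (by linarith) (by linarith) (by linarith) hb hb' h2
      rwa [show b * b' * (b'⁻¹ * cm b (xPerm ^ l) * b') = (xPerm ^ l)⁻¹ * b * xPerm ^ l * b' by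
        simp only [cm]; group] at this

end BSV

-- Weights on Γ: the dimension series is contained in the filtration, and linear independence

section

variable {G : Type*} [Group G] (T : Subgroup G) [T.Normal]

theorem normalForm_mul_mem {P Q P' Q' d d' : G} (hQP : cm Q P' ∈ T)
    (hd : ∀ y, cm d y ∈ T) :
    (d * d')⁻¹ * ((P * P' * (Q * Q'))⁻¹ * (P * Q * d * (P' * Q' * d'))) ∈ T := by
  simp only [cm_mem_iff] at *
  rw [mem_iff_mk'_eq_one]
  simp only [map_mul, map_inv] at *
  have h1 := hd P'
  have h2 := hd Q'
  generalize QuotientGroup.mk' T P = P at *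
  generalize QuotientGroup.mk' T Q = Q at *
  generalize QuotientGroup.mk' T P' = P' at *
  generalize QuotientGroup.mk' T Q' = Q' at *
  generalize QuotientGroup.mk' T d = d at *
  calc _ = (d * QuotientGroup.mk' T d')⁻¹ * ((P * P' * (Q * Q'))⁻¹ * (P * Q * (d * (P' * Q')) *
        QuotientGroup.mk' T d')) := by group
    _ = (d * QuotientGroup.mk' T d')⁻¹ * ((P * P' * (Q * Q'))⁻¹ * (P * (Q * P') * Q' * d *
        QuotientGroup.mk' T d')) := by rw [(h1.mul_right h2).eq]; group
    _ = 1 := by rw [hQP.eq]; group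

theorem normalForm_sq_mem {P Q d : G} (hQP : cm Q P ∈ T) (hdP : cm d P ∈ T) (hdQ : cm d Q ∈ T)
    (hd : d ^ 2 ∈ T) : (P * P * (Q * Q))⁻¹ * (P * Q * d * (P * Q * d)) ∈ T := by
  simp only [cm_mem_iff] at *
  rw [mem_iff_mk'_eq_one] at *
  rw [pow_two] at hd
  simp only [map_mul, map_inv] at *
  generalize QuotientGroup.mk' T P = P at *
  generalize QuotientGroup.mk' T Q = Q at *
  generalize QuotientGroup.mk' T d = d at *
  calc _ = (P * P * (Q * Q))⁻¹ * (P * Q * (d * (P * Q)) * d) := by group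
    _ = (P * P * (Q * Q))⁻¹ * (P * (Q * P) * Q) * (d * d) := by
      rw [(hdP.mul_right hdQ).eq]; group
    _ = 1 := by rw [hQP.eq, hd]; group

end

namespace BSV

/-- The elements `τⁱμʲd` of `Γ` with `2ᵛ ∣ i`, `2ᵛ ∣ j`, `n ≤ 2ᵛ` and `d` of weight `n`. -/
def InDelta (N n : ℕ) (g : WordPerm) : Prop :=
  ∃ i j : ℤ, ∃ v : ℕ, (2 ^ v : ℤ) ∣ i ∧ (2 ^ v : ℤ) ∣ j ∧ n ≤ 2 ^ v ∧
    ∃ d ∈ filt N 1 n, g = tauPerm ^ i * muPerm ^ j * d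

theorem InDelta.of_filt {N n : ℕ} {g : WordPerm} (hg : g ∈ filt N 1 n) : InDelta N n g :=
  -- The exponents are 0, so any v with n ≤ 2^v serves; v = n is one.
  ⟨0, 0, n, dvd_zero _, dvd_zero _, Nat.lt_two_pow_self.le, g, hg, by simp⟩

theorem zpow_cm_mem {N n v : ℕ} (hv : n ≤ 2 ^ v) {i : ℤ} (hi : (2 ^ v : ℤ) ∣ i) {y z : WordPerm}
    (hy : y ∈ Gam) (hz : z ∈ Gam) : cm (y ^ i) z ∈ filt N 1 (n + 1) := by
  have hv' : (n : ℚ) ≤ 2 ^ v := by exact_mod_cast hv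
  exact filt_mono N (fun P e hP he h => by linarith) ((filtEstimates N).cm_zpow_mem hy hz hi)

theorem cm_filt_one_mem {N n : ℕ} {d y : WordPerm} (hd : d ∈ filt N 1 n) (hy : y ∈ Gam) :
    cm d y ∈ filt N 1 (n + 1) := by
  simpa using (filtEstimates N).cm_Gam le_rfl zero_le_one le_rfl n.cast_nonneg hd hy

theorem normal_filt_one (N : ℕ) {n : ℚ} (hn : 0 ≤ n) : ((filt N 1 n).subgroupOf Gam).Normal :=
  (filtEstimates N).normal zero_le_one le_rfl hn

/-- The product of two normal forms. -/
theorem exists_normalForm_mul {N n : ℕ} {i j i' j' : ℤ} {v : ℕ} {d d' : WordPerm}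
    (hj : (2 ^ v : ℤ) ∣ j) (hv : n ≤ 2 ^ v) (hd : d ∈ filt N 1 n) (hd' : d' ∈ filt N 1 n) :
    ∃ t ∈ filt N 1 (n + 1), tauPerm ^ i * muPerm ^ j * d * (tauPerm ^ i' * muPerm ^ j' * d') =
      tauPerm ^ (i + i') * muPerm ^ (j + j') * (d * d' * t) := by
  have hT := normal_filt_one N (n := n + 1) (by positivity)
  have hdG := filt_le_Gam _ _ _ hd
  have hdG' := filt_le_Gam _ _ _ hd'
  refine ⟨_, normalForm_mul_mem ((filt N 1 (n + 1)).subgroupOf Gam)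
    (P := ⟨_, zpow_mem tauPerm_mem i⟩) (Q := ⟨_, zpow_mem muPerm_mem j⟩)
    (P' := ⟨_, zpow_mem tauPerm_mem i'⟩) (Q' := ⟨_, zpow_mem muPerm_mem j'⟩)
    (d := ⟨d, hdG⟩) (d' := ⟨d', hdG'⟩)
    (zpow_cm_mem hv hj muPerm_mem (zpow_mem tauPerm_mem i'))
    (fun y => cm_filt_one_mem hd y.2), ?_⟩
  change _ = _ * (d * d' * ((d * d')⁻¹ * ((tauPerm ^ i * tauPerm ^ i' *
    (muPerm ^ j * muPerm ^ j'))⁻¹ * (tauPerm ^ i * muPerm ^ j * d *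
      (tauPerm ^ i' * muPerm ^ j' * d')))))
  rw [zpow_add, zpow_add, mul_inv_cancel_left, mul_inv_cancel_left]

theorem InDelta.anti {N n n' : ℕ} (h : n' ≤ n) {g : WordPerm} (hg : InDelta N n g) :
    InDelta N n' g := by
  obtain ⟨i, j, v, hi, hj, hv, d, hd, rfl⟩ := hg
  exact ⟨i, j, v, hi, hj, h.trans hv, d, filt_anti N (by exact_mod_cast h) hd, rfl⟩

theorem InDelta.mul {N n : ℕ} {g h : WordPerm} (hg : InDelta N n g) (hh : InDelta N n h) :
    InDelta N n (g * h) := by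
  obtain ⟨i, j, v, hi, hj, hv, d, hd, rfl⟩ := hg
  obtain ⟨i', j', v', hi', hj', hv', d', hd', rfl⟩ := hh
  obtain ⟨t, ht, e⟩ := exists_normalForm_mul (i := i) (i' := i') (j' := j') hj hv hd hd'
  refine ⟨i + i', j + j', min v v', ?_, ?_, ?_, d * d' * t,
    mul_mem (mul_mem hd hd') (filt_anti N (by linarith) ht), e⟩
  · exact dvd_add ((pow_dvd_pow 2 (min_le_left _ _)).trans hi)
      ((pow_dvd_pow 2 (min_le_right _ _)).trans hi')
  · exact dvd_add ((pow_dvd_pow 2 (min_le_left _ _)).trans hj)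
      ((pow_dvd_pow 2 (min_le_right _ _)).trans hj')
  · rcases min_choice v v' with h | h <;> rw [h] <;> assumption

theorem InDelta.inv {N n : ℕ} {g : WordPerm} (hg : InDelta N n g) : InDelta N n g⁻¹ := by
  obtain ⟨i, j, v, hi, hj, hv, d, hd, rfl⟩ := hg
  have h1 := zpow_cm_mem (N := N) hv ((dvd_neg).2 hj) muPerm_mem (zpow_mem tauPerm_mem (-i))
  have h2 := (filtEstimates N).conj_mem' zero_le_one le_rfl n.cast_nonneg
    (mul_mem (zpow_mem muPerm_mem j) (zpow_mem tauPerm_mem i)) (inv_mem hd)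
  refine ⟨-i, -j, v, (dvd_neg).2 hi, (dvd_neg).2 hj, hv, _,
    mul_mem h2 (filt_anti N (by linarith) h1), ?_⟩
  simp only [cm]
  group

/-- The subgroup of the elements of weight at least `n`. -/
def deltaSubgroup (N n : ℕ) : Subgroup WordPerm where
  carrier := {g | InDelta N n g}
  one_mem' := .of_filt (one_mem _)
  mul_mem' := .mul
  inv_mem' := .inv

/-- Modulo weight n + 1 each of the three factors of the normal form is central; the powers of τ and
μ are so because their exponents are divisible by 2^v ≥ n. -/
theorem InDelta.cm_mem {N n : ℕ} {g : WordPerm} (hg : InDelta N n g) {y : WordPerm}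
    (hy : y ∈ Gam) : cm g y ∈ filt N 1 (n + 1) := by
  obtain ⟨i, j, v, hi, hj, hv, d, hd, rfl⟩ := hg
  have hT := normal_filt_one N (n := n + 1) (by positivity)
  have h1 := (cm_mem_iff ((filt N 1 (n + 1)).subgroupOf Gam)
    (a := ⟨_, zpow_mem tauPerm_mem i⟩) (b := ⟨y, hy⟩)).1 (zpow_cm_mem hv hi tauPerm_mem hy)
  have h2 := (cm_mem_iff ((filt N 1 (n + 1)).subgroupOf Gam)
    (a := ⟨_, zpow_mem muPerm_mem j⟩) (b := ⟨y, hy⟩)).1 (zpow_cm_mem hv hj muPerm_mem hy)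
  have h3 := (cm_mem_iff ((filt N 1 (n + 1)).subgroupOf Gam)
    (a := ⟨d, filt_le_Gam _ _ _ hd⟩) (b := ⟨y, hy⟩)).1 (cm_filt_one_mem hd hy)
  have h4 := (h1.mul_left h2).mul_left h3
  rw [← map_mul, ← map_mul, ← cm_mem_iff] at h4
  exact h4

theorem InDelta.sq {N n : ℕ} {g : WordPerm} (hg : InDelta N n g) : InDelta N (2 * n) (g ^ 2) := by
  obtain ⟨i, j, v, hi, hj, hv, d, hd, rfl⟩ := hg
  have E := filtEstimates N
  have hv' : (n : ℚ) ≤ 2 ^ v := by exact_mod_cast hv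
  have hT := normal_filt_one N (n := (2 * n : ℕ)) (Nat.cast_nonneg _)
  obtain ⟨y, hy, ey⟩ := exists_zpow_eq_pow tauPerm_mem hi
  obtain ⟨z, hz, ez⟩ := exists_zpow_eq_pow muPerm_mem hj
  have h1 : cm (muPerm ^ j) (tauPerm ^ i) ∈ filt N 1 (2 * n : ℕ) := by
    rw [ey, ez]
    exact filt_anti N (by push_cast; linarith) (E.pow_cm_pow v v hz hy)
  have h2 : ∀ {w : WordPerm}, w ∈ Gam → cm d (w ^ 2 ^ v) ∈ filt N 1 (2 * n : ℕ) := by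
    intro w hw
    have := E.cm_pow v hw le_rfl zero_le_one le_rfl n.cast_nonneg hd
    rw [sub_zero] at this
    exact filt_anti N (by push_cast; linarith) this
  have h3 : d ^ 2 ∈ filt N 1 (2 * n : ℕ) := by
    have := E.sq zero_le_one le_rfl n.cast_nonneg hd
    push_cast
    exact this
  refine ⟨i + i, j + j, v + 1, ?_, ?_, ?_, _,
    normalForm_sq_mem ((filt N 1 (2 * n : ℕ)).subgroupOf Gam)
      (P := ⟨_, zpow_mem tauPerm_mem i⟩) (Q := ⟨_, zpow_mem muPerm_mem j⟩)
      (d := ⟨d, filt_le_Gam _ _ _ hd⟩) h1 (by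
        change cm d (tauPerm ^ i) ∈ filt N 1 (2 * n : ℕ)
        rw [ey]; exact h2 hy) (by
        change cm d (muPerm ^ j) ∈ filt N 1 (2 * n : ℕ)
        rw [ez]; exact h2 hz) h3, ?_⟩
  · rw [← two_mul, pow_succ, mul_comm]; exact mul_dvd_mul_left 2 hi
  · rw [← two_mul, pow_succ, mul_comm]; exact mul_dvd_mul_left 2 hj
  · rw [pow_succ]; omega
  · change _ = _ * ((tauPerm ^ i * tauPerm ^ i * (muPerm ^ j * muPerm ^ j))⁻¹ *
      (tauPerm ^ i * muPerm ^ j * d * (tauPerm ^ i * muPerm ^ j * d)))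
    rw [zpow_add, zpow_add, mul_inv_cancel_left, pow_two]

/-- The dimension series is the smallest series closed under commutation with Γ and under squaring
from index ⌈n/2⌉ to n. The subgroups of weight at least n have both closure properties, and for n ≤
1 they are all of Γ. -/
theorem inDelta_of_mem_dimSeries (N n : ℕ) {g : Gam} (hg : g ∈ dimSeries Gam n) :
    InDelta N n g := by
  have hlow : ∀ n ≤ 1, ∀ g : Gam, InDelta N n g := by
    intro n hn g
    obtain ⟨i, j, h⟩ := exists_hasExp g.2
    obtain ⟨d, hd, e⟩ := h.exists_eq
    refine ⟨i, j, 0, by simp, by simp, by simpa using hn, d, ?_, e⟩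
    have : (n : ℚ) ≤ 1 := by exact_mod_cast hn
    rwa [filt_eq_Gam' N zero_le_one (by linarith)]
  suffices h : dimSeries Gam n ≤ (deltaSubgroup N n).comap Gam.subtype from h hg
  clear hg g
  induction n using Nat.strong_induction_on with
  | _ n ih =>
    match n, ih with
    | 0, _ => exact fun g _ => hlow 0 zero_le_one g
    | 1, _ => exact fun g _ => hlow 1 le_rfl g
    | n + 2, ih =>
      rw [dimSeries_add_two, sup_le_iff, Subgroup.commutator_le, Subgroup.closure_le]
      refine ⟨fun y _ g hg => ?_, ?_⟩
      · have h1 : InDelta N (n + 1) g := ih (n + 1) (by omega) hg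
        have h2 := inv_mem (h1.inv.cm_mem (inv_mem y.2))
        rw [cm_inv] at h2
        have : InDelta N (n + 2) (cm (y : WordPerm)⁻¹ (g : WordPerm)⁻¹) := .of_filt (by
          push_cast at h2 ⊢
          convert h2 using 2
          ring)
        rw [cm, inv_inv, inv_inv] at this
        exact this
      · rintro _ ⟨h, hh, rfl⟩
        have h1 : InDelta N ((n + 3) / 2) h := ih _ (by omega) hh
        exact h1.sq.anti (by omega)

/-- The exponent sums of an element of `Γ`. -/
noncomputable def exponents (g : WordPerm) : ℤ × ℤ := Classical.epsilon fun p => HasExp g p.1 p.2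

theorem HasExp.exponents_eq {g : WordPerm} {i j : ℤ} (h : HasExp g i j) : exponents g = (i, j) := by
  have := Classical.epsilon_spec (p := fun p : ℤ × ℤ => HasExp g p.1 p.2) ⟨(i, j), h⟩
  obtain ⟨h1, h2⟩ := this.unique h
  exact Prod.ext h1 h2

/-- The coordinate of an element of `Γ` at a basis label. -/
noncomputable def labelCoord : BasisLabel → WordPerm → ℤ
  | .tau _, g => (exponents g).1
  | .mu _, g => (exponents g).2
  | .word W _, g => coord W ((tauPerm ^ (exponents g).1 * muPerm ^ (exponents g).2)⁻¹ * g)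

/-- The exponent `n` of the power `2ⁿ` in a basis label. -/
def BasisLabel.exp : BasisLabel → ℕ
  | .tau n => n
  | .mu n => n
  | .word _ n => n

theorem exponents_normalForm (i j : ℤ) {d : WordPerm} (hd : d ∈ Gam') :
    exponents (tauPerm ^ i * muPerm ^ j * d) = (i, j) :=
  (hasExp_zpow_mul_zpow_mul i j hd).exponents_eq

theorem labelCoord_word_normalForm (W : List Letter) (n : ℕ) (i j : ℤ) {d : WordPerm}
    (hd : d ∈ Gam') : labelCoord (.word W n) (tauPerm ^ i * muPerm ^ j * d) = coord W d := by
  rw [labelCoord, exponents_normalForm i j hd]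
  dsimp only
  rw [inv_mul_cancel_left]

/-- A depth that sees the coordinate at a given label. -/
def BasisLabel.depth : BasisLabel → ℕ
  | .tau _ => 0
  | .mu _ => 0
  | .word W _ => W.length + 1

theorem dvd_of_two_pow_le {a b : ℕ} {z : ℤ} (h : 2 ^ a ≤ 2 ^ b) (hz : (2 ^ b : ℤ) ∣ z) :
    (2 ^ a : ℤ) ∣ z :=
  (pow_dvd_pow 2 ((pow_le_pow_iff_right₀ one_lt_two).1 h)).trans hz

theorem dvd_of_two_pow_lt {a b : ℕ} {z : ℤ} (h : 2 ^ a < 2 ^ b) (hz : (2 ^ b : ℤ) ∣ z) :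
    (2 ^ (a + 1) : ℤ) ∣ z :=
  (pow_dvd_pow 2 ((pow_lt_pow_iff_right₀ one_lt_two).1 h)).trans hz

theorem dvd_labelCoord {v : BasisLabel} {g : WordPerm} (hg : InDelta v.depth v.deg g) :
    (2 ^ v.exp : ℤ) ∣ labelCoord v g := by
  obtain ⟨i, j, a, hi, hj, ha, d, hd, rfl⟩ := hg
  have hd' := filt_le_Gam' _ _ _ hd
  cases v with
  | tau n =>
    rw [labelCoord, exponents_normalForm i j hd']
    exact dvd_of_two_pow_le ha hi
  | mu n =>
    rw [labelCoord, exponents_normalForm i j hd']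
    exact dvd_of_two_pow_le ha hj
  | word W n =>
    rw [labelCoord_word_normalForm _ _ _ _ hd']
    obtain ⟨b, hb, hbn⟩ := coord_mem (N := W.length + 1) (W := W) (by omega) zero_le_one le_rfl
      (Nat.cast_nonneg _) hd
    rw [BasisLabel.deg_word] at hbn
    push_cast at hbn
    have := le_of_mul_le_mul_right hbn (by positivity)
    exact (pow_dvd_pow 2 ((pow_le_pow_iff_right₀ one_lt_two).1 this)).trans hb

theorem dvd_labelCoord_of_lt {v : BasisLabel} {g : WordPerm}
    (hg : InDelta v.depth (v.deg + 1) g) : (2 ^ (v.exp + 1) : ℤ) ∣ labelCoord v g := by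
  obtain ⟨i, j, a, hi, hj, ha, d, hd, rfl⟩ := hg
  have hd' := filt_le_Gam' _ _ _ hd
  cases v with
  | tau n =>
    rw [labelCoord, exponents_normalForm i j hd']
    exact dvd_of_two_pow_lt ha hi
  | mu n =>
    rw [labelCoord, exponents_normalForm i j hd']
    exact dvd_of_two_pow_lt ha hj
  | word W n =>
    rw [labelCoord_word_normalForm _ _ _ _ hd']
    refine coord_dvd_of_lt (N := W.length + 1) (by omega) zero_le_one le_rfl ?_ hd
    rw [BasisLabel.deg_word]
    push_cast
    change (2 : ℚ) ^ n * _ < _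
    linarith

theorem labelCoord_mul {v : BasisLabel} {g h : WordPerm} (hg : InDelta v.depth v.deg g)
    (hh : InDelta v.depth v.deg h) :
    labelCoord v (g * h) ≡ labelCoord v g + labelCoord v h [ZMOD 2 ^ (v.exp + 1)] := by
  obtain ⟨i, j, a, hi, hj, ha, d, hd, rfl⟩ := hg
  obtain ⟨i', j', a', hi', hj', ha', d', hd', rfl⟩ := hh
  have h1 := filt_le_Gam' _ _ _ hd
  have h2 := filt_le_Gam' _ _ _ hd'
  obtain ⟨t, ht, e⟩ := exists_normalForm_mul (i := i) (i' := i') (j' := j') hj ha hd hd'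
  have h3 := filt_le_Gam' _ _ _ ht
  have h4 := mul_mem (mul_mem h1 h2) h3
  rw [e]
  cases v with
  | tau n =>
    simp only [labelCoord]
    rw [exponents_normalForm i j h1, exponents_normalForm i' j' h2, exponents_normalForm _ _ h4]
  | mu n =>
    simp only [labelCoord]
    rw [exponents_normalForm i j h1, exponents_normalForm i' j' h2, exponents_normalForm _ _ h4]
  | word W n =>
    rw [labelCoord_word_normalForm _ _ _ _ h1, labelCoord_word_normalForm _ _ _ _ h2,
      labelCoord_word_normalForm _ _ _ _ h4]
    have en : (((BasisLabel.word W n).deg : ℕ) : ℚ) = 2 ^ n * (wordIndex W + (1 : ℚ)) := by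
      rw [BasisLabel.deg_word]; push_cast; rfl
    rw [en] at hd hd' ht
    have hW : W.length < (BasisLabel.word W n).depth := Nat.lt_succ_self _
    have e1 := coord_mul hW zero_le_one le_rfl n (mul_mem hd hd') (filt_anti _ (by linarith) ht)
    have e2 := coord_mul hW zero_le_one le_rfl n hd hd'
    have e3 := Int.modEq_zero_iff_dvd.2
      (coord_dvd_of_lt hW zero_le_one le_rfl (j := n) (by linarith) ht)
    have := e1.trans (e2.add e3)
    rw [add_zero] at this
    exact this

theorem coe_elt_word (W : List Letter) (n : ℕ) :
    ((BasisLabel.word W n).elt : WordPerm) = wordHom W (cPerm ^ ((2 ^ n : ℕ) : ℤ)) := by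
  rw [BasisLabel.elt, Subgroup.coe_pow, coe_wordC, zpow_natCast, map_pow]

theorem coe_elt_tau (n : ℕ) : ((BasisLabel.tau n).elt : WordPerm) =
    tauPerm ^ ((2 ^ n : ℕ) : ℤ) * muPerm ^ (0 : ℤ) * 1 := by
  rw [BasisLabel.elt, Subgroup.coe_pow, zpow_natCast, zpow_zero, mul_one, mul_one]; rfl

theorem coe_elt_mu (n : ℕ) : ((BasisLabel.mu n).elt : WordPerm) =
    tauPerm ^ (0 : ℤ) * muPerm ^ ((2 ^ n : ℕ) : ℤ) * 1 := by
  rw [BasisLabel.elt, Subgroup.coe_pow, zpow_natCast, zpow_zero, one_mul, mul_one]; rfl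

theorem coe_elt_word' (W : List Letter) (n : ℕ) : ((BasisLabel.word W n).elt : WordPerm) =
    tauPerm ^ (0 : ℤ) * muPerm ^ (0 : ℤ) * wordHom W (cPerm ^ ((2 ^ n : ℕ) : ℤ)) := by
  rw [coe_elt_word, zpow_zero, zpow_zero, one_mul, one_mul]

theorem labelCoord_elt_self (v : BasisLabel) : labelCoord v v.elt = 2 ^ v.exp := by
  cases v with
  | tau n => rw [coe_elt_tau, labelCoord, exponents_normalForm _ _ (one_mem _)]; simp [BasisLabel.exp]
  | mu n => rw [coe_elt_mu, labelCoord, exponents_normalForm _ _ (one_mem _)]; simp [BasisLabel.exp]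
  | word W n =>
    rw [coe_elt_word', labelCoord_word_normalForm _ _ _ _ (wordHom_mem W (zpow_mem cPerm_mem _)),
      coord_wordHom_self]
    simp [BasisLabel.exp]

/-- Labels that differ only in the exponent 2ⁿ share one coordinate, and equality of degrees
excludes that case. In all other cases the elements have disjoint coordinates. -/
theorem labelCoord_elt_of_ne {v w : BasisLabel} (h : v ≠ w) (hd : v.deg = w.deg) :
    labelCoord v w.elt = 0 := by
  have hC : ∀ W n, wordHom W (cPerm ^ ((2 ^ n : ℕ) : ℤ)) ∈ Gam' := fun W n =>
    wordHom_mem W (zpow_mem cPerm_mem _)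
  have hpow : ∀ {a b : ℕ}, 2 ^ a = 2 ^ b → a = b := fun h => Nat.pow_right_injective le_rfl h
  cases w with
  | tau n =>
    rw [coe_elt_tau]
    cases v with
    | tau m => exact absurd (congrArg _ (hpow hd)) h
    | mu m => rw [labelCoord, exponents_normalForm _ _ (one_mem _)]
    | word W m => rw [labelCoord_word_normalForm _ _ _ _ (one_mem _), coord_one]
  | mu n =>
    rw [coe_elt_mu]
    cases v with
    | tau m => rw [labelCoord, exponents_normalForm _ _ (one_mem _)]
    | mu m => exact absurd (congrArg _ (hpow hd)) h
    | word W m => rw [labelCoord_word_normalForm _ _ _ _ (one_mem _), coord_one]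
  | word V n =>
    rw [coe_elt_word']
    cases v with
    | tau m => rw [labelCoord, exponents_normalForm _ _ (hC _ _)]
    | mu m => rw [labelCoord, exponents_normalForm _ _ (hC _ _)]
    | word W m =>
      rw [labelCoord_word_normalForm _ _ _ _ (hC _ _)]
      refine coord_wordHom_of_ne (fun e => h ?_) _
      subst e
      rw [BasisLabel.deg_word, BasisLabel.deg_word] at hd
      rw [hpow (Nat.eq_of_mul_eq_mul_right (Nat.succ_pos _) hd)]

theorem elt_notMem_dimSeries (v : BasisLabel) : v.elt ∉ dimSeries Gam (v.deg + 1) := by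
  intro h
  have h1 := dvd_labelCoord_of_lt (inDelta_of_mem_dimSeries v.depth _ h)
  rw [labelCoord_elt_self] at h1
  have := Int.le_of_dvd (by positivity) h1
  rw [pow_succ] at this
  have h2 : (0 : ℤ) < 2 ^ v.exp := by positivity
  linarith

/-- The functional on `Γₙ/Γₙ₊₁` dual to a basis label of degree `n`. -/
noncomputable def labelFunctional (v : BasisLabel) : Gr Gam v.deg →+ ZMod 2 :=
  Gr.lift (fun x => ((labelCoord v (x : Gam) / 2 ^ v.exp : ℤ) : ZMod 2))
    (by
      intro x y
      have hx := inDelta_of_mem_dimSeries v.depth _ x.2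
      have hy := inDelta_of_mem_dimSeries v.depth _ y.2
      have hxy := inDelta_of_mem_dimSeries v.depth _ (x * y).2
      obtain ⟨a, ha⟩ := dvd_labelCoord hx
      obtain ⟨b, hb⟩ := dvd_labelCoord hy
      obtain ⟨e, he⟩ := dvd_labelCoord hxy
      have hm : labelCoord v ((x * y : dimSeries Gam v.deg) : Gam) ≡ _ [ZMOD _] :=
        labelCoord_mul hx hy
      have h0 : (2 ^ v.exp : ℤ) ≠ 0 := by positivity
      rw [he, ha, hb, ← mul_add, pow_succ] at hm
      have h2 := Int.ModEq.mul_left_cancel' h0 hm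
      rw [ha, hb, he, Int.mul_ediv_cancel_left _ h0, Int.mul_ediv_cancel_left _ h0,
        Int.mul_ediv_cancel_left _ h0, ← Int.cast_add]
      exact (ZMod.intCast_eq_intCast_iff _ _ 2).2 h2)
    (by
      intro x hx
      obtain ⟨a, ha⟩ := dvd_labelCoord_of_lt (inDelta_of_mem_dimSeries v.depth _ hx)
      have h0 : (2 ^ v.exp : ℤ) ≠ 0 := by positivity
      rw [ha, pow_succ, mul_assoc, Int.mul_ediv_cancel_left _ h0]
      push_cast
      rw [show (2 : ZMod 2) = 0 from rfl, zero_mul])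

theorem labelFunctional_self {v : BasisLabel} (hv : v.elt ∈ dimSeries Gam v.deg) :
    labelFunctional v (Gr.mk ⟨v.elt, hv⟩) = 1 := by
  rw [labelFunctional, Gr.lift_mk]
  dsimp only
  rw [labelCoord_elt_self, Int.ediv_self (by positivity), Int.cast_one]

theorem labelFunctional_of_ne {v w : BasisLabel} (h : v ≠ w) (hd : v.deg = w.deg)
    (hw : w.elt ∈ dimSeries Gam v.deg) : labelFunctional v (Gr.mk ⟨w.elt, hw⟩) = 0 := by
  rw [labelFunctional, Gr.lift_mk]
  dsimp only
  rw [labelCoord_elt_of_ne h hd, Int.zero_ediv, Int.cast_zero]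

/-- The functional of a label, extended by 0 to the other degrees, takes the value 1 on its own
element and 0 on all others. -/
theorem linearIndependent_symbol_elt (hmem : ∀ v : BasisLabel, v.elt ∈ dimSeries Gam v.deg) :
    LinearIndependent (ZMod 2) fun v : BasisLabel => DimLie.symbol v.elt := by
  classical
  let f : BasisLabel → DimLie Gam →+ ZMod 2 := fun v =>
    AddMonoidHom.mk' (fun x => labelFunctional v (x v.deg)) fun x y => by
      rw [DirectSum.add_apply, map_add]
  have hsym : ∀ w : BasisLabel, DimLie.symbol w.elt =
      DirectSum.of (fun n => Gr Gam n) w.deg (Gr.mk ⟨w.elt, hmem w⟩) := fun w =>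
    DimLie.symbol_eq_cls (hmem w) (elt_notMem_dimSeries w)
  have h1 : ∀ v, f v (DimLie.symbol v.elt) = 1 := by
    intro v
    rw [hsym]
    change labelFunctional v (DirectSum.of (fun n => Gr Gam n) v.deg _ v.deg) = 1
    rw [DirectSum.of_eq_same, labelFunctional_self]
  have h2 : ∀ v w, v ≠ w → f v (DimLie.symbol w.elt) = 0 := by
    intro v w hvw
    by_cases hd : v.deg = w.deg
    · have hw : w.elt ∈ dimSeries Gam v.deg := hd ▸ hmem w
      have e : DimLie.symbol w.elt =
          DirectSum.of (fun n => Gr Gam n) v.deg (Gr.mk ⟨w.elt, hw⟩) :=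
        DimLie.symbol_eq_cls hw (hd ▸ elt_notMem_dimSeries w)
      rw [e]
      change labelFunctional v (DirectSum.of (fun n => Gr Gam n) v.deg _ v.deg) = 0
      rw [DirectSum.of_eq_same, labelFunctional_of_ne hvw hd]
    · rw [hsym]
      change labelFunctional v (DirectSum.of (fun n => Gr Gam n) w.deg _ v.deg) = 0
      rw [DirectSum.of_eq_of_ne _ _ _ hd, map_zero]
  rw [linearIndependent_iff']
  intro s a ha v hv
  have := congrArg (f v) ha
  rw [map_sum, map_zero, Finset.sum_eq_single v] at this
  · rwa [ZMod.map_smul, h1, smul_eq_mul, mul_one] at this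
  · intro w _ hw
    rw [ZMod.map_smul, h2 v w hw.symm, smul_zero]
  · exact fun h => absurd hv h

end BSV

-- The filtration is contained in the dimension series

section

variable {G : Type*} [Group G]

theorem cm_inv_right (g y : G) : cm g y⁻¹ = y * (cm g y)⁻¹ * y⁻¹ := by simp only [cm]; group

theorem cm_inv_left (g y : G) : cm g⁻¹ y = g * (cm g y)⁻¹ * g⁻¹ := by simp only [cm]; group

theorem cm_mul_left (a b c : G) : cm (a * b) c = b⁻¹ * cm a c * b * cm b c := by
  simp only [cm]; group

variable (T : Subgroup G) [T.Normal]

theorem inv_mul_conj_inv_mem {h k : G} (hk : h⁻¹ * k ∈ T) (hc : ∀ y, cm h y ∈ T)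
    (h2 : h ^ 2 ∈ T) (y : G) : h⁻¹ * (y * k⁻¹ * y⁻¹) ∈ T := by
  simp only [cm_mem_iff] at hc
  rw [mem_iff_mk'_eq_one] at *
  simp only [map_mul, map_inv, map_pow] at *
  rw [← inv_mul_eq_one.1 hk, (hc y).inv_left.eq_conj, ← mul_inv_rev, ← pow_two, h2, inv_one]

theorem conj_mul_conj_mem {h : G} (hc : ∀ y, cm h y ∈ T) (h2 : h ^ 2 ∈ T) (y z : G) :
    y * h * y⁻¹ * (z * h * z⁻¹) ∈ T := by
  simp only [cm_mem_iff] at hc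
  rw [mem_iff_mk'_eq_one] at *
  simp only [map_mul, map_inv, map_pow] at *
  rw [(hc y).eq_conj, (hc z).eq_conj, ← pow_two, h2]

end

namespace BSV

/-- The terms of the 2-dimension series of `Γ`, as groups of permutations. -/
def dimGam (n : ℕ) : Subgroup WordPerm := (dimSeries Gam n).map Gam.subtype

theorem mem_dimGam_iff {n : ℕ} {g : Gam} : (g : WordPerm) ∈ dimGam n ↔ g ∈ dimSeries Gam n :=
  Subgroup.mem_map_iff_mem Gam.subtype_injective

theorem dimGam_le_Gam (n : ℕ) : dimGam n ≤ Gam := by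
  rintro _ ⟨g, -, rfl⟩
  exact g.2

theorem dimGam_anti {m n : ℕ} (h : m ≤ n) : dimGam n ≤ dimGam m :=
  Subgroup.map_mono (dimSeries_antitone Gam h)

theorem dimGam_conj {n : ℕ} {y g : WordPerm} (hy : y ∈ Gam) (hg : g ∈ dimGam n) :
    y⁻¹ * g * y ∈ dimGam n := by
  obtain ⟨g, hg, rfl⟩ := hg
  exact ⟨_, (dimSeries_normal Gam n).conj_mem' g hg ⟨y, hy⟩, rfl⟩

theorem cm_mem_dimGam {m n : ℕ} {g h : WordPerm} (hg : g ∈ dimGam m) (hh : h ∈ dimGam n) :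
    cm g h ∈ dimGam (m + n) := by
  obtain ⟨g, hg, rfl⟩ := hg
  obtain ⟨h, hh, rfl⟩ := hh
  exact ⟨_, comm_mem_dimSeries hg hh, rfl⟩

theorem dimGam_one : dimGam 1 = Gam := by
  rw [dimGam, dimSeries_one, ← MonoidHom.range_eq_map, Subgroup.range_subtype]

theorem cm_Gam_mem_dimGam {n : ℕ} {g y : WordPerm} (hg : g ∈ dimGam n) (hy : y ∈ Gam) :
    cm g y ∈ dimGam (n + 1) := cm_mem_dimGam hg (dimGam_one ▸ hy)

theorem sq_mem_dimGam {n : ℕ} {g : WordPerm} (hg : g ∈ dimGam n) : g ^ 2 ∈ dimGam (2 * n) := by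
  obtain ⟨g, hg, rfl⟩ := hg
  exact ⟨_, sq_mem_dimSeries n hg, rfl⟩

theorem pow_mem_dimGam {n : ℕ} {g : WordPerm} (hg : g ∈ dimGam n) (j : ℕ) :
    g ^ 2 ^ j ∈ dimGam (2 ^ j * n) := by
  induction j with
  | zero => simpa using hg
  | succ j ih =>
    have := sq_mem_dimGam ih
    rwa [← pow_mul, ← pow_succ, ← mul_assoc, mul_comm 2, ← pow_succ] at this

theorem Gam'_le_dimGam : Gam' ≤ dimGam 2 := by
  refine Subgroup.commutator_le.2 fun a ha b hb => ?_
  have := cm_Gam_mem_dimGam (n := 1) (by rw [dimGam_one]; exact inv_mem ha) (inv_mem hb)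
  simpa [cm, commutatorElement_def] using this

theorem wordHom_append (V W : List Letter) (g : WordPerm) :
    wordHom (V ++ W) g = wordHom V (wordHom W g) := by
  induction V with
  | nil => rfl
  | cons l V ih => rw [List.cons_append, wordHom_cons, ih, wordHom_cons]

/-- Some y = (p, h) lies in Γ, and conjugation by it realises conjugation by p inside the first
section. Hence preimages under 𝟖 of Γ-invariant subgroups are Γ-invariant. -/
theorem exists_eight_hom_conj {p : WordPerm} (hp : p ∈ Gam) :
    ∃ y ∈ Gam, ∀ g, Letter.eight.hom (p⁻¹ * g * p) = y⁻¹ * Letter.eight.hom g * y := by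
  obtain ⟨h, hh⟩ := exists_pair_mem hp
  refine ⟨_, hh, fun g => ?_⟩
  rw [Letter.eight_hom, Letter.eight_hom, conj_pair_even]
  simp

theorem exists_wordHom_replicate_conj (N : ℕ) {p : WordPerm} (hp : p ∈ Gam) : ∃ y ∈ Gam, ∀ g,
    wordHom (List.replicate N .eight) (p⁻¹ * g * p) =
      y⁻¹ * wordHom (List.replicate N .eight) g * y := by
  induction N with
  | zero => exact ⟨p, hp, fun _ => rfl⟩
  | succ N ih =>
    obtain ⟨y, hy, h⟩ := ih
    obtain ⟨z, hz, h'⟩ := exists_eight_hom_conj hy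
    refine ⟨z, hz, fun g => ?_⟩
    rw [List.replicate_succ, wordHom_cons, h, h', wordHom_cons]

/-- Both generators have the form (1, q)ε, with q = τ or μ⁻¹, and for these q the commutator [x, q]
is a conjugate of c⁻¹. So [c, τ] and [c, μ] are 𝟖(c) up to conjugation, inversion and the square
c⁻². -/
theorem cm_cPerm_odd (q : WordPerm) :
    cm cPerm (pair (1, q) * eps) = (cPerm ^ 2)⁻¹ * Letter.eight.hom (cm xPerm q) := by
  have h := conj_cPerm_odd 1 q 1
  rw [zpow_one, zpow_one, show cm xPerm⁻¹ (1 : WordPerm) = 1 by simp [cm]] at h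
  rw [Letter.eight_hom, pow_two, mul_inv_rev, mul_assoc, ← h]
  simp only [cm]
  group

theorem cm_xPerm_tauPerm : cm xPerm tauPerm = tauPerm⁻¹ * cPerm⁻¹ * tauPerm := by
  simp only [cm, xPerm, cPerm]; group

theorem cm_xPerm_muPerm_inv : cm xPerm muPerm⁻¹ = muPerm * cPerm⁻¹ * muPerm⁻¹ := by
  simp only [cm, xPerm, cPerm]; group

/-- A crude bound, one degree per letter. With f = 𝟖^N, the element f([c, τ]) is a commutator of
f(c) with an element of Γ, and it equals f(c)⁻² · f𝟖(c⁻¹ conjugated by τ). Both f([c, τ]) and the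
square lie in index N + 3, so f𝟖(c) does too, and Γ' is the normal closure of c. -/
theorem wordHom_replicate_mem_dimGam (N : ℕ) {g : WordPerm} (hg : g ∈ Gam') :
    wordHom (List.replicate N .eight) g ∈ dimGam (N + 2) := by
  induction N generalizing g with
  | zero => exact Gam'_le_dimGam hg
  | succ N ih =>
    set f := wordHom (List.replicate N .eight) with hf
    have hcm : ∀ g ∈ Gam', ∀ p ∈ Gam, f (cm g p) ∈ dimGam (N + 3) := by
      intro g hg p hp
      obtain ⟨y, hy, h⟩ := exists_wordHom_replicate_conj N hp
      have := cm_Gam_mem_dimGam (ih hg) hy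
      rwa [show cm (f g) y = f (cm g p) by
        rw [show cm g p = g⁻¹ * (p⁻¹ * g * p) by simp only [cm]; group, map_mul, h, map_inv]
        simp only [cm, hf]; group] at this
    let K : Subgroup WordPerm := (dimGam (N + 3)).comap (f.comp Letter.eight.hom)
    have hK : ∀ y ∈ Gam, ∀ h ∈ K, y⁻¹ * h * y ∈ K := by
      intro p hp g hg
      obtain ⟨y, hy, h⟩ := exists_eight_hom_conj hp
      obtain ⟨z, hz, h'⟩ := exists_wordHom_replicate_conj N hy
      change f (Letter.eight.hom (p⁻¹ * g * p)) ∈ dimGam (N + 3)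
      rw [h, hf, h']
      exact dimGam_conj hz hg
    have hc : cPerm ∈ K := by
      have h1 := hcm _ cPerm_mem _ tauPerm_mem
      rw [tauPerm_eq, cm_cPerm_odd, map_mul, map_inv, map_pow] at h1
      have h2 := dimGam_anti (m := N + 3) (by omega) (sq_mem_dimGam (ih cPerm_mem))
      have h3 : cm xPerm tauPerm ∈ K := by
        have := mul_mem h2 h1
        rwa [mul_inv_cancel_left] at this
      rw [cm_xPerm_tauPerm] at h3
      have h4 := inv_mem (hK _ (inv_mem tauPerm_mem) _ h3)
      rwa [show (tauPerm⁻¹⁻¹ * (tauPerm⁻¹ * cPerm⁻¹ * tauPerm) * tauPerm⁻¹)⁻¹ = cPerm by group]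
        at h4
    have := Gam'_le_of_normal hK hc hg
    rw [List.replicate_succ', wordHom_append]
    exact this

/-- A letter 𝟗 costs nothing compared with 𝟖: (g, g) = (g, 1)(1, g), and (1, g) is the conjugate of
(g, 1) by τ. -/
theorem wordHom_mem_of_replicate {K : Subgroup WordPerm} (hK : ∀ y ∈ Gam, ∀ h ∈ K, y⁻¹ * h * y ∈ K)
    {W : List Letter} (h : ∀ g ∈ Gam', wordHom (List.replicate W.length .eight) g ∈ K)
    {g : WordPerm} (hg : g ∈ Gam') : wordHom W g ∈ K := by
  induction W generalizing K with
  | nil => exact h g hg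
  | cons l W ih =>
    have h1 : wordHom W g ∈ K.comap Letter.eight.hom := by
      refine ih (K := K.comap Letter.eight.hom) ?_ h
      intro p hp g hg
      obtain ⟨y, hy, h⟩ := exists_eight_hom_conj hp
      rw [Subgroup.mem_comap, h]
      exact hK y hy _ hg
    cases l
    · exact h1
    · have h2 := hK _ tauPerm_mem _ h1
      rw [Letter.eight_hom, conj_tauPerm_pair] at h2
      have h1' : Letter.eight.hom (wordHom W g) ∈ K := h1
      have h3 := mul_mem h1' h2
      rwa [Letter.eight_hom, pair_mul, show wordHom W g * (tauPerm⁻¹ * 1 * tauPerm) = wordHom W g by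
        group, one_mul] at h3

theorem wordHom_mem_dimGam (W : List Letter) {g : WordPerm} (hg : g ∈ Gam') :
    wordHom W g ∈ dimGam (W.length + 2) :=
  wordHom_mem_of_replicate (fun _ hy _ hh => dimGam_conj hy hh)
    (fun _ hg => wordHom_replicate_mem_dimGam _ hg) hg

/-- Generators of the filtration. -/
theorem filt_le_of_words {H : Subgroup WordPerm} {N : ℕ} {s n : ℚ}
    (h : ∀ W : List Letter, W.length = N → ∀ g ∈ Gam', wordHom W g ∈ H)
    (h' : ∀ W : List Letter, W.length < N → ∀ j : ℕ, n ≤ 2 ^ j * (wordIndex W + s) →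
      wordHom W cPerm ^ 2 ^ j ∈ H) : filt N s n ≤ H := by
  induction N generalizing H s n with
  | zero => exact h [] rfl
  | succ N ih =>
    refine (Subgroup.closure_le _).2 ?_
    rintro _ ⟨k, u, hu, b, hb, ⟨j, hj, hjn⟩, rfl⟩
    have hc : cPerm ^ k ∈ H := by
      obtain ⟨m, rfl⟩ := hj
      rw [zpow_mul]
      refine zpow_mem ?_ m
      have := h' [] (Nat.succ_pos _) j (by simpa [wordIndex] using hjn)
      rw [← zpow_natCast] at this
      exact_mod_cast this
    have hu' : Letter.eight.hom u ∈ H := by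
      refine ih (H := H.comap Letter.eight.hom) (fun W hW g hg => h (.eight :: W) (by simp [hW]) g hg)
        (fun W hW j hj => ?_) hu
      have := h' (.eight :: W) (by simpa using hW) j (by
        simp only [wordIndex]; push_cast; linarith)
      rw [Subgroup.mem_comap, map_pow]
      exact this
    have hb' : Letter.nine.hom b ∈ H := by
      refine ih (H := H.comap Letter.nine.hom) (fun W hW g hg => h (.nine :: W) (by simp [hW]) g hg)
        (fun W hW j hj => ?_) hb
      have := h' (.nine :: W) (by simpa using hW) j (by
        simp only [wordIndex]; push_cast; linarith)
      rw [Subgroup.mem_comap, map_pow]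
      exact this
    have := mul_mem hc (mul_mem hu' hb')
    rwa [Letter.eight_hom, Letter.nine_hom, pair_mul, one_mul] at this

theorem eight_hom_mem_filt {N : ℕ} {s n : ℚ} (hs : 0 ≤ s) {u : WordPerm}
    (hu : u ∈ filt N (s / 2) (n / 2)) : Letter.eight.hom u ∈ filt (N + 1) s n := by
  obtain ⟨j, hj⟩ := exists_le_two_pow_mul (n := n) (w := 1 + s) (by linarith)
  rw [eight_hom_eq]
  exact mem_filt_of_blockSet hu (one_mem _) (dvd_zero _) hj

theorem nine_hom_mem_filt {N : ℕ} {s n : ℚ} (hs : 0 ≤ s) {u : WordPerm}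
    (hu : u ∈ filt N ((1 + s) / 2) (n / 2)) : Letter.nine.hom u ∈ filt (N + 1) s n := by
  obtain ⟨j, hj⟩ := exists_le_two_pow_mul (n := n) (w := 1 + s) (by linarith)
  rw [nine_hom_eq]
  exact mem_filt_of_blockSet (one_mem _) hu (dvd_zero _) hj

theorem wordHom_mem_filt (N : ℕ) (W : List Letter) {s : ℚ} (hs : 0 ≤ s) :
    wordHom W cPerm ∈ filt N s (wordIndex W + s) := by
  induction W generalizing N s with
  | nil =>
    rw [filt_eq_Gam' N hs (by simp [wordIndex])]
    exact cPerm_mem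
  | cons l W ih =>
    obtain _ | N := N
    · exact wordHom_mem _ cPerm_mem
    rw [wordHom_cons]
    cases l
    · refine eight_hom_mem_filt hs (filt_anti N (le_of_eq ?_) (ih N (s := s / 2) (by linarith)))
      simp only [wordIndex]; push_cast; ring
    · refine nine_hom_mem_filt hs
        (filt_anti N (le_of_eq ?_) (ih N (s := (1 + s) / 2) (by linarith)))
      simp only [wordIndex]; push_cast; ring

theorem wordHom_pow_mem_filt (N : ℕ) (W : List Letter) {s : ℚ} (hs : 0 ≤ s) (hs' : s ≤ 1) (j : ℕ) :
    wordHom W cPerm ^ 2 ^ j ∈ filt N s (2 ^ j * (wordIndex W + s)) := by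
  induction j with
  | zero => simpa using wordHom_mem_filt N W hs
  | succ j ih =>
    have := (filtEstimates N).sq hs hs' (by positivity) ih
    rwa [← pow_mul, ← pow_succ, ← mul_assoc, ← pow_succ'] at this

theorem sq_mem_filt_of_le {N : ℕ} {s n m : ℚ} (hs : 0 ≤ s) (hs' : s ≤ 1) (hn : 0 ≤ n)
    (h : m ≤ 2 * n) {g : WordPerm} (hg : g ∈ filt N s n) : g ^ 2 ∈ filt N s m :=
  filt_anti N h ((filtEstimates N).sq hs hs' hn hg)

theorem cm_mem_filt_of_le {N : ℕ} {s n m : ℚ} (hs : 0 ≤ s) (hs' : s ≤ 1) (hn : 0 ≤ n)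
    (h : m ≤ n + 1) {g y : WordPerm} (hg : g ∈ filt N s n) (hy : y ∈ Gam) :
    cm g y ∈ filt N s m := by
  have := (filtEstimates N).cm_Gam le_rfl hs hs' hn hg hy
  rw [sub_zero, sub_zero] at this
  exact filt_anti N h this

/-- Modulo weight `m`, an element of weight at least `m - 1` and `m/2` may be conjugated and
inverted. -/
theorem inv_mul_conj_inv_mem_filt {N : ℕ} {s n m : ℚ} (hs : 0 ≤ s) (hs' : s ≤ 1) (hn : 0 ≤ n)
    (hm : 0 ≤ m) (h1 : m ≤ n + 1) (h2 : m ≤ 2 * n) {h k y : WordPerm} (hh : h ∈ filt N s n)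
    (hk : k ∈ Gam) (hy : y ∈ Gam) (hhk : h⁻¹ * k ∈ filt N s m) :
    h⁻¹ * (y * k⁻¹ * y⁻¹) ∈ filt N s m := by
  have hT := (filtEstimates N).normal hs hs' hm
  exact inv_mul_conj_inv_mem ((filt N s m).subgroupOf Gam) (h := ⟨h, filt_le_Gam _ _ _ hh⟩)
    (k := ⟨k, hk⟩) hhk (fun y => cm_mem_filt_of_le hs hs' hn h1 hh y.2)
    (sq_mem_filt_of_le hs hs' hn h2 hh) ⟨y, hy⟩

theorem conj_mul_conj_mem_filt {N : ℕ} {s n m : ℚ} (hs : 0 ≤ s) (hs' : s ≤ 1) (hn : 0 ≤ n)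
    (hm : 0 ≤ m) (h1 : m ≤ n + 1) (h2 : m ≤ 2 * n) {h y z : WordPerm} (hh : h ∈ filt N s n)
    (hy : y ∈ Gam) (hz : z ∈ Gam) : y * h * y⁻¹ * (z * h * z⁻¹) ∈ filt N s m := by
  have hT := (filtEstimates N).normal hs hs' hm
  exact conj_mul_conj_mem ((filt N s m).subgroupOf Gam) (h := ⟨h, filt_le_Gam _ _ _ hh⟩)
    (fun y => cm_mem_filt_of_le hs hs' hn h1 hh y.2)
    (sq_mem_filt_of_le hs hs' hn h2 hh) ⟨y, hy⟩ ⟨z, hz⟩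

/-- The successor of a word: it adds `1` to `wordIndex`. -/
def succWord : List Letter → List Letter
  | [] => [.eight]
  | .eight :: W => .nine :: W
  | .nine :: W => .eight :: succWord W

theorem wordIndex_succWord (W : List Letter) : wordIndex (succWord W) = wordIndex W + 1 := by
  induction W with
  | nil => rfl
  | cons l W ih => cases l <;> simp only [succWord, wordIndex, ih]; ring

theorem exists_succWord_eq {W : List Letter} (hW : W ≠ []) : ∃ V, succWord V = W := by
  induction W with
  | nil => exact absurd rfl hW
  | cons l W ih =>
    cases l
    · rcases eq_or_ne W [] with rfl | h
      · exact ⟨[], rfl⟩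
      · obtain ⟨V, rfl⟩ := ih h
        exact ⟨.nine :: V, rfl⟩
    · exact ⟨.eight :: W, rfl⟩

theorem one_le_wordIndex_cast (W : List Letter) : (1 : ℚ) ≤ wordIndex W := by
  exact_mod_cast one_le_wordIndex W

/-- `[W(c), τ]` and `[W(c), μ]` are congruent to `W'(c)`, where `W'` is the successor of `W`. -/
theorem succWord_inv_mul_cm_mem (N : ℕ) (W : List Letter) {s : ℚ} (hs : 0 ≤ s) (hs' : s ≤ 1)
    {y : WordPerm} (hy : y = tauPerm ∨ y = muPerm) :
    (wordHom (succWord W) cPerm)⁻¹ * cm (wordHom W cPerm) y ∈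
      filt N s (wordIndex W + 1 + 2 * s) := by
  induction W generalizing N s y with
  | nil =>
    obtain _ | N := N
    · have hy' : y ∈ Gam := by rcases hy with rfl | rfl; exacts [tauPerm_mem, muPerm_mem]
      exact mul_mem (inv_mem (wordHom_mem _ cPerm_mem)) (cm_mem_Gam' (Gam'_le cPerm_mem) hy')
    have hc : cPerm ∈ filt N (s / 2) (1 + s / 2) := by
      simpa [wordIndex, wordHom_nil] using wordHom_mem_filt N [] (s := s / 2) (by linarith)
    -- For either generator [x, q] is a conjugate of c⁻¹, and it agrees with c because conjugation
    -- and inversion change c only by elements of higher weight.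
    obtain ⟨q, hyq, hq⟩ : ∃ q, y = pair (1, q) * eps ∧
        cPerm⁻¹ * cm xPerm q ∈ filt N (s / 2) ((wordIndex [] + 1 + 2 * s) / 2) := by
      have key : ∀ z ∈ Gam, cPerm⁻¹ * (z * cPerm⁻¹ * z⁻¹) ∈
          filt N (s / 2) ((wordIndex [] + 1 + 2 * s) / 2) := by
        intro z hz
        have hw : ((wordIndex [] : ℕ) : ℚ) = 1 := by simp [wordIndex]
        rw [hw]
        exact inv_mul_conj_inv_mem_filt (by linarith) (by linarith) (by linarith) (by linarith)
          (by linarith) (by linarith) hc (Gam'_le cPerm_mem) hz (by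
            rw [inv_mul_cancel]; exact one_mem _)
      rcases hy with rfl | rfl
      · refine ⟨tauPerm, tauPerm_eq, ?_⟩
        have := key _ (inv_mem tauPerm_mem)
        rwa [inv_inv, ← cm_xPerm_tauPerm] at this
      · refine ⟨muPerm⁻¹, muPerm_eq, ?_⟩
        rw [cm_xPerm_muPerm_inv]
        exact key _ muPerm_mem
    have h1 := eight_hom_mem_filt hs hq
    have h2 := sq_mem_filt_of_le (m := wordIndex [] + 1 + 2 * s) hs hs' (by linarith)
      (by simp only [wordIndex]; push_cast; linarith)
      (show cPerm ∈ filt (N + 1) s (1 + s) by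
        rw [filt_eq_Gam' _ hs le_rfl]; exact cPerm_mem)
    have h3 := (filtEstimates (N + 1)).conj_mem hs hs' (by positivity)
      (Gam'_le (wordHom_mem [.eight] cPerm_mem)) (inv_mem h2)
    have := mul_mem h3 h1
    rw [hyq, succWord, wordHom_nil, cm_cPerm_odd]
    rw [map_mul, map_inv] at this
    rwa [show wordHom [.eight] cPerm = Letter.eight.hom cPerm from rfl, ← mul_assoc,
      mul_inv_cancel_right, mul_assoc] at this
  | cons l W ih =>
    obtain _ | N := N
    · have hy' : y ∈ Gam := by rcases hy with rfl | rfl; exacts [tauPerm_mem, muPerm_mem]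
      exact mul_mem (inv_mem (wordHom_mem _ cPerm_mem))
        (cm_mem_Gam' (Gam'_le (wordHom_mem _ cPerm_mem)) hy')
    have hWm := wordHom_mem W cPerm_mem
    have hidx := one_le_wordIndex_cast W
    cases l
    -- The digit 0 becomes 1: [(g, 1), (1, q)ε] = (g⁻¹, g) = 𝟗(g) · 𝟖(g⁻²), and the square has
    -- higher weight.
    · obtain ⟨q, rfl⟩ : ∃ q, y = pair (1, q) * eps := by
        rcases hy with rfl | rfl
        exacts [⟨_, tauPerm_eq⟩, ⟨_, muPerm_eq⟩]
      have h1 := inv_mem (sq_mem_filt_of_le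
        (m := (wordIndex (.eight :: W) + 1 + 2 * s) / 2) (by linarith) (by linarith)
        (by linarith) (by simp only [wordIndex]; push_cast; linarith)
        (wordHom_mem_filt N W (s := s / 2) (by linarith)))
      have h2 := eight_hom_mem_filt hs h1
      convert h2 using 1
      rw [succWord, wordHom_cons, wordHom_cons, Letter.nine_hom, Letter.eight_hom, Letter.eight_hom,
        cm_pair_odd, pair_inv, pair_mul]
      congr 2
      · rw [pow_two]; group
      · group
    -- The digit 1 becomes 0 with a carry: [(g, g), (1, q)ε] = 𝟖([g, q]). For y = μ one has q = μ⁻¹,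
    -- and [g, μ⁻¹] is a conjugate of [g, μ]⁻¹.
    · obtain ⟨q, rfl, hq⟩ : ∃ q, y = pair (1, q) * eps ∧
          (wordHom (succWord W) cPerm)⁻¹ * cm (wordHom W cPerm) q ∈
            filt N (s / 2) ((wordIndex (.nine :: W) + 1 + 2 * s) / 2) := by
        have hw : (wordIndex (.nine :: W) + 1 + 2 * s) / 2 = wordIndex W + 1 + 2 * (s / 2) := by
          simp only [wordIndex]; push_cast; ring
        rw [hw]
        rcases hy with rfl | rfl
        · exact ⟨_, tauPerm_eq, ih N (by linarith) (by linarith) (Or.inl rfl)⟩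
        · refine ⟨_, muPerm_eq, ?_⟩
          rw [cm_inv_right]
          have h1 := wordHom_mem_filt N (succWord W) (s := s / 2) (by linarith)
          rw [wordIndex_succWord] at h1
          push_cast at h1
          exact inv_mul_conj_inv_mem_filt (by linarith) (by linarith) (by linarith) (by linarith)
            (by linarith) (by linarith) h1 (Gam'_le (cm_mem_Gam' (Gam'_le hWm) muPerm_mem))
            muPerm_mem (ih N (by linarith) (by linarith) (Or.inr rfl))
      have h2 := eight_hom_mem_filt hs hq
      convert h2 using 1
      rw [succWord, wordHom_cons, wordHom_cons, Letter.nine_hom, Letter.eight_hom, Letter.eight_hom,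
        cm_pair_odd, pair_inv, pair_mul]
      congr 2
      group

theorem wordIndex_lt (W : List Letter) : wordIndex W < 2 ^ (W.length + 1) := by
  induction W with
  | nil => simp [wordIndex]
  | cons l W ih =>
    rw [List.length_cons, pow_succ]
    cases l <;> simp only [wordIndex] <;> omega

/-- `W(c)` lies in the term of the dimension series given by its asserted degree. -/
theorem wordHom_cPerm_mem_dimGam (W : List Letter) :
    wordHom W cPerm ∈ dimGam (wordIndex W + 1) := by
  suffices h : ∀ n W, wordHom W cPerm ∈ dimGam (min (wordIndex W + 1) n) by
    simpa using h (wordIndex W + 1) W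
  have hGam' : ∀ W : List Letter, wordHom W cPerm ∈ dimGam 2 := fun W =>
    Gam'_le_dimGam (wordHom_mem W cPerm_mem)
  intro n
  induction n with
  | zero => exact fun W => dimGam_anti (by omega) (hGam' W)
  | succ n ih =>
    rcases Nat.lt_or_ge n 2 with hn2 | hn2
    · exact fun W => dimGam_anti (by omega) (hGam' W)
    have hlong : ∀ W : List Letter, W.length = n + 1 → ∀ g ∈ Gam', wordHom W g ∈ dimGam (n + 1) :=
      fun W hW g hg => dimGam_anti (by omega) (wordHom_mem_dimGam W hg)
    -- Downward induction on the weight m, with k bounding the distance to 2^(2n+2). It is possible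
    -- because at fixed depth only finitely many words occur.
    have key : ∀ k m : ℕ, n + 1 ≤ m → 2 ^ (2 * n + 2) ≤ m + k →
        filt (n + 1) 1 m ≤ dimGam (n + 1) := by
      intro k
      induction k with
      | zero =>
        intro m _ hm
        -- Words of length at most n have e + 1 ≤ 2^(n+1), so weight at least 2^(2n+2) forces j ≥ n
        -- + 1. The 2^j-th power of an element of Γ' is then deep enough whatever W is.
        refine filt_le_of_words hlong fun W hW j hj => ?_
        have h1 : m ≤ 2 ^ j * (wordIndex W + 1) := by exact_mod_cast hj
        have h2 : wordIndex W + 1 ≤ 2 ^ (n + 1) :=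
          (wordIndex_lt W).trans_le (Nat.pow_le_pow_right two_pos hW)
        have h3 : 2 ^ (2 * n + 2) ≤ 2 ^ (j + (n + 1)) := by
          rw [pow_add 2 j (n + 1)]
          exact (hm.trans h1).trans (Nat.mul_le_mul_left _ h2)
        have h4 := (Nat.pow_le_pow_iff_right one_lt_two).1 h3
        have h5 : n + 1 < 2 ^ j := (show n + 1 ≤ j by omega).trans_lt Nat.lt_two_pow_self
        exact dimGam_anti (by omega) (pow_mem_dimGam (hGam' W) j)
      | succ k ihk =>
        intro m hm hk
        have hnext := ihk (m + 1) (by omega) (by omega)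
        refine filt_le_of_words hlong fun W hW j hj => ?_
        have h1 : m ≤ 2 ^ j * (wordIndex W + 1) := by exact_mod_cast hj
        rcases Nat.lt_or_eq_of_le h1 with h2 | h2
        · refine hnext (filt_anti _ ?_ (wordHom_pow_mem_filt (n + 1) W zero_le_one le_rfl j))
          exact_mod_cast h2
        obtain _ | j := j
        -- In weight exactly m and j = 0, W is the successor of some V; it is not empty because m ≥
        -- n + 1 ≥ 3. Up to weight m + 1, W(c) is [V(c), τ], and V(c) has index at least n by the
        -- outer induction.
        · obtain ⟨V, rfl⟩ := exists_succWord_eq (W := W) (by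
            rintro rfl
            simp only [wordIndex] at h2
            omega)
          rw [pow_zero, one_mul, wordIndex_succWord] at h2
          have h3 := dimGam_anti (m := n) (by omega) (ih V)
          have h4 := cm_Gam_mem_dimGam h3 tauPerm_mem
          have h5 := hnext (filt_anti _ (by rw [h2]; push_cast; linarith)
            (succWord_inv_mul_cm_mem (n + 1) V zero_le_one le_rfl (Or.inl rfl)))
          have := mul_mem h4 (inv_mem h5)
          rwa [mul_inv_rev, inv_inv, mul_inv_cancel_left, ← pow_one (wordHom _ _),
            ← pow_zero 2] at this
        -- A proper power needs no successor argument: 2^(j+1) times min(e + 1, n) is already at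
        -- least n + 1.
        · refine dimGam_anti ?_ (pow_mem_dimGam (ih W) (j + 1))
          rcases min_choice (wordIndex W + 1) n with h | h <;> rw [h]
          · omega
          · have : 2 * n ≤ 2 ^ (j + 1) * n :=
              Nat.mul_le_mul_right n (by rw [pow_succ]; have := Nat.one_le_two_pow (n := j); omega)
            omega
    intro W
    rcases Nat.lt_or_ge n (wordIndex W + 1) with h | h
    · rw [min_eq_right h]
      refine key _ (wordIndex W + 1) h (Nat.le_add_left _ _) ?_
      have := wordHom_mem_filt (n + 1) W zero_le_one
      push_cast
      exact this
    · have := ih W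
      rw [min_eq_left h] at this
      rwa [min_eq_left (by omega)]

/-- The filtration of depth N does not control words of length N, but their values lie in index N +
2 anyway; this explains the bound on n. -/
theorem filt_le_dimGam {N n : ℕ} (h : n ≤ N + 2) : filt N 1 n ≤ dimGam n := by
  refine filt_le_of_words (fun W hW g hg => dimGam_anti (by omega) (wordHom_mem_dimGam W hg))
    fun W _ j hj => ?_
  have h1 : n ≤ 2 ^ j * (wordIndex W + 1) := by exact_mod_cast hj
  exact dimGam_anti h1 (pow_mem_dimGam (wordHom_cPerm_mem_dimGam W) j)

theorem mem_dimGam_of_forall_filt {n : ℕ} {m : ℚ} {g : WordPerm} (hn : (n : ℚ) ≤ m)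
    (h : ∀ N, g ∈ filt N 1 m) : g ∈ dimGam n :=
  filt_le_dimGam (Nat.le_add_right n 2) (filt_anti n hn (h n))

-- Brackets with τ and μ modulo higher weight

theorem wordIndex_replicate_eight (n : ℕ) : wordIndex (List.replicate n .eight) = 2 ^ n := by
  induction n with
  | zero => rfl
  | succ n ih => rw [List.replicate_succ, wordIndex, ih, pow_succ, mul_comm]

/-- τ² = (τ, τ) and μ = (1, μ⁻¹)ε give [τ^(2^(n+1)), μ] = 𝟖([τ^(2ⁿ), μ⁻¹]), and μ⁻¹ may be replaced
by μ up to higher weight. -/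
theorem replicate_inv_mul_cm_tauPerm_mem (N n : ℕ) {s : ℚ} (hs : 0 ≤ s) (hs' : s ≤ 1) :
    (wordHom (List.replicate n .eight) cPerm)⁻¹ * cm (tauPerm ^ 2 ^ n) muPerm ∈
      filt N s (2 ^ n + s + 1) := by
  induction n generalizing N s with
  | zero =>
    rw [show tauPerm ^ 2 ^ 0 = tauPerm by simp, cm_tauPerm_muPerm]
    change cPerm⁻¹ * cPerm ∈ _
    rw [inv_mul_cancel]
    exact one_mem _
  | succ n ih =>
    obtain _ | N := N
    · exact mul_mem (inv_mem (wordHom_mem _ cPerm_mem))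
        (cm_mem_Gam' (pow_mem tauPerm_mem _) muPerm_mem)
    have hJ : (1 : ℚ) ≤ 2 ^ n := one_le_pow₀ one_le_two
    have h1 := wordHom_mem_filt N (List.replicate n .eight) (s := s / 2) (by linarith)
    rw [wordIndex_replicate_eight] at h1
    push_cast at h1
    have h2 := inv_mul_conj_inv_mem_filt (by linarith) (by linarith) (by linarith) (by linarith)
      (by linarith) (by linarith) h1 (Gam'_le (cm_mem_Gam' (pow_mem tauPerm_mem _) muPerm_mem))
      muPerm_mem (ih N (s := s / 2) (by linarith) (by linarith))
    rw [← cm_inv_right] at h2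
    have h3 := eight_hom_mem_filt hs (filt_anti N (n' := (2 ^ (n + 1) + s + 1) / 2)
      (by rw [pow_succ]; linarith) h2)
    convert h3 using 1
    rw [List.replicate_succ, wordHom_cons, map_mul, map_inv]
    congr 1
    rw [Letter.eight_hom, pow_succ' 2 n, pow_mul, tauPerm_sq, pair_pow]
    conv_lhs => rw [muPerm_eq, cm_pair_odd]
    congr 2
    group

theorem replicate_inv_mul_cm_muPerm_mem (N n : ℕ) {s : ℚ} (hs : 0 ≤ s) (hs' : s ≤ 1) :
    (wordHom (List.replicate n .eight) cPerm)⁻¹ * cm (muPerm ^ 2 ^ n) tauPerm ∈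
      filt N s (2 ^ n + s + 1) := by
  induction n generalizing N s with
  | zero =>
    rw [show muPerm ^ 2 ^ 0 = muPerm by simp, ← cm_inv, cm_tauPerm_muPerm]
    change cPerm⁻¹ * cPerm⁻¹ ∈ _
    rw [← mul_inv_rev, ← pow_two]
    have h1 := wordHom_mem_filt N [] hs
    exact inv_mem (sq_mem_filt_of_le hs hs' (by positivity)
      (by simp only [wordIndex]; push_cast; linarith) h1)
  | succ n ih =>
    obtain _ | N := N
    · exact mul_mem (inv_mem (wordHom_mem _ cPerm_mem))
        (cm_mem_Gam' (pow_mem muPerm_mem _) tauPerm_mem)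
    have hJ : (1 : ℚ) ≤ 2 ^ n := one_le_pow₀ one_le_two
    have h1 := wordHom_mem_filt N (List.replicate n .eight) (s := s / 2) (by linarith)
    rw [wordIndex_replicate_eight] at h1
    push_cast at h1
    have h2 := inv_mul_conj_inv_mem_filt (by linarith) (by linarith) (by linarith) (by linarith)
      (by linarith) (by linarith) h1 (Gam'_le (cm_mem_Gam' (pow_mem muPerm_mem _) tauPerm_mem))
      (pow_mem muPerm_mem (2 ^ n)) (ih N (s := s / 2) (by linarith) (by linarith))
    rw [← cm_inv_left] at h2
    have h3 := eight_hom_mem_filt hs (filt_anti N (n' := (2 ^ (n + 1) + s + 1) / 2)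
      (by rw [pow_succ]; linarith) h2)
    convert h3 using 1
    rw [List.replicate_succ, wordHom_cons, map_mul, map_inv]
    congr 1
    rw [Letter.eight_hom, pow_succ' 2 n, pow_mul, muPerm_sq, pair_pow, inv_pow]
    conv_lhs => rw [tauPerm_eq, cm_pair_odd]
    congr 2
    group

/-- As c = (x⁻¹, x) and x = (τ, μ⁻¹), the sections of [c, x] are conjugates of c and c⁻¹. The
𝟖-component is a product of two conjugates of c, so it behaves like a square. The constant 5/2 is
what the base case of `cm_succWord_mem` requires. -/
theorem cm_cPerm_xPerm_mem (N : ℕ) {s : ℚ} (hs : 0 ≤ s) (hs' : s ≤ 1) :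
    cm cPerm xPerm ∈ filt N s (5 / 2 + s) := by
  obtain _ | N := N
  · exact cm_mem_Gam' (Gam'_le cPerm_mem) xPerm_mem
  have hc : cPerm ∈ filt N (s / 2) (1 + s / 2) := by
    rw [filt_eq_Gam' N (by linarith) le_rfl]; exact cPerm_mem
  have hb : muPerm * cPerm⁻¹ * muPerm⁻¹ ∈ filt N ((1 + s) / 2) ((5 / 2 + s) / 2) := by
    rw [filt_eq_Gam' N (by linarith) (by linarith)]
    exact conj_mem_Gam' muPerm_mem (inv_mem cPerm_mem)
  have hu := conj_mul_conj_mem_filt (m := (5 / 2 + s) / 2) (by linarith) (by linarith)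
    (by linarith) (by linarith) (by linarith) (by linarith) hc
    (mul_mem xPerm_mem (inv_mem tauPerm_mem)) muPerm_mem
  obtain ⟨j, hj⟩ := exists_le_two_pow_mul (n := 5 / 2 + s) (w := 1 + s) (by linarith)
  have := mem_filt_of_blockSet hu hb (dvd_zero _) hj
  convert this using 1
  have e : cm cPerm xPerm = pair (cm xPerm⁻¹ tauPerm, cm xPerm muPerm⁻¹) := by
    conv_lhs => rw [cPerm_eq, xPerm, muPerm_mul_tauPerm]
    rw [cm_pair_pair, ← muPerm_mul_tauPerm]
    rfl
  rw [e, zpow_zero, one_mul, cm_inv_left, cm_xPerm_tauPerm, cm_xPerm_muPerm_inv]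
  congr 2
  group

/-- Consecutive elements `W(c)` commute up to an element of higher weight. -/
theorem cm_succWord_mem (N : ℕ) (W : List Letter) {s : ℚ} (hs : 0 ≤ s) (hs' : s ≤ 1) :
    cm (wordHom W cPerm) (wordHom (succWord W) cPerm) ∈ filt N s (2 * wordIndex W + 3 + s) := by
  induction W generalizing N s with
  | nil =>
    obtain _ | N := N
    · exact cm_mem_Gam' (Gam'_le cPerm_mem) (Gam'_le (wordHom_mem _ cPerm_mem))
    have h1 := cm_cPerm_xPerm_mem N (s := s / 2) (by linarith) (by linarith)
    have h2 := (filtEstimates N).conj_mem' (by linarith) (by linarith) (by linarith) xPerm_mem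
      (inv_mem h1)
    rw [← cm_inv_right] at h2
    have h3 := eight_hom_mem_filt hs (filt_anti N (n' := (2 * wordIndex [] + 3 + s) / 2)
      (by simp only [wordIndex]; push_cast; linarith) (inv_mem h2))
    rw [cm_inv] at h3
    convert h3 using 1
    change cm cPerm (pair (cPerm, 1)) = pair (_, 1)
    have e : cPerm = pair (xPerm⁻¹, xPerm) := cPerm_eq
    rw [congrArg (fun z => cm z (pair (cPerm, 1))) e, cm_pair_pair]
    congr 2
    simp [cm]
  | cons l W ih =>
    obtain _ | N := N
    · exact cm_mem_Gam' (Gam'_le (wordHom_mem _ cPerm_mem)) (Gam'_le (wordHom_mem _ cPerm_mem))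
    cases l
    -- The elements 𝟖(g) = (g, 1) and 𝟗(g) = (g, g) commute. In the other case [(g, g), (g', 1)] =
    -- 𝟖([g, g']), and the induction applies.
    · rw [succWord, wordHom_cons, wordHom_cons, Letter.eight_hom, Letter.nine_hom, cm_pair_pair,
        cm_eq_one_iff.2 (Commute.refl _), cm_eq_one_iff.2 (Commute.one_left _)]
      rw [show ((1 : WordPerm), (1 : WordPerm)) = 1 from rfl, map_one]
      exact one_mem _
    · have h3 := eight_hom_mem_filt hs (filt_anti N (n' := (2 * wordIndex (.nine :: W) + 3 + s) / 2)
        (by simp only [wordIndex]; push_cast; linarith)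
        (ih N (s := s / 2) (by linarith) (by linarith)))
      convert h3 using 1
      rw [succWord, wordHom_cons, wordHom_cons, Letter.eight_hom, Letter.nine_hom, Letter.eight_hom,
        cm_pair_pair, cm_eq_one_iff.2 (Commute.one_right (wordHom W cPerm))]

theorem succWord_inv_mul_cm_mem_dimGam (W : List Letter) {y : WordPerm}
    (hy : y = tauPerm ∨ y = muPerm) :
    (wordHom (succWord W) cPerm)⁻¹ * cm (wordHom W cPerm) y ∈ dimGam (wordIndex W + 3) :=
  mem_dimGam_of_forall_filt (by push_cast; linarith)
    fun N => succWord_inv_mul_cm_mem N W zero_le_one le_rfl hy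

/-- Write [w², y] = v[v, w]v with v = [w, y]. For w = W(c) the expected degree of [v, w] is one too
small; but v agrees with W'(c) modulo higher degree, and `cm_succWord_mem` supplies the missing
unit. The surplus then persists under further squaring. -/
theorem cm_pow_mem_dimGam (W : List Letter) (n : ℕ) {y : WordPerm}
    (hy : y = tauPerm ∨ y = muPerm) :
    cm (wordHom W cPerm ^ 2 ^ (n + 1)) y ∈ dimGam (2 ^ (n + 1) * (wordIndex W + 1) + 2) := by
  have hyG : y ∈ Gam := by rcases hy with rfl | rfl; exacts [tauPerm_mem, muPerm_mem]
  have hw := wordHom_cPerm_mem_dimGam W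
  have step : ∀ {d : ℕ} {w : WordPerm}, w ∈ Gam → cm w y ^ 2 ∈ dimGam d →
      cm (cm w y) w ∈ dimGam d → cm (w * w) y ∈ dimGam d := by
    intro d w hw h1 h2
    have h3 := mul_mem h1 (dimGam_conj (Gam'_le (cm_mem_Gam' hw hyG)) h2)
    rwa [show ∀ v u : WordPerm, v ^ 2 * (v⁻¹ * u * v) = v * u * v by
      intro v u; rw [pow_two]; group, ← cm_mul_self_left] at h3
  have hwG := dimGam_le_Gam _ hw
  rw [pow_two_pow_succ]
  induction n with
  | zero =>
    rw [pow_zero, pow_one]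
    refine step hwG (dimGam_anti (by omega) (sq_mem_dimGam (cm_Gam_mem_dimGam hw hyG))) ?_
    have h1 := succWord_inv_mul_cm_mem_dimGam W hy
    have h2 : cm (wordHom W cPerm) (wordHom (succWord W) cPerm) ∈ dimGam (2 * wordIndex W + 4) :=
      mem_dimGam_of_forall_filt (by push_cast; linarith)
        fun N => cm_succWord_mem N W zero_le_one le_rfl
    have h3 := inv_mem h2
    rw [cm_inv] at h3
    have h4 := mul_mem (dimGam_conj (dimGam_le_Gam _ h1) h3)
      (dimGam_anti (m := 2 * wordIndex W + 4) (by omega) (cm_mem_dimGam h1 hw))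
    rw [← cm_mul_left, mul_inv_cancel_left] at h4
    exact dimGam_anti (by omega) h4
  | succ n ih =>
    rw [← pow_two_pow_succ] at ih
    have h1 := pow_mem_dimGam hw (n + 1)
    have e : 2 ^ (n + 1 + 1) * (wordIndex W + 1) = 2 * (2 ^ (n + 1) * (wordIndex W + 1)) := by ring
    rw [e]
    exact step (pow_mem hwG _) (dimGam_anti (by omega) (sq_mem_dimGam ih))
      (dimGam_anti (by omega) (cm_mem_dimGam ih h1))

end BSV

-- Passage to Lie(Γ): degrees, spanning and brackets

namespace BSV

theorem elt_mem_dimSeries (v : BasisLabel) : v.elt ∈ dimSeries Gam v.deg := by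
  rw [← mem_dimGam_iff]
  have one_mem_dimGam : ∀ {g : WordPerm}, g ∈ Gam → g ∈ dimGam 1 := fun hg => dimGam_one ▸ hg
  cases v with
  | tau n =>
    have h := pow_mem_dimGam (one_mem_dimGam tauPerm_mem) n
    rwa [mul_one] at h
  | mu n =>
    have h := pow_mem_dimGam (one_mem_dimGam muPerm_mem) n
    rwa [mul_one] at h
  | word W n =>
    rw [BasisLabel.deg_word, BasisLabel.elt, Subgroup.coe_pow, coe_wordC]
    exact pow_mem_dimGam (wordHom_cPerm_mem_dimGam W) n

theorem symbol_elt (v : BasisLabel) :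
    DimLie.symbol v.elt = DimLie.cls v.deg ⟨v.elt, elt_mem_dimSeries v⟩ :=
  DimLie.symbol_eq_cls _ (elt_notMem_dimSeries v)

end BSV

theorem dimDegree_eq {G : Type*} [Group G] {g : G} {n : ℕ} (h : g ∈ dimSeries G n)
    (h' : g ∉ dimSeries G (n + 1)) : dimDegree g = n := by
  refine le_antisymm (iSup₂_le fun m hm => ?_) (le_iSup₂_of_le n h le_rfl)
  rw [Nat.cast_le]
  by_contra hlt
  exact h' (dimSeries_antitone G (not_le.1 hlt) hm)

theorem DimLie.cls_eq_zero {G : Type*} [Group G] {n : ℕ} {x : dimSeries G n}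
    (hx : (x : G) ∈ dimSeries G (n + 1)) : DimLie.cls n x = 0 := by
  rw [DimLie.cls, Gr.mk_eq_zero.2 hx, map_zero]

theorem DimLie.cls_eq_of_inv_mul_mem {G : Type*} [Group G] {n : ℕ} {x y : dimSeries G n}
    (h : (x : G)⁻¹ * y ∈ dimSeries G (n + 1)) : DimLie.cls n x = DimLie.cls n y := by
  rw [DimLie.cls, DimLie.cls, Gr.mk_eq_mk.2 (QuotientGroup.eq.2 h)]

namespace BSV

/-- The span of the elements of `Lie(Γ)` represented by the labels. -/
noncomputable def symbolSpan : Submodule (ZMod 2) (DimLie Gam) :=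
  Submodule.span (ZMod 2) (Set.range fun v : BasisLabel => DimLie.symbol v.elt)

/-- The elements of `Γₙ` whose class lies in the span of the elements represented by the labels. -/
def spanned (n : ℕ) : Subgroup WordPerm :=
  Subgroup.map Gam.subtype <| Subgroup.map (dimSeries Gam n).subtype
    { carrier := {x | DimLie.cls n x ∈ symbolSpan}
      mul_mem' := fun {x y} hx hy => by
        rw [Set.mem_ofPred_eq, DimLie.cls_mul]
        exact add_mem hx hy
      one_mem' := by
        rw [Set.mem_ofPred_eq, DimLie.cls_eq_zero (one_mem _)]
        exact zero_mem _
      inv_mem' := fun {x} hx => by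
        rw [Set.mem_ofPred_eq, DimLie.cls_inv]
        exact hx }

theorem coe_mem_spanned {n : ℕ} {x : dimSeries Gam n} :
    ((x : Gam) : WordPerm) ∈ spanned n ↔ DimLie.cls n x ∈ symbolSpan :=
  (Subgroup.mem_map_iff_mem Gam.subtype_injective).trans
    (Subgroup.mem_map_iff_mem (dimSeries Gam n).subtype_injective)

theorem dimGam_succ_le_spanned (n : ℕ) : dimGam (n + 1) ≤ spanned n := by
  rintro _ ⟨g, hg, rfl⟩
  refine (coe_mem_spanned (x := ⟨g, dimSeries_succ_le Gam n hg⟩)).2 ?_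
  rw [DimLie.cls_eq_zero hg]
  exact zero_mem _

theorem elt_mem_spanned {n : ℕ} {v : BasisLabel} (h : n ≤ v.deg) :
    (v.elt : WordPerm) ∈ spanned n := by
  rcases h.lt_or_eq with h | rfl
  · exact dimGam_succ_le_spanned n (dimGam_anti h (mem_dimGam_iff.2 (elt_mem_dimSeries v)))
  · refine (coe_mem_spanned (x := ⟨v.elt, elt_mem_dimSeries v⟩)).2 ?_
    rw [← symbol_elt]
    exact Submodule.subset_span ⟨v, rfl⟩

/-- The normal form is used at depth N = n: words of length n take values in Γₙ₊₂ and vanish in the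
quotient, so only powers of τ, of μ and of W(c) for shorter W remain. -/
theorem cls_mem_symbolSpan (n : ℕ) (x : dimSeries Gam n) : DimLie.cls n x ∈ symbolSpan := by
  rw [← coe_mem_spanned]
  obtain ⟨i, j, v, ⟨i, rfl⟩, ⟨j, rfl⟩, hv, d, hd, e⟩ := inDelta_of_mem_dimSeries n n x.2
  rw [e]
  refine mul_mem (mul_mem ?_ ?_) (filt_le_of_words (fun W hW g hg => ?_) (fun W _ k hk => ?_) hd)
  · rw [zpow_mul]
    exact zpow_mem (by exact_mod_cast elt_mem_spanned (v := .tau v) hv) _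
  · rw [zpow_mul]
    exact zpow_mem (by exact_mod_cast elt_mem_spanned (v := .mu v) hv) _
  · exact dimGam_succ_le_spanned n (dimGam_anti (by omega) (wordHom_mem_dimGam W hg))
  · have h := elt_mem_spanned (n := n) (v := .word W k)
      (by rw [BasisLabel.deg_word]; exact_mod_cast hk)
    rwa [BasisLabel.elt, Subgroup.coe_pow, coe_wordC] at h

theorem symbolSpan_eq_top : symbolSpan = ⊤ := by
  rw [Submodule.eq_top_iff']
  intro x
  induction x using DimLie.induction with
  | h0 => exact zero_mem _
  | hc n g => exact cls_mem_symbolSpan n g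
  | ha x y hx hy => exact add_mem hx hy

theorem frobenius_symbol_elt (v : BasisLabel) :
    DimLie.frobenius (DimLie.symbol v.elt) = DimLie.symbol v.double.elt := by
  have hd : 2 * v.deg = v.double.deg := by
    cases v <;> simp only [BasisLabel.deg, BasisLabel.double, pow_succ] <;> ring
  have he : v.elt ^ 2 = v.double.elt := by
    cases v <;> simp only [BasisLabel.elt, BasisLabel.double, pow_succ, pow_mul]
  rw [symbol_elt, DimLie.cls, DimLie.frobenius_of, grFrobenius_mk]
  change DimLie.cls (2 * v.deg) ⟨v.elt ^ 2, _⟩ = _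
  rw [DimLie.symbol_eq_cls (n := 2 * v.deg) (hd ▸ elt_mem_dimSeries v.double)
    (hd ▸ elt_notMem_dimSeries v.double)]
  congr 2

theorem bracket_symbol_elt_eq_symbol {u v w : BasisLabel} (hd : w.deg = u.deg + v.deg)
    (h : (w.elt : WordPerm)⁻¹ * cm (u.elt : WordPerm) v.elt ∈ dimGam (w.deg + 1)) :
    ⁅DimLie.symbol u.elt, DimLie.symbol v.elt⁆ = DimLie.symbol w.elt := by
  rw [symbol_elt u, symbol_elt v, DimLie.cls_bracket_cls,
    DimLie.symbol_eq_cls (n := u.deg + v.deg) (hd ▸ elt_mem_dimSeries w)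
      (hd ▸ elt_notMem_dimSeries w)]
  rw [hd] at h
  exact (DimLie.cls_eq_of_inv_mul_mem (mem_dimGam_iff.1 h)).symm

theorem bracket_symbol_elt_eq_zero {u v : BasisLabel}
    (h : cm (u.elt : WordPerm) v.elt ∈ dimGam (u.deg + v.deg + 1)) :
    ⁅DimLie.symbol u.elt, DimLie.symbol v.elt⁆ = 0 := by
  rw [symbol_elt u, symbol_elt v, DimLie.cls_bracket_cls]
  exact DimLie.cls_eq_zero (mem_dimGam_iff.1 h)

theorem elt_tau_zero : (BasisLabel.tau 0).elt = tau := by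
  rw [BasisLabel.elt, pow_zero, pow_one]

theorem elt_mu_zero : (BasisLabel.mu 0).elt = mu := by
  rw [BasisLabel.elt, pow_zero, pow_one]

theorem elt_word_zero (W : List Letter) : (BasisLabel.word W 0).elt = wordC W := by
  rw [BasisLabel.elt, pow_zero, pow_one]

theorem exists_label {x : Gam} (hx : x ∈ ({tau, mu} : Set Gam)) :
    ∃ v : BasisLabel, v.elt = x ∧ v.deg = 1 ∧
      ((x : WordPerm) = tauPerm ∨ (x : WordPerm) = muPerm) := by
  rcases hx with rfl | rfl
  exacts [⟨.tau 0, elt_tau_zero, rfl, Or.inl rfl⟩, ⟨.mu 0, elt_mu_zero, rfl, Or.inr rfl⟩]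

theorem bracket_symbol_tau_pow_mu (n : ℕ) :
    ⁅DimLie.symbol (tau ^ 2 ^ n), DimLie.symbol mu⁆ =
      DimLie.symbol (wordC (List.replicate n .eight)) := by
  rw [← elt_word_zero, ← elt_mu_zero]
  refine bracket_symbol_elt_eq_symbol (u := .tau n) ?_ ?_ <;>
    rw [BasisLabel.deg_word, wordIndex_replicate_eight, pow_zero, one_mul]
  · rfl
  · rw [elt_word_zero, coe_wordC, elt_mu_zero]
    exact mem_dimGam_of_forall_filt (by push_cast; linarith)
      fun N => replicate_inv_mul_cm_tauPerm_mem N n zero_le_one le_rfl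

theorem bracket_symbol_mu_pow_tau (n : ℕ) :
    ⁅DimLie.symbol (mu ^ 2 ^ n), DimLie.symbol tau⁆ =
      DimLie.symbol (wordC (List.replicate n .eight)) := by
  rw [← elt_word_zero, ← elt_tau_zero]
  refine bracket_symbol_elt_eq_symbol (u := .mu n) ?_ ?_ <;>
    rw [BasisLabel.deg_word, wordIndex_replicate_eight, pow_zero, one_mul]
  · rfl
  · rw [elt_word_zero, coe_wordC, elt_tau_zero]
    exact mem_dimGam_of_forall_filt (by push_cast; linarith)
      fun N => replicate_inv_mul_cm_muPerm_mem N n zero_le_one le_rfl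

theorem bracket_symbol_wordC {x : Gam} (hx : x ∈ ({tau, mu} : Set Gam)) (W : List Letter) :
    ⁅DimLie.symbol (wordC W), DimLie.symbol x⁆ = DimLie.symbol (wordC (succWord W)) := by
  obtain ⟨v, rfl, hv, hx⟩ := exists_label hx
  rw [← elt_word_zero, ← elt_word_zero]
  refine bracket_symbol_elt_eq_symbol ?_ ?_
  · rw [hv, BasisLabel.deg_word, BasisLabel.deg_word, wordIndex_succWord]
    ring
  · rw [elt_word_zero, elt_word_zero, coe_wordC, coe_wordC, BasisLabel.deg_word,
      wordIndex_succWord, pow_zero, one_mul]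
    exact succWord_inv_mul_cm_mem_dimGam W hx

theorem bracket_symbol_wordC_pow {x : Gam} (hx : x ∈ ({tau, mu} : Set Gam)) (W : List Letter)
    (n : ℕ) : ⁅DimLie.symbol (wordC W ^ 2 ^ (n + 1)), DimLie.symbol x⁆ = 0 := by
  obtain ⟨v, rfl, hv, hx⟩ := exists_label hx
  refine bracket_symbol_elt_eq_zero (u := .word W (n + 1)) ?_
  rw [hv, BasisLabel.deg_word, BasisLabel.elt, Subgroup.coe_pow, coe_wordC]
  exact cm_pow_mem_dimGam W n hx

theorem bracket_symbol_elt_of_commute {u v : BasisLabel} (h : Commute u.elt v.elt) :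
    ⁅DimLie.symbol u.elt, DimLie.symbol v.elt⁆ = 0 := by
  refine bracket_symbol_elt_eq_zero ?_
  exact cm_eq_one_iff.2 (h.map Gam.subtype) ▸ one_mem (dimGam (u.deg + v.deg + 1))

/-- Adding 1 to a binary number, least significant digit first: a block of ones carries through,
here up to a new leading digit. -/
theorem succWord_replicate_nine (n : ℕ) :
    succWord (List.replicate n .nine) = List.replicate (n + 1) .eight := by
  induction n with
  | zero => rfl
  | succ n ih => rw [List.replicate_succ, succWord, ih]; rfl

theorem succWord_replicate_nine_append (n : ℕ) (W : List Letter) :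
    succWord (List.replicate n .nine ++ .eight :: W) = List.replicate n .eight ++ .nine :: W := by
  induction n with
  | zero => rfl
  | succ n ih => rw [List.replicate_succ, List.cons_append, succWord, ih]; rfl

end BSV

theorem mainTheorem2 :
    -- the degrees
    (∀ v : BSV.BasisLabel, dimDegree v.elt = (v.deg : ℕ∞)) ∧
    -- the basis
    (∃ b : Module.Basis BSV.BasisLabel (ZMod 2) (DimLie BSV.Gam),
      ∀ v : BSV.BasisLabel, b v = DimLie.symbol v.elt) ∧
    -- the arrows labelled `2`
    (∀ v : BSV.BasisLabel,
      DimLie.frobenius (DimLie.symbol v.elt) = DimLie.symbol v.double.elt) ∧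
    -- the arrows labelled `τ` and `μ` from the powers of `τ` and `μ`
    (∀ n : ℕ, ⁅DimLie.symbol (BSV.tau ^ 2 ^ n), DimLie.symbol BSV.mu⁆ =
        DimLie.symbol (BSV.wordC (List.replicate n .eight)) ∧
      ⁅DimLie.symbol (BSV.mu ^ 2 ^ n), DimLie.symbol BSV.tau⁆ =
        DimLie.symbol (BSV.wordC (List.replicate n .eight))) ∧
    -- the arrows labelled `τ` and `μ` from the elements `W(c)`
    (∀ x ∈ ({BSV.tau, BSV.mu} : Set BSV.Gam), ∀ n : ℕ,
      ⁅DimLie.symbol (BSV.wordC (List.replicate n .nine)), DimLie.symbol x⁆ =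
        DimLie.symbol (BSV.wordC (List.replicate (n + 1) .eight)) ∧
      ∀ W : List BSV.Letter,
        ⁅DimLie.symbol (BSV.wordC (List.replicate n .nine ++ .eight :: W)), DimLie.symbol x⁆ =
          DimLie.symbol (BSV.wordC (List.replicate n .eight ++ .nine :: W))) ∧
    -- there are no other arrows
    (∀ n : ℕ, ⁅DimLie.symbol (BSV.tau ^ 2 ^ n), DimLie.symbol BSV.tau⁆ = 0 ∧
      ⁅DimLie.symbol (BSV.mu ^ 2 ^ n), DimLie.symbol BSV.mu⁆ = 0) ∧
    (∀ x ∈ ({BSV.tau, BSV.mu} : Set BSV.Gam), ∀ (W : List BSV.Letter) (n : ℕ),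
      ⁅DimLie.symbol (BSV.wordC W ^ 2 ^ (n + 1)), DimLie.symbol x⁆ = 0) :=
  ⟨fun v => dimDegree_eq (BSV.elt_mem_dimSeries v) (BSV.elt_notMem_dimSeries v),
    ⟨Module.Basis.mk (BSV.linearIndependent_symbol_elt BSV.elt_mem_dimSeries)
      BSV.symbolSpan_eq_top.ge, fun v => Module.Basis.mk_apply _ _ v⟩,
    BSV.frobenius_symbol_elt,
    fun n => ⟨BSV.bracket_symbol_tau_pow_mu n, BSV.bracket_symbol_mu_pow_tau n⟩,
    fun _ hx n =>
      ⟨BSV.succWord_replicate_nine n ▸ BSV.bracket_symbol_wordC hx _,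
        fun W => BSV.succWord_replicate_nine_append n W ▸ BSV.bracket_symbol_wordC hx _⟩,
    fun n =>
      ⟨BSV.elt_tau_zero ▸ BSV.bracket_symbol_elt_of_commute (u := .tau n) (v := .tau 0)
          (Commute.pow_pow_self _ _ _),
        BSV.elt_mu_zero ▸ BSV.bracket_symbol_elt_of_commute (u := .mu n) (v := .mu 0)
          (Commute.pow_pow_self _ _ _)⟩,
    fun _ hx W n => BSV.bracket_symbol_wordC_pow hx W n⟩
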